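/- Let $d\ge 0$ be an integer. There are a constant $C$ and an algorithm $\mathcal A$ for the real RAM, both depending only on $d$, such that the following holds for every integer $n\ge 0$, every family $D=\{D_1,\dots,D_n\}$ of $n$ pairwise disjoint closed Euclidean balls in $\mathbb{R}^d$ of arbitrary radii (radius $0$, i.e. a single point, is allowed), and every real number $t>1$. There is an imprecise $t$-spanner $G=(D,E)$ for $D$ with $$|E|\le C\Bigl(n+\frac{n}{(t-1)^d}\Bigr)$$ edges, and on input $n$, $t$ and the centres and radii of the balls, $\mathcal A$ lists the edges of $G$, each exactly once, in time at most $$C\Bigl(1+n\log n+\frac{n}{(t-1)^d}\Bigr).$$ In particular, for $n\ge 2$ the running time is $O(n\log n+n/(t-1)^d)$, and for $t$ in any bounded range $1<t\le T$ the number of edges is $O(n/(t-1)^d)$. Here an imprecise $t$-spanner for $D$ is a graph $G=(D,E)$ on the balls such that for every choice of points $p_i\in D_i$ $(1\le i\le n)$ the geometric graph with vertices $p_1,\dots,p_n$ and an edge of length $|p_ip_j|$ for each $\{D_i,D_j\}\in E$ is a $t$-spanner, i.e. for all $i\ne j$ it contains a path from $p_i$ to $p_j$ of total length at most $t\,|p_ip_j|$.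 The real RAM is the unit-cost random access machine with indirect addressing whose cells hold natural numbers (operations $+$, truncated $-$, comparison) or real numbers (operations $+,-,\times,\div$, comparison); it has no floor function, and programs contain only rational constants. -/

import Mathlib

open scoped ENNReal

/-! ### Geometric graphs, spanners and imprecise spanners -/

section Spanner

variable {ι X : Type*} [MetricSpace X]

/-- Euclidean length of a walk in the geometric graph whose vertex `i` is placed at `p i`. -/
noncomputable def walkLength (G : SimpleGraph ι) (p : ι → X) {i j : ι} (w : G.Walk i j) : ℝ≥0∞ :=
  (w.darts.map fun e => edist (p e.fst) (p e.snd)).sum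

/-- The graph distance: the least length of a walk from `i` to `j` (`∞` if there is none).
Deleting closed sub-walks does not increase the length, so this is also the length of a
shortest path. -/
noncomputable def graphDist (G : SimpleGraph ι) (p : ι → X) (i j : ι) : ℝ≥0∞ :=
  ⨅ w : G.Walk i j, walkLength G p w

/-- The dilation: graph distance divided by the distance of the two points. -/
noncomputable def dilation (G : SimpleGraph ι) (p : ι → X) (i j : ι) : ℝ≥0∞ :=
  graphDist G p i j / edist (p i) (p j)

/-- The geometric graph with vertices `p i` and edges given by `G` is a `t`-spanner. -/
def IsSpanner (t : ℝ) (G : SimpleGraph ι) (p : ι → X) : Prop :=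
  ∀ i j, p i ≠ p j → dilation G p i j ≤ ENNReal.ofReal t

/-- `G`, a graph on the regions `R i`, is an imprecise `t`-spanner: every choice of one point in
each region turns it into a geometric `t`-spanner. -/
def IsImpreciseSpanner (t : ℝ) (R : ι → Set X) (G : SimpleGraph ι) : Prop :=
  ∀ p : ι → X, (∀ i, p i ∈ R i) → IsSpanner t G p

end Spanner

/-! ### The real RAM

A random access machine with natural-number cells (for counters and pointers; operations `+` and
truncated `-`, comparison) and real-number cells (operations `+`, `-`, `*`, `/`, comparison).
There is no rounding and no other conversion from reals to integers, there are no bit operations,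
and the only constants in a program are natural and rational numbers.  Memory is organised in
finitely many registers and arrays that are named in the program; arrays are addressed indirectly.
Every elementary operation costs one unit of time.  Programs are finite and structured. -/

namespace RealRAM

/-- Memory contents and the list of pairs output so far (latest first). -/
structure State where
  nreg : ℕ → ℕ
  rreg : ℕ → ℝ
  narr : ℕ → ℕ → ℕ
  rarr : ℕ → ℕ → ℝ
  out : List (ℕ × ℕ)

/-- Expressions with values in the natural numbers. -/
inductive NExp where
  | const (k : ℕ)
  | reg (x : ℕ)
  | read (a : ℕ) (i : NExp)
  | add (e f : NExp)
  | sub (e f : NExp)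

/-- Expressions with values in the real numbers. -/
inductive RExp where
  | const (q : ℚ)
  | reg (x : ℕ)
  | read (a : ℕ) (i : NExp)
  | add (e f : RExp)
  | sub (e f : RExp)
  | mul (e f : RExp)
  | div (e f : RExp)

/-- Tests. -/
inductive Test where
  | nlt (e f : NExp)
  | rlt (e f : RExp)
  | not (b : Test)
  | and (b c : Test)

/-- Programs. -/
inductive Cmd where
  | skip
  | setN (x : ℕ) (e : NExp)
  | setR (x : ℕ) (e : RExp)
  | writeN (a : ℕ) (i e : NExp)
  | writeR (a : ℕ) (i : NExp) (e : RExp)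
  | emit (e f : NExp)
  | seq (P Q : Cmd)
  | ite (b : Test) (P Q : Cmd)
  | loop (b : Test) (P : Cmd)

def NExp.eval (s : State) : NExp → ℕ
  | .const k => k
  | .reg x => s.nreg x
  | .read a i => s.narr a (i.eval s)
  | .add e f => e.eval s + f.eval s
  | .sub e f => e.eval s - f.eval s

/-- Number of elementary operations in the evaluation of an expression. -/
def NExp.cost : NExp → ℕ
  | .const _ => 1
  | .reg _ => 1
  | .read _ i => i.cost + 1
  | .add e f => e.cost + f.cost + 1
  | .sub e f => e.cost + f.cost + 1

/-- Division by zero returns zero; a program could as well test the divisor first. -/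
noncomputable def RExp.eval (s : State) : RExp → ℝ
  | .const q => (q : ℝ)
  | .reg x => s.rreg x
  | .read a i => s.rarr a (i.eval s)
  | .add e f => e.eval s + f.eval s
  | .sub e f => e.eval s - f.eval s
  | .mul e f => e.eval s * f.eval s
  | .div e f => e.eval s / f.eval s

def RExp.cost : RExp → ℕ
  | .const _ => 1
  | .reg _ => 1
  | .read _ i => i.cost + 1
  | .add e f => e.cost + f.cost + 1
  | .sub e f => e.cost + f.cost + 1
  | .mul e f => e.cost + f.cost + 1
  | .div e f => e.cost + f.cost + 1

def Test.Holds (s : State) : Test → Prop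
  | .nlt e f => e.eval s < f.eval s
  | .rlt e f => e.eval s < f.eval s
  | .not b => ¬ b.Holds s
  | .and b c => b.Holds s ∧ c.Holds s

def Test.cost : Test → ℕ
  | .nlt e f => e.cost + f.cost + 1
  | .rlt e f => e.cost + f.cost + 1
  | .not b => b.cost + 1
  | .and b c => b.cost + c.cost + 1

/-- `Exec P s s' k`: started in state `s`, the program `P` halts in state `s'` after `k` time
units. -/
inductive Exec : Cmd → State → State → ℕ → Prop
  | skip (s : State) : Exec .skip s s 1
  | setN (s : State) (x : ℕ) (e : NExp) :
      Exec (.setN x e) s { s with nreg := Function.update s.nreg x (e.eval s) } (e.cost + 1)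
  | setR (s : State) (x : ℕ) (e : RExp) :
      Exec (.setR x e) s { s with rreg := Function.update s.rreg x (e.eval s) } (e.cost + 1)
  | writeN (s : State) (a : ℕ) (i e : NExp) :
      Exec (.writeN a i e) s
        { s with narr := Function.update s.narr a
                  (Function.update (s.narr a) (i.eval s) (e.eval s)) }
        (i.cost + e.cost + 1)
  | writeR (s : State) (a : ℕ) (i : NExp) (e : RExp) :
      Exec (.writeR a i e) s
        { s with rarr := Function.update s.rarr a
                  (Function.update (s.rarr a) (i.eval s) (e.eval s)) }
        (i.cost + e.cost + 1)
  | emit (s : State) (e f : NExp) :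
      Exec (.emit e f) s { s with out := (e.eval s, f.eval s) :: s.out } (e.cost + f.cost + 1)
  | seq {P Q : Cmd} {s s₁ s₂ : State} {k₁ k₂ : ℕ} (h₁ : Exec P s s₁ k₁) (h₂ : Exec Q s₁ s₂ k₂) :
      Exec (.seq P Q) s s₂ (k₁ + k₂)
  | iteTrue {b : Test} {P Q : Cmd} {s s' : State} {k : ℕ} (hb : b.Holds s) (h : Exec P s s' k) :
      Exec (.ite b P Q) s s' (b.cost + k + 1)
  | iteFalse {b : Test} {P Q : Cmd} {s s' : State} {k : ℕ} (hb : ¬ b.Holds s)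
      (h : Exec Q s s' k) : Exec (.ite b P Q) s s' (b.cost + k + 1)
  | loopTrue {b : Test} {P : Cmd} {s s₁ s₂ : State} {k₁ k₂ : ℕ} (hb : b.Holds s)
      (h₁ : Exec P s s₁ k₁) (h₂ : Exec (.loop b P) s₁ s₂ k₂) :
      Exec (.loop b P) s s₂ (b.cost + k₁ + k₂ + 1)
  | loopFalse {b : Test} {P : Cmd} {s : State} (hb : ¬ b.Holds s) :
      Exec (.loop b P) s s (b.cost + 1)

/-- The start state for the balls with centres `c i` and radii `r i` and the stretch factor `t`:
register `0` holds `n`, real register `0` holds `t`, real array `a < d` holds the `a`-th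
coordinates of the centres, real array `d` holds the radii; all other cells hold `0`, and nothing
has been output. -/
noncomputable def inputState {d n : ℕ} (c : Fin n → EuclideanSpace ℝ (Fin d)) (r : Fin n → ℝ)
    (t : ℝ) : State where
  nreg x := if x = 0 then n else 0
  rreg x := if x = 0 then t else 0
  narr _ _ := 0
  rarr a i :=
    if hi : i < n then
      if ha : a < d then c ⟨i, hi⟩ ⟨a, ha⟩ else if a = d then r ⟨i, hi⟩ else 0
    else 0
  out := []

/-- The output list contains each edge of `G` exactly once, as a pair of the indices of its two
ends in one of the two orders, and it contains nothing else. -/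
def ListsEdges {n : ℕ} (out : List (ℕ × ℕ)) (G : SimpleGraph (Fin n)) : Prop :=
  (out.map fun e => s(e.1, e.2)).Nodup ∧
  (∀ e ∈ out, ∃ i j : Fin n, G.Adj i j ∧ e = ((i : ℕ), (j : ℕ))) ∧
  ∀ i j : Fin n, G.Adj i j → ((i : ℕ), (j : ℕ)) ∈ out ∨ ((j : ℕ), (i : ℕ)) ∈ out

end RealRAM

set_option linter.unusedSimpArgs false

/-! The spanner comes from a well-separated pair decomposition of the centres, with one edge between
representatives for each pair.

Geometry. The centres are organised in a split tree: a node with longest side `EL > 0` is cut at the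
midpoint of that side, and a leaf has `EL = 0` and contains one centre. If a node contains two
centres, each of its balls is disjoint from another one, so its radius is at most `d * EL`; hence
all admissible points of the node lie within `RHO = 3/2 * d * EL` of the box centre. For a leaf,
`RHO` is the radius of its ball. Two nodes are `Far` if their regions are separated by at least `τ`
times the larger `EL`. Only `EL` is multiplied by `τ`, so two leaves are always far, however large
their balls are. With `τ = 18 * d / (t - 1)`, replacing two points by the representatives of a far
pair costs a factor `(t - 1) / 6` of their distance (`FairTree.approx`), and induction on the
distance gives stretch `t` as long as `t ≤ 2` (`graphDist_le_of_approx`); larger `t` are replaced by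
`2`.

Size. Starting with the sibling pairs, the bigger node of each pair that is not far is split.
`PairQueue` records that every two balls are covered exactly once, so each split uses up its own
element of `crossings`. For a fixed bigger node `a` the partners are counted by volume: partners
with a small region own separated cubes of side `EL a / 2` near `a`
(`FairTree.card_crossing_small`), while those with a large region are leaves, whose balls contain
disjoint balls of radius `τ * EL a` near `a` (`FairTree.card_crossing_big`). This gives `O(n + n /
(t - 1) ^ d)` pairs.

Time. The tree is built from lists sorted in every coordinate. A split scans the list from both
ends, so it costs only as much as the side that occupies fewer positions; that side gets a new
label, and the work continues with the other side until it is a leaf. Then one pass distributes the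
relabelled elements to new sorted lists. Each new list has at most half of the old size, so a credit
of `m * (log m + 1)` for a list of size `m` pays for everything (`sum_credit_le`,
`RealRAM.processList_spec`). -/

namespace RealRAM

-- Rules for reasoning about runs of programs

attribute [simp] NExp.eval NExp.cost RExp.eval RExp.cost Test.Holds Test.cost

/-- `P` halts when started in `s`, and the final state and running time satisfy `Q`. -/
def Run (P : Cmd) (s : State) (Q : State → ℕ → Prop) : Prop :=
  ∃ s' k, Exec P s s' k ∧ Q s' k

theorem Run.mono {P : Cmd} {s : State} {Q R : State → ℕ → Prop} (h : Run P s Q)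
    (hQ : ∀ s' k, Q s' k → R s' k) : Run P s R := by
  obtain ⟨s', k, he, hq⟩ := h
  exact ⟨s', k, he, hQ _ _ hq⟩

/-- With the postcondition replaced by a variable, symbolic execution by `simp` cannot rewrite
inside it; the real postcondition is supplied at the end of each branch. -/
theorem Run.of_forall {P : Cmd} {s : State} {Q : State → ℕ → Prop}
    (h : ∀ R : State → ℕ → Prop, (∀ s' k, Q s' k → R s' k) → Run P s R) : Run P s Q :=
  h Q fun _ _ => id

@[simp] theorem run_skip {s : State} {Q : State → ℕ → Prop} : Run .skip s Q ↔ Q s 1 :=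
  ⟨fun ⟨_, _, he, hq⟩ => by cases he; exact hq, fun h => ⟨_, _, .skip s, h⟩⟩

@[simp] theorem run_setN {x : ℕ} {e : NExp} {s : State} {Q : State → ℕ → Prop} :
    Run (.setN x e) s Q ↔
      Q { s with nreg := Function.update s.nreg x (e.eval s) } (e.cost + 1) :=
  ⟨fun ⟨_, _, he, hq⟩ => by cases he; exact hq, fun h => ⟨_, _, .setN s x e, h⟩⟩

@[simp] theorem run_setR {x : ℕ} {e : RExp} {s : State} {Q : State → ℕ → Prop} :
    Run (.setR x e) s Q ↔
      Q { s with rreg := Function.update s.rreg x (e.eval s) } (e.cost + 1) :=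
  ⟨fun ⟨_, _, he, hq⟩ => by cases he; exact hq, fun h => ⟨_, _, .setR s x e, h⟩⟩

@[simp] theorem run_writeN {a : ℕ} {i e : NExp} {s : State} {Q : State → ℕ → Prop} :
    Run (.writeN a i e) s Q ↔
      Q
        { s with narr := Function.update s.narr a
                  (Function.update (s.narr a) (i.eval s) (e.eval s)) } (i.cost + e.cost + 1) :=
  ⟨fun ⟨_, _, he, hq⟩ => by cases he; exact hq, fun h => ⟨_, _, .writeN s a i e, h⟩⟩

@[simp] theorem run_writeR {a : ℕ} {i : NExp} {e : RExp} {s : State} {Q : State → ℕ → Prop} :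
    Run (.writeR a i e) s Q ↔
      Q
        { s with rarr := Function.update s.rarr a
                  (Function.update (s.rarr a) (i.eval s) (e.eval s)) } (i.cost + e.cost + 1) :=
  ⟨fun ⟨_, _, he, hq⟩ => by cases he; exact hq, fun h => ⟨_, _, .writeR s a i e, h⟩⟩

@[simp] theorem run_emit {e f : NExp} {s : State} {Q : State → ℕ → Prop} :
    Run (.emit e f) s Q ↔
      Q { s with out := (e.eval s, f.eval s) :: s.out } (e.cost + f.cost + 1) :=
  ⟨fun ⟨_, _, he, hq⟩ => by cases he; exact hq, fun h => ⟨_, _, .emit s e f, h⟩⟩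

@[simp] theorem run_seq {P R : Cmd} {s : State} {Q : State → ℕ → Prop} :
    Run (.seq P R) s Q ↔ Run P s fun s₁ k₁ => Run R s₁ fun s₂ k₂ => Q s₂ (k₁ + k₂) := by
  constructor
  · rintro ⟨_, _, he, hq⟩
    cases he with
    | seq h₁ h₂ => exact ⟨_, _, h₁, _, _, h₂, hq⟩
  · rintro ⟨_, _, h₁, _, _, h₂, hq⟩
    exact ⟨_, _, .seq h₁ h₂, hq⟩

@[simp] theorem run_ite {b : Test} {P R : Cmd} {s : State} {Q : State → ℕ → Prop} :
    Run (.ite b P R) s Q ↔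
      (b.Holds s → Run P s fun s' k => Q s' (b.cost + k + 1)) ∧
      (¬ b.Holds s → Run R s fun s' k => Q s' (b.cost + k + 1)) := by
  constructor
  · rintro ⟨_, _, he, hq⟩
    cases he with
    | iteTrue hb h => exact ⟨fun _ => ⟨_, _, h, hq⟩, fun hn => absurd hb hn⟩
    | iteFalse hb h => exact ⟨fun hn => absurd hn hb, fun _ => ⟨_, _, h, hq⟩⟩
  · rintro ⟨h₁, h₂⟩
    by_cases hb : b.Holds s
    · obtain ⟨_, _, h, hq⟩ := h₁ hb
      exact ⟨_, _, .iteTrue hb h, hq⟩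
    · obtain ⟨_, _, h, hq⟩ := h₂ hb
      exact ⟨_, _, .iteFalse hb h, hq⟩

/-! ### Footprints -/

/-- `P` may write the natural-number register `y`. -/
@[simp] def Cmd.WritesN : Cmd → ℕ → Prop
  | .setN x _, y => y = x
  | .seq P Q, y => P.WritesN y ∨ Q.WritesN y
  | .ite _ P Q, y => P.WritesN y ∨ Q.WritesN y
  | .loop _ P, y => P.WritesN y
  | _, _ => False

/-- `P` may write the real register `y`. -/
@[simp] def Cmd.WritesR : Cmd → ℕ → Prop
  | .setR x _, y => y = x
  | .seq P Q, y => P.WritesR y ∨ Q.WritesR y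
  | .ite _ P Q, y => P.WritesR y ∨ Q.WritesR y
  | .loop _ P, y => P.WritesR y
  | _, _ => False

/-- `P` may write to the natural-number array `y`. -/
@[simp] def Cmd.WritesNArr : Cmd → ℕ → Prop
  | .writeN a _ _, y => y = a
  | .seq P Q, y => P.WritesNArr y ∨ Q.WritesNArr y
  | .ite _ P Q, y => P.WritesNArr y ∨ Q.WritesNArr y
  | .loop _ P, y => P.WritesNArr y
  | _, _ => False

/-- `P` may write to the real array `y`. -/
@[simp] def Cmd.WritesRArr : Cmd → ℕ → Prop
  | .writeR a _ _, y => y = a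
  | .seq P Q, y => P.WritesRArr y ∨ Q.WritesRArr y
  | .ite _ P Q, y => P.WritesRArr y ∨ Q.WritesRArr y
  | .loop _ P, y => P.WritesRArr y
  | _, _ => False

/-- `P` may produce output. -/
@[simp] def Cmd.Emits : Cmd → Prop
  | .emit _ _ => True
  | .seq P Q => P.Emits ∨ Q.Emits
  | .ite _ P Q => P.Emits ∨ Q.Emits
  | .loop _ P => P.Emits
  | _ => False

/-- The states differ at most where `P` may write. -/
structure Frame (P : Cmd) (s s' : State) : Prop where
  n : ∀ y, ¬ P.WritesN y → s'.nreg y = s.nreg y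
  r : ∀ y, ¬ P.WritesR y → s'.rreg y = s.rreg y
  na : ∀ y, ¬ P.WritesNArr y → s'.narr y = s.narr y
  ra : ∀ y, ¬ P.WritesRArr y → s'.rarr y = s.rarr y
  out : ¬ P.Emits → s'.out = s.out

theorem Frame.refl (P : Cmd) (s : State) : Frame P s s :=
  ⟨fun _ _ => rfl, fun _ _ => rfl, fun _ _ => rfl, fun _ _ => rfl, fun _ => rfl⟩

theorem Frame.trans {P : Cmd} {s s₁ s₂ : State} (h₁ : Frame P s s₁) (h₂ : Frame P s₁ s₂) :
    Frame P s s₂ :=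
  ⟨fun y hy => (h₂.n y hy).trans (h₁.n y hy), fun y hy => (h₂.r y hy).trans (h₁.r y hy),
    fun y hy => (h₂.na y hy).trans (h₁.na y hy), fun y hy => (h₂.ra y hy).trans (h₁.ra y hy),
    fun hy => (h₂.out hy).trans (h₁.out hy)⟩

theorem Frame.weaken {P R : Cmd} {s s' : State} (h : Frame P s s')
    (hn : ∀ y, P.WritesN y → R.WritesN y) (hr : ∀ y, P.WritesR y → R.WritesR y)
    (hna : ∀ y, P.WritesNArr y → R.WritesNArr y) (hra : ∀ y, P.WritesRArr y → R.WritesRArr y)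
    (ho : P.Emits → R.Emits) : Frame R s s' :=
  ⟨fun y hy => h.n y (mt (hn y) hy), fun y hy => h.r y (mt (hr y) hy),
    fun y hy => h.na y (mt (hna y) hy), fun y hy => h.ra y (mt (hra y) hy),
    fun hy => h.out (mt ho hy)⟩

/-- The footprint is syntactic, so invariants of loops need to mention only those cells that the
loop changes. -/
theorem Exec.frame {P : Cmd} {s s' : State} {k : ℕ} (h : Exec P s s' k) : Frame P s s' := by
  induction h with
  | skip s => exact Frame.refl _ _
  | setN s x e =>
    refine ⟨fun y hy => Function.update_of_ne hy _ _, fun _ _ => rfl, fun _ _ => rfl,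
      fun _ _ => rfl, fun _ => rfl⟩
  | setR s x e =>
    refine ⟨fun _ _ => rfl, fun y hy => Function.update_of_ne hy _ _, fun _ _ => rfl,
      fun _ _ => rfl, fun _ => rfl⟩
  | writeN s a i e =>
    refine ⟨fun _ _ => rfl, fun _ _ => rfl, fun y hy => Function.update_of_ne hy _ _,
      fun _ _ => rfl, fun _ => rfl⟩
  | writeR s a i e =>
    refine ⟨fun _ _ => rfl, fun _ _ => rfl, fun _ _ => rfl,
      fun y hy => Function.update_of_ne hy _ _, fun _ => rfl⟩
  | emit s e f =>
    exact ⟨fun _ _ => rfl, fun _ _ => rfl, fun _ _ => rfl, fun _ _ => rfl,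
      fun h => absurd trivial h⟩
  | seq _ _ ih₁ ih₂ =>
    exact (ih₁.weaken (fun _ => Or.inl) (fun _ => Or.inl) (fun _ => Or.inl) (fun _ => Or.inl) Or.inl).trans
      (ih₂.weaken (fun _ => Or.inr) (fun _ => Or.inr) (fun _ => Or.inr) (fun _ => Or.inr) Or.inr)
  | iteTrue _ _ ih =>
    exact ih.weaken (fun _ => Or.inl) (fun _ => Or.inl) (fun _ => Or.inl) (fun _ => Or.inl) Or.inl
  | iteFalse _ _ ih =>
    exact ih.weaken (fun _ => Or.inr) (fun _ => Or.inr) (fun _ => Or.inr) (fun _ => Or.inr) Or.inr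
  | loopTrue _ _ _ ih₁ ih₂ =>
    exact Frame.trans (Frame.weaken ih₁ (fun _ h => h) (fun _ h => h) (fun _ h => h)
      (fun _ h => h) fun h => h) ih₂
  | loopFalse _ => exact Frame.refl _ _

theorem Run.frame {P : Cmd} {s : State} {Q : State → ℕ → Prop} (h : Run P s Q) :
    Run P s fun s' k => Q s' k ∧ Frame P s s' := by
  obtain ⟨s', k, he, hq⟩ := h
  exact ⟨s', k, he, hq, he.frame⟩

/-! ### Loops -/

/-- Amortised rule for loops: the potential `Φ` pays for all iterations. -/
theorem Run.loop {b : Test} {P : Cmd} {s₀ : State} (I : State → Prop) (Φ : State → ℕ)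
    (h₀ : I s₀)
    (step : ∀ s, Frame P s₀ s → I s → b.Holds s →
      Run P s fun s' k => I s' ∧ k + (b.cost + 1) + Φ s' ≤ Φ s) :
    Run (.loop b P) s₀ fun s' k =>
      (I s' ∧ ¬ b.Holds s' ∧ k + Φ s' ≤ Φ s₀ + (b.cost + 1)) ∧ Frame (.loop b P) s₀ s' := by
  -- Every iteration costs at least one unit, so the potential decreases strictly and a bound `m` on
  -- it serves for induction; this also proves termination.
  suffices H : ∀ m s, Φ s ≤ m → I s → Frame P s₀ s → Run (.loop b P) s fun s' k =>
      (I s' ∧ ¬ b.Holds s' ∧ k + Φ s' ≤ Φ s + (b.cost + 1)) ∧ Frame P s₀ s' from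
    (H _ s₀ le_rfl h₀ (Frame.refl _ _)).mono fun s' k h =>
      ⟨h.1, ⟨h.2.n, h.2.r, h.2.na, h.2.ra, h.2.out⟩⟩
  intro m
  induction m with
  | zero =>
    intro s hm hI hF
    by_cases hb : b.Holds s
    · obtain ⟨s', k, he, hI', hk⟩ := step s hF hI hb
      omega
    · exact ⟨s, _, .loopFalse hb, ⟨hI, hb, by omega⟩, hF⟩
  | succ m ih =>
    intro s hm hI hF
    by_cases hb : b.Holds s
    · obtain ⟨s', k, he, hI', hk⟩ := step s hF hI hb
      obtain ⟨s'', k', he', ⟨hI'', hb'', hk'⟩, hF''⟩ := ih s' (by omega) hI' (hF.trans he.frame)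
      exact ⟨s'', _, .loopTrue hb he he', ⟨hI'', hb'', by omega⟩, hF''⟩
    · exact ⟨s, _, .loopFalse hb, ⟨hI, hb, by omega⟩, hF⟩

/-- The programs `f 0, …, f (d - 1)` one after the other. -/
def forK : ℕ → (ℕ → Cmd) → Cmd
  | 0, _ => .skip
  | d + 1, f => .seq (forK d f) (f d)

@[simp] theorem forK_writesN {d : ℕ} {f : ℕ → Cmd} {y : ℕ} :
    (forK d f).WritesN y ↔ ∃ k < d, (f k).WritesN y := by
  induction d with
  | zero => simp [forK]
  | succ d ih => simp [forK, ih, Nat.exists_lt_succ_right, -Order.lt_add_one_iff]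

@[simp] theorem forK_writesR {d : ℕ} {f : ℕ → Cmd} {y : ℕ} :
    (forK d f).WritesR y ↔ ∃ k < d, (f k).WritesR y := by
  induction d with
  | zero => simp [forK]
  | succ d ih => simp [forK, ih, Nat.exists_lt_succ_right, -Order.lt_add_one_iff]

@[simp] theorem forK_writesNArr {d : ℕ} {f : ℕ → Cmd} {y : ℕ} :
    (forK d f).WritesNArr y ↔ ∃ k < d, (f k).WritesNArr y := by
  induction d with
  | zero => simp [forK]
  | succ d ih => simp [forK, ih, Nat.exists_lt_succ_right, -Order.lt_add_one_iff]

@[simp] theorem forK_writesRArr {d : ℕ} {f : ℕ → Cmd} {y : ℕ} :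
    (forK d f).WritesRArr y ↔ ∃ k < d, (f k).WritesRArr y := by
  induction d with
  | zero => simp [forK]
  | succ d ih => simp [forK, ih, Nat.exists_lt_succ_right, -Order.lt_add_one_iff]

@[simp] theorem forK_emits {d : ℕ} {f : ℕ → Cmd} :
    (forK d f).Emits ↔ ∃ k < d, (f k).Emits := by
  induction d with
  | zero => simp [forK]
  | succ d ih => simp [forK, ih, Nat.exists_lt_succ_right, -Order.lt_add_one_iff]

/-- Amortised rule for `forK`. -/
theorem Run.forK {d : ℕ} {f : ℕ → Cmd} {s₀ : State} (I : ℕ → State → Prop) (Φ : State → ℕ)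
    (B : ℕ) (h₀ : I 0 s₀)
    (step : ∀ k s, k < d → Frame (forK d f) s₀ s → I k s →
      Run (f k) s fun s' c => I (k + 1) s' ∧ c + Φ s' ≤ Φ s + B) :
    Run (forK d f) s₀ fun s' c =>
      (I d s' ∧ c + Φ s' ≤ Φ s₀ + d * B + 1) ∧ Frame (forK d f) s₀ s' := by
  suffices H : ∀ m ≤ d, Run (RealRAM.forK m f) s₀ fun s' c =>
      I m s' ∧ c + Φ s' ≤ Φ s₀ + m * B + 1 from (H d le_rfl).frame
  intro m
  induction m with
  | zero =>
    intro _
    simp only [RealRAM.forK, run_skip]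
    exact ⟨h₀, by omega⟩
  | succ m ih =>
    intro hm
    obtain ⟨s₁, c₁, he, hI, hc⟩ := ih (by omega)
    have hF : Frame (RealRAM.forK d f) s₀ s₁ := by
      refine he.frame.weaken ?_ ?_ ?_ ?_ ?_ <;> simp only [forK_writesN, forK_writesR,
        forK_writesNArr, forK_writesRArr, forK_emits]
      · exact fun y ⟨k, hk, h⟩ => ⟨k, by omega, h⟩
      · exact fun y ⟨k, hk, h⟩ => ⟨k, by omega, h⟩
      · exact fun y ⟨k, hk, h⟩ => ⟨k, by omega, h⟩
      · exact fun y ⟨k, hk, h⟩ => ⟨k, by omega, h⟩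
      · exact fun ⟨k, hk, h⟩ => ⟨k, by omega, h⟩
    obtain ⟨s₂, c₂, he₂, hI₂, hc₂⟩ := step m s₁ (by omega) hF hI
    exact ⟨s₂, _, .seq he he₂, hI₂, by rw [Nat.add_mul]; omega⟩

/-- The program `f k`, where `k` is the content of the register `x`. -/
def switchK (x : ℕ) : ℕ → (ℕ → Cmd) → Cmd
  | 0, _ => .skip
  | d + 1, f => .ite (.nlt (.reg x) (.const d)) (switchK x d f) (f d)

/-- Array names are part of the program text. A dimension that is held in a register can therefore
select an array only through a chain of `d` tests, each of cost `4`. -/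
theorem Run.switchK {x d k : ℕ} {f : ℕ → Cmd} {s : State} {Q : State → ℕ → Prop}
    (hx : s.nreg x = k) (hk : k < d)
    (h : Run (f k) s fun s' c' => ∀ c, c ≤ c' + 4 * d → Q s' c) :
    Run (switchK x d f) s Q := by
  induction d generalizing Q with
  | zero => omega
  | succ d ih =>
    simp only [RealRAM.switchK, run_ite, Test.Holds, NExp.eval, hx]
    refine ⟨fun hlt => ih hlt (h.mono fun s' c' hQ c hc => ?_), fun hge => ?_⟩
    · exact hQ _ (by simp; omega)
    · obtain rfl : k = d := by omega
      exact h.mono fun s' c hQ => hQ _ (by simp; omega)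

@[simp] theorem switchK_writesN {x d : ℕ} {f : ℕ → Cmd} {y : ℕ} :
    (RealRAM.switchK x d f).WritesN y ↔ ∃ k < d, (f k).WritesN y := by
  induction d with
  | zero => simp [RealRAM.switchK]
  | succ d ih => simp [RealRAM.switchK, ih, Nat.exists_lt_succ_right, -Order.lt_add_one_iff]

@[simp] theorem switchK_writesR {x d : ℕ} {f : ℕ → Cmd} {y : ℕ} :
    (RealRAM.switchK x d f).WritesR y ↔ ∃ k < d, (f k).WritesR y := by
  induction d with
  | zero => simp [RealRAM.switchK]
  | succ d ih => simp [RealRAM.switchK, ih, Nat.exists_lt_succ_right, -Order.lt_add_one_iff]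

@[simp] theorem switchK_emits {x d : ℕ} {f : ℕ → Cmd} :
    (RealRAM.switchK x d f).Emits ↔ ∃ k < d, (f k).Emits := by
  induction d with
  | zero => simp [RealRAM.switchK]
  | succ d ih => simp [RealRAM.switchK, ih, Nat.exists_lt_succ_right, -Order.lt_add_one_iff]

end RealRAM

namespace RealRAM

/-! ### Sorting -/

/-- The positions `st, …, en - 1` of `A` hold the elements of `L`, sorted by `key`. -/
structure Seg (key : ℕ → ℝ) (A : ℕ → ℕ) (st en : ℕ) (L : Set ℕ) : Prop where
  mem : ∀ p, st ≤ p → p < en → A p ∈ L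
  surj : ∀ e ∈ L, ∃ p, st ≤ p ∧ p < en ∧ A p = e
  sorted : ∀ p p', st ≤ p → p ≤ p' → p' < en → key (A p) ≤ key (A p')

theorem Seg.empty (key : ℕ → ℝ) (A : ℕ → ℕ) (st : ℕ) : Seg key A st st ∅ :=
  ⟨fun p h h' => absurd h (by omega), fun _ h => h.elim, fun p p' h h' h'' => by omega⟩

theorem Seg.congr {key : ℕ → ℝ} {A A' : ℕ → ℕ} {st en : ℕ} {L : Set ℕ} (h : Seg key A st en L)
    (hA : ∀ p, st ≤ p → p < en → A' p = A p) : Seg key A' st en L where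
  mem p h₁ h₂ := hA p h₁ h₂ ▸ h.mem p h₁ h₂
  surj e he := by
    obtain ⟨p, h₁, h₂, h₃⟩ := h.surj e he
    exact ⟨p, h₁, h₂, (hA p h₁ h₂).trans h₃⟩
  sorted p p' h₁ h₂ h₃ := by
    rw [hA p h₁ (by omega), hA p' (by omega) h₃]
    exact h.sorted p p' h₁ h₂ h₃

theorem Seg.push {key : ℕ → ℝ} {A : ℕ → ℕ} {st en : ℕ} {L : Set ℕ} (h : Seg key A st en L)
    (hse : st ≤ en) {e : ℕ} (he : ∀ l ∈ L, key l ≤ key e) :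
    Seg key (Function.update A en e) st (en + 1) (insert e L) where
  mem p h₁ h₂ := by
    rcases eq_or_ne p en with rfl | hp
    · simp
    · rw [Function.update_of_ne hp]
      exact Or.inr (h.mem p h₁ (by omega))
  surj l hl := by
    rcases hl with rfl | hl
    · exact ⟨en, hse, by omega, by simp⟩
    · obtain ⟨p, h₁, h₂, h₃⟩ := h.surj l hl
      exact ⟨p, h₁, by omega, by rw [Function.update_of_ne (by omega), h₃]⟩
  sorted p p' h₁ h₂ h₃ := by
    rcases eq_or_ne p' en with rfl | hp'
    · rcases eq_or_ne p p' with rfl | hp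
      · rfl
      · rw [Function.update_of_ne hp, Function.update_self]
        exact he _ (h.mem p h₁ (by omega))
    · rw [Function.update_of_ne hp', Function.update_of_ne (by omega)]
      exact h.sorted p p' h₁ h₂ (by omega)

/-- Merge the sorted pieces `[lo, mid)` and `[mid, hi)` of array `a` into array `10`;
registers: `16` mid, `17` hi, `18`, `19` reading positions, `20` writing position. -/
def mergeLoop (a k : ℕ) : Cmd :=
  .loop (.nlt (.reg 20) (.reg 17)) <|
    .seq (.ite (.and (.nlt (.reg 18) (.reg 16)) (.not (.and (.nlt (.reg 19) (.reg 17))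
        (.rlt (.read k (.read a (.reg 19))) (.read k (.read a (.reg 18)))))))
      (.seq (.writeN 10 (.reg 20) (.read a (.reg 18))) (.setN 18 (.add (.reg 18) (.const 1))))
      (.seq (.writeN 10 (.reg 20) (.read a (.reg 19))) (.setN 19 (.add (.reg 19) (.const 1)))))
    (.setN 20 (.add (.reg 20) (.const 1)))

/-- Positions `[lo, i)` and `[mid, j)` have been copied to `[lo, o)`. The field `le` says that
nothing left is smaller than anything copied, which is what keeps the output sorted. -/
structure MergeInv (key : ℕ → ℝ) (A : ℕ → ℕ) (lo mid hi : ℕ) (B₀ : ℕ → ℕ) (i j o : ℕ)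
    (B : ℕ → ℕ) : Prop where
  i_le : i ≤ mid
  le_i : lo ≤ i
  j_le : j ≤ hi
  le_j : mid ≤ j
  pos : o + mid = i + j
  seg : Seg key B lo o (A '' {p | lo ≤ p ∧ p < i ∨ mid ≤ p ∧ p < j})
  le : ∀ p p', (lo ≤ p ∧ p < i ∨ mid ≤ p ∧ p < j) → (i ≤ p' ∧ p' < mid ∨ j ≤ p' ∧ p' < hi) →
    key (A p) ≤ key (A p')
  out : ∀ p, (p < lo ∨ hi ≤ p) → B p = B₀ p

/-- The two alternatives are a step in the left and in the right piece. In both, `q` is a position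
with the least key among all that remain, so it may be appended. -/
theorem MergeInv.step {key : ℕ → ℝ} {A : ℕ → ℕ} {lo mid hi : ℕ} {B₀ : ℕ → ℕ} {i j o : ℕ}
    {B : ℕ → ℕ} (h : MergeInv key A lo mid hi B₀ i j o B) (hoh : o < hi)
    (h₁ : ∀ p p', lo ≤ p → p ≤ p' → p' < mid → key (A p) ≤ key (A p'))
    (h₂ : ∀ p p', mid ≤ p → p ≤ p' → p' < hi → key (A p) ≤ key (A p'))
    {i' j' q : ℕ}
    (hq : (q = i ∧ i < mid ∧ i' = i + 1 ∧ j' = j ∧ (j < hi → key (A i) ≤ key (A j))) ∨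
      (q = j ∧ j < hi ∧ i' = i ∧ j' = j + 1 ∧ (i < mid → key (A j) ≤ key (A i)))) :
    MergeInv key A lo mid hi B₀ i' j' (o + 1) (Function.update B o (A q)) := by
  obtain ⟨a1, a2, a3, a4, a5, a6, a7, a8⟩ := h
  have hmem : ∀ p, (i' ≤ p ∧ p < mid ∨ j' ≤ p ∧ p < hi) → key (A q) ≤ key (A p) := by
    intro p hp
    rcases hq with ⟨rfl, g1, rfl, rfl, g2⟩ | ⟨rfl, g1, rfl, rfl, g2⟩
    · rcases hp with hp | hp
      · exact h₁ _ _ a2 (by omega) hp.2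
      · exact (g2 (by omega)).trans (h₂ _ _ a4 hp.1 hp.2)
    · rcases hp with hp | hp
      · exact (g2 (by omega)).trans (h₁ _ _ a2 hp.1 hp.2)
      · exact h₂ _ _ a4 (by omega) hp.2
  refine ⟨by omega, by omega, by omega, by omega, by omega, ?_, ?_, ?_⟩
  · have := a6.push (e := A q) (by omega) (by
      rintro _ ⟨p, hp, rfl⟩
      exact a7 p q hp (by omega))
    convert this using 1
    rw [← Set.image_insert_eq]
    congr 1
    ext p
    simp only [Set.mem_ofPred_eq, Set.mem_insert_iff]
    omega
  · intro p p' hp hp'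
    by_cases hpq : p = q
    · exact hpq ▸ hmem p' hp'
    · exact a7 p p' (by omega) (by omega)
  · intro p hp
    rw [Function.update_of_ne (by omega)]
    exact a8 p hp

theorem mergeLoop_spec {a k : ℕ} (ha : a ≠ 10) {s : State} {lo mid hi : ℕ}
    (hlm : lo ≤ mid) (hmh : mid ≤ hi)
    (r16 : s.nreg 16 = mid) (r17 : s.nreg 17 = hi) (r18 : s.nreg 18 = lo)
    (r19 : s.nreg 19 = mid) (r20 : s.nreg 20 = lo)
    (h₁ : ∀ p p', lo ≤ p → p ≤ p' → p' < mid → s.rarr k (s.narr a p) ≤ s.rarr k (s.narr a p'))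
    (h₂ : ∀ p p', mid ≤ p → p ≤ p' → p' < hi → s.rarr k (s.narr a p) ≤ s.rarr k (s.narr a p')) :
    Run (mergeLoop a k) s fun s' c =>
      (Seg (s.rarr k) (s'.narr 10) lo hi (s.narr a '' {p | lo ≤ p ∧ p < hi}) ∧
        (∀ p, (p < lo ∨ hi ≤ p) → s'.narr 10 p = s.narr 10 p) ∧
        c ≤ 40 * (hi - lo) + 4) ∧ Frame (mergeLoop a k) s s' := by
  refine (Run.loop (fun s' => MergeInv (s.rarr k) (s.narr a) lo mid hi (s.narr 10)
    (s'.nreg 18) (s'.nreg 19) (s'.nreg 20) (s'.narr 10)) (fun s' => 40 * (hi - s'.nreg 20))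
    ?_ ?_).mono ?_
  · rw [r18, r19, r20]
    refine ⟨hlm, le_rfl, hmh, le_rfl, by omega, ?_, fun p p' hp => by omega, fun _ _ => rfl⟩
    convert Seg.empty _ _ _
    rw [Set.image_eq_empty]
    ext p
    simp only [Set.mem_ofPred_eq, Set.mem_empty_iff_false, iff_false]
    omega
  · intro s' hF hI hb
    have e16 : s'.nreg 16 = mid := by rw [hF.n 16 (by simp), r16]
    have e17 : s'.nreg 17 = hi := by rw [hF.n 17 (by simp), r17]
    have eA : s'.narr a = s.narr a := hF.na a (by simp [ha])
    have eX : s'.rarr k = s.rarr k := hF.ra k (by simp)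
    simp only [Test.Holds, NExp.eval, e17] at hb
    simp [e16, e17, eA, eX]
    have ha2 := hI.pos
    have ha3 := hI.j_le
    have ha4 := hI.i_le
    refine ⟨fun g1 g2 => ⟨hI.step hb h₁ h₂ (.inl ⟨rfl, g1, rfl, rfl, fun g => ?_⟩), by omega⟩,
      fun g1 => ⟨hI.step hb h₁ h₂ (.inr ⟨rfl, ?_, rfl, rfl, fun g => ?_⟩), by omega⟩⟩
    · exact (not_lt.1 fun hlt => absurd hlt (not_lt.2 (g2 g)))
    · by_contra hc
      by_cases g : s'.nreg 18 < mid
      · exact hc (g1 g).1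
      · omega
    · exact (g1 g).2.le
  · rintro s' c ⟨⟨hI, hb, hc⟩, hF⟩
    have e17 : s'.nreg 17 = hi := by rw [hF.n 17 (by simp [mergeLoop]), r17]
    simp only [Test.Holds, NExp.eval, e17, not_lt] at hb
    have ha2 := hI.pos
    have ha3 := hI.j_le
    have ha4 := hI.i_le
    have ho : s'.nreg 20 = hi := by omega
    refine ⟨⟨?_, hI.out, by simp at hc; omega⟩, hF⟩
    have := hI.seg
    rw [ho] at this
    have hset : {p | lo ≤ p ∧ p < s'.nreg 18 ∨ mid ≤ p ∧ p < s'.nreg 19} =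
        {p | lo ≤ p ∧ p < hi} := by
      ext p
      simp only [Set.mem_ofPred_eq]
      omega
    rwa [hset] at this

/-- One round of merge sort on array `a`: blocks of length `w` (register `14`) are merged in pairs
into array `10`. -/
def mergeRound (a k : ℕ) : Cmd :=
  .seq (.setN 15 (.const 0)) <| .loop (.nlt (.reg 15) (.reg 0)) <|
    .seq (.setN 16 (.add (.reg 15) (.reg 14))) <|
    .seq (.setN 17 (.add (.reg 16) (.reg 14))) <|
    .seq (.setN 29 (.reg 17)) <|
    .seq (.ite (.nlt (.reg 0) (.reg 16)) (.setN 16 (.reg 0)) .skip) <|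
    .seq (.ite (.nlt (.reg 0) (.reg 17)) (.setN 17 (.reg 0)) .skip) <|
    .seq (.setN 18 (.reg 15)) <|
    .seq (.setN 19 (.reg 16)) <|
    .seq (.setN 20 (.reg 15)) <|
    .seq (mergeLoop a k) <|
    .setN 15 (.reg 29)

/-- `A` is sorted on each of the blocks of length `w` of `[0, n)`. -/
def BlockSorted (key : ℕ → ℝ) (A : ℕ → ℕ) (n w m : ℕ) : Prop :=
  ∀ q < m, ∀ p p', q * w ≤ p → p ≤ p' → p' < q * w + w → p' < n → key (A p) ≤ key (A p')

/-- The fields `mem` and `surj` take the place of a permutation: together they say that the copied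
blocks hold the same elements as before. Multiplicities are not tracked. -/
structure RoundInv (key : ℕ → ℝ) (A : ℕ → ℕ) (n w : ℕ) (lo : ℕ) (B : ℕ → ℕ) : Prop where
  block : ∃ q, lo = q * (w + w) ∧ BlockSorted key B n (w + w) q
  mem : ∀ p, p < lo → p < n → ∃ p' < n, B p = A p'
  surj : ∀ p', p' < lo → p' < n → ∃ p < n, p < lo ∧ B p = A p'

theorem RoundInv.step {key : ℕ → ℝ} {A : ℕ → ℕ} {n w lo : ℕ} {B B' : ℕ → ℕ}
    (h : RoundInv key A n w lo B) {hi : ℕ} (hhi : hi = min (lo + w + w) n)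
    (hseg : Seg key B' lo hi (A '' {p | lo ≤ p ∧ p < hi}))
    (hout : ∀ p, (p < lo ∨ hi ≤ p) → B' p = B p) :
    RoundInv key A n w (lo + w + w) B' := by
  obtain ⟨⟨q, hq, hb⟩, hm, hs⟩ := h
  refine ⟨⟨q + 1, by rw [hq]; ring, ?_⟩, ?_, ?_⟩
  · intro q' hq' p p' h₁ h₂ h₃ h₄
    rcases Nat.lt_succ_iff_lt_or_eq.1 hq' with hlt | rfl
    · have : (q' + 1) * (w + w) ≤ lo := hq ▸ Nat.mul_le_mul_right _ hlt
      rw [Nat.add_mul, one_mul] at this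
      rw [hout p (by omega), hout p' (by omega)]
      exact hb q' hlt p p' h₁ h₂ h₃ h₄
    · exact hseg.sorted p p' (by omega) h₂ (by omega)
  · intro p h₁ h₂
    by_cases hp : p < lo
    · rw [hout p (by omega)]
      exact hm p hp h₂
    · obtain ⟨p', ⟨h₃, h₄⟩, h₅⟩ := hseg.mem p (by omega) (by omega)
      exact ⟨p', by omega, h₅.symm⟩
  · intro p' h₁ h₂
    by_cases hp : p' < lo
    · obtain ⟨p, h₃, h₄, h₅⟩ := hs p' hp h₂
      exact ⟨p, h₃, by omega, by rw [hout p (by omega), h₅]⟩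
    · obtain ⟨p, h₃, h₄, h₅⟩ := hseg.surj (A p') ⟨p', ⟨by omega, by omega⟩, rfl⟩
      exact ⟨p, by omega, by omega, h₅⟩

theorem mergeRound_spec {a k : ℕ} (ha : a ≠ 10) {s : State} {n w : ℕ} (hw : 0 < w)
    (r0 : s.nreg 0 = n) (r14 : s.nreg 14 = w)
    (hb : ∀ q, BlockSorted (s.rarr k) (s.narr a) n w q) :
    Run (mergeRound a k) s fun s' c =>
      ((∀ q, BlockSorted (s.rarr k) (s'.narr 10) n (w + w) q) ∧
        (∀ p < n, ∃ p' < n, s'.narr 10 p = s.narr a p') ∧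
        (∀ p' < n, ∃ p < n, s'.narr 10 p = s.narr a p') ∧
        c ≤ 90 * n + 6) ∧ Frame (mergeRound a k) s s' := by
  refine Run.frame ?_
  rw [mergeRound, run_seq, run_setN]
  refine (Run.loop (fun s' => RoundInv (s.rarr k) (s.narr a) n w (s'.nreg 15) (s'.narr 10))
    (fun s' => 90 * (n - s'.nreg 15)) ?_ ?_).mono ?_
  · exact ⟨⟨0, by simp, fun q h => by omega⟩, fun p h => by simp at h, fun p h => by simp at h⟩
  · intro s' hF hI hlt
    have e0 : s'.nreg 0 = n := by rw [hF.n 0 (by simp [mergeLoop])]; simpa using r0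
    have e14 : s'.nreg 14 = w := by rw [hF.n 14 (by simp [mergeLoop])]; simpa using r14
    have eA : s'.narr a = s.narr a := hF.na a (by simp [ha, mergeLoop])
    have eX : s'.rarr k = s.rarr k := hF.ra k (by simp [mergeLoop])
    simp only [Test.Holds, NExp.eval, e0] at hlt
    obtain ⟨⟨q, hq, -⟩, -, -⟩ := id hI
    set lo := s'.nreg 15 with hlo
    -- The block ends are clipped to `n` by two tests; this statement serves all four outcomes.
    -- Register `29` keeps the unclipped end, so that block starts stay multiples of `w + w`.
    have key : ∀ s₁ : State, ∀ c₁ : ℕ, s₁.nreg 16 = min (lo + w) n →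
        s₁.nreg 17 = min (lo + w + w) n →
        s₁.nreg 18 = lo → s₁.nreg 19 = min (lo + w) n → s₁.nreg 20 = lo → s₁.narr = s'.narr →
        s₁.rarr = s'.rarr → s₁.nreg 29 = lo + w + w → c₁ ≤ 46 →
        Run (mergeLoop a k) s₁ fun s₂ c₂ => RoundInv (s.rarr k) (s.narr a) n w
          (s₂.nreg 29) (s₂.narr 10) ∧ c₁ + c₂ + 90 * (n - s₂.nreg 29) ≤ 90 * (n - lo) := by
      intro s₁ c₁ g16 g17 g18 g19 g20 gN gR g29 hc₁
      refine (mergeLoop_spec ha (lo := lo) (mid := min (lo + w) n) (hi := min (lo + w + w) n)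
        (by omega) (by omega) g16 g17 g18 g19 g20 ?_ ?_).mono ?_
      · intro p p' h₁ h₂ h₃
        rw [gN, gR, eA, eX]
        -- The pair number `q` of blocks of length `w` consists of the blocks `2 * q` and `2 * q +
        -- 1`.
        exact hb (q + q + 1) (q + q) (by omega) p p' (by rw [Nat.add_mul, ← Nat.mul_add]; omega)
          h₂ (by rw [Nat.add_mul, ← Nat.mul_add]; omega) (by omega)
      · intro p p' h₁ h₂ h₃
        rw [gN, gR, eA, eX]
        exact hb (q + q + 1 + 1) (q + q + 1) (by omega) p p'
          (by rw [Nat.add_mul, Nat.add_mul, ← Nat.mul_add]; omega)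
          h₂ (by rw [Nat.add_mul, Nat.add_mul, ← Nat.mul_add]; omega) (by omega)
      · rintro s₂ c₂ ⟨⟨h₁, h₂, h₃⟩, hF₂⟩
        have f29 : s₂.nreg 29 = lo + w + w := by rw [hF₂.n 29 (by simp [mergeLoop]), g29]
        rw [f29]
        rw [gR, gN, eX, eA] at h₁
        rw [gN] at h₂
        exact ⟨hI.step rfl h₁ h₂, by omega⟩
    simp only [run_seq, run_setN, run_ite, run_skip, Test.Holds, NExp.eval]
    simp [e0, e14, ← hlo]
    refine ⟨fun h₁ => ⟨fun h₂ => ?_, fun h₂ => ?_⟩, fun h₁ => ⟨fun h₂ => ?_, fun h₂ => ?_⟩⟩ <;>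
    refine (key _ 46 ?_ ?_ ?_ ?_ ?_ ?_ ?_ ?_ ?_).mono ?_ <;> simp <;> try omega
    all_goals
      intro s₂ c₂ h₁ h₂
      exact ⟨h₁, by omega⟩
  · rintro s' c ⟨⟨⟨⟨q, hq, hb'⟩, hm, hs⟩, hge, hc⟩, hF⟩
    have e0 : s'.nreg 0 = n := by rw [hF.n 0 (by simp [mergeLoop])]; simpa using r0
    simp only [Test.Holds, NExp.eval, e0, not_lt] at hge
    refine ⟨?_, fun p hp => hm p (by omega) hp, fun p hp => ?_, by simp at hc ⊢; omega⟩
    · intro q' q'' hq'' p p' h₁ h₂ h₃ h₄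
      have : q'' < q := by
        by_contra hcon
        have := Nat.mul_le_mul_right (w + w) (not_lt.1 hcon)
        omega
      exact hb' q'' this p p' h₁ h₂ h₃ h₄
    · obtain ⟨p', h₁, -, h₂⟩ := hs p (by omega) hp
      exact ⟨p', h₁, h₂⟩

/-- Copy `[0, n)` of array `b` to array `a`. -/
def copyLoop (a b : ℕ) : Cmd :=
  .seq (.setN 18 (.const 0)) <| .loop (.nlt (.reg 18) (.reg 0)) <|
    .seq (.writeN a (.reg 18) (.read b (.reg 18))) (.setN 18 (.add (.reg 18) (.const 1)))

theorem copyLoop_spec {a b : ℕ} (hab : a ≠ b) {s : State} {n : ℕ} (r0 : s.nreg 0 = n) :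
    Run (copyLoop a b) s fun s' c =>
      ((∀ p < n, s'.narr a p = s.narr b p) ∧ c ≤ 12 * n + 6) ∧ Frame (copyLoop a b) s s' := by
  refine Run.frame ?_
  rw [copyLoop, run_seq, run_setN]
  refine (Run.loop (fun s' => ∀ p, p < s'.nreg 18 → p < n → s'.narr a p = s.narr b p)
    (fun s' => 12 * (n - s'.nreg 18)) ?_ ?_).mono ?_
  · simp
  · intro s' hF hI hlt
    have e0 : s'.nreg 0 = n := by rw [hF.n 0 (by simp)]; simpa using r0
    have eB : s'.narr b = s.narr b := hF.na b (by simp [hab.symm])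
    simp only [Test.Holds, NExp.eval, e0] at hlt
    simp [eB]
    refine ⟨fun p hp hpn => ?_, by omega⟩
    rcases eq_or_ne p (s'.nreg 18) with rfl | hne
    · simp
    · rw [Function.update_of_ne hne]
      exact hI p (by omega) hpn
  · rintro s' c ⟨⟨hI, hge, hc⟩, hF⟩
    have e0 : s'.nreg 0 = n := by rw [hF.n 0 (by simp)]; simpa using r0
    simp only [Test.Holds, NExp.eval, e0, not_lt] at hge
    exact ⟨fun p hp => hI p (by omega) hp, by simp at hc ⊢; omega⟩
end RealRAM

namespace RealRAM

/-- Sort `0, …, n - 1` by the real array `k` into array `a`. -/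
def sortDim (a k : ℕ) : Cmd :=
  .seq (.setN 18 (.const 0)) <|
  .seq (.loop (.nlt (.reg 18) (.reg 0)) <|
    .seq (.writeN a (.reg 18) (.reg 18)) (.setN 18 (.add (.reg 18) (.const 1)))) <|
  .seq (.setN 14 (.const 1)) <|
  .loop (.nlt (.reg 14) (.reg 0)) <|
    .seq (mergeRound a k) <| .seq (copyLoop a 10) <| .setN 14 (.add (.reg 14) (.reg 14))

/-- The block length runs through the powers of two below `n`, at most `Nat.clog 2 n` of them, and
every round is linear. The last round leaves one block that contains `[0, n)`. -/
theorem sortDim_spec {a k : ℕ} (ha : a ≠ 10) {s : State} {n : ℕ} (r0 : s.nreg 0 = n) :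
    Run (sortDim a k) s fun s' c =>
      (Seg (s.rarr k) (s'.narr a) 0 n {e | e < n} ∧
        c ≤ 120 * ((n + 1) * (Nat.clog 2 n + 1))) ∧ Frame (sortDim a k) s s' := by
  refine Run.frame ?_
  rw [sortDim, run_seq, run_setN, run_seq]
  refine (Run.loop (fun s' => ∀ p, p < s'.nreg 18 → s'.narr a p = p)
    (fun s' => 12 * (n - s'.nreg 18)) ?_ ?_).mono ?_
  · simp
  · intro s' hF hI hlt
    have e0 : s'.nreg 0 = n := by rw [hF.n 0 (by simp)]; simpa using r0
    simp only [Test.Holds, NExp.eval, e0] at hlt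
    simp
    refine ⟨fun p hp => ?_, by omega⟩
    rcases eq_or_ne p (s'.nreg 18) with rfl | hne
    · simp
    · rw [Function.update_of_ne hne]
      exact hI p (by omega)
  rintro s₁ c₁ ⟨⟨hI₁, hge₁, hc₁⟩, hF₁⟩
  have e0 : s₁.nreg 0 = n := by rw [hF₁.n 0 (by simp)]; simpa using r0
  have eX : s₁.rarr k = s.rarr k := hF₁.ra k (by simp)
  simp only [Test.Holds, NExp.eval, e0, not_lt] at hge₁
  rw [run_seq, run_setN]
  refine (Run.loop (fun s' => (∃ j ≤ Nat.clog 2 n, s'.nreg 14 = 2 ^ j) ∧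
      (∀ q, BlockSorted (s.rarr k) (s'.narr a) n (s'.nreg 14) q) ∧
      (∀ p < n, s'.narr a p < n) ∧ (∀ e < n, ∃ p < n, s'.narr a p = e))
    (fun s' => 110 * ((n + 1) * (Nat.clog 2 n - Nat.log 2 (s'.nreg 14)))) ?_ ?_).mono ?_
  · refine ⟨⟨0, by omega, by simp⟩, ?_, ?_, ?_⟩
    · intro q q' hq' p p' h₁ h₂ h₃ h₄
      simp at h₁ h₃
      obtain rfl : p = p' := by omega
      rfl
    · intro p hp
      simp only
      rw [hI₁ p (by omega)]
      exact hp
    · exact fun e he => ⟨e, he, hI₁ e (by omega)⟩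
  · rintro s₂ hF₂ ⟨⟨j, hj, hw⟩, hb, hm, hs⟩ hlt
    have f0 : s₂.nreg 0 = n := by
      rw [hF₂.n 0 (by simp [mergeRound, mergeLoop, copyLoop])]; simpa using e0
    have fX : s₂.rarr k = s.rarr k := by
      rw [hF₂.ra k (by simp [mergeRound, mergeLoop, copyLoop])]; simpa using eX
    simp only [Test.Holds, NExp.eval, f0] at hlt
    rw [run_seq]
    refine (mergeRound_spec ha (w := 2 ^ j) (by positivity) f0 hw
      (by rw [fX, ← hw]; exact hb)).mono ?_
    rintro s₃ c₃ ⟨⟨h₁, h₂, h₃, h₄⟩, hF₃⟩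
    rw [run_seq]
    have g0 : s₃.nreg 0 = n := by
      rw [hF₃.n 0 (by simp [mergeRound, mergeLoop, copyLoop])]; simpa using f0
    have g14 : s₃.nreg 14 = 2 ^ j := by
      rw [hF₃.n 14 (by simp [mergeRound, mergeLoop, copyLoop])]; simpa using hw
    refine (copyLoop_spec ha g0).mono ?_
    rintro s₄ c₄ ⟨⟨h₅, h₆⟩, hF₄⟩
    have i14 : s₄.nreg 14 = 2 ^ j := by
      rw [hF₄.n 14 (by simp [mergeRound, mergeLoop, copyLoop])]; simpa using g14
    have i10 : s₄.narr 10 = s₃.narr 10 := hF₄.na 10 (by simp [copyLoop, ha.symm])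
    have hj' : j < Nat.clog 2 n := (Nat.lt_clog_iff_pow_lt (by norm_num)).2 (hw ▸ hlt)
    have hpow : 2 ^ j + 2 ^ j = 2 ^ (j + 1) := by rw [pow_succ]; ring
    rw [fX] at h₁
    simp [i14]
    refine ⟨⟨⟨j + 1, by omega, hpow⟩, ?_, ?_, ?_⟩, ?_⟩
    · intro q q' hq' p p' g₁ g₂ g₃ g₄
      rw [h₅ p (by omega), h₅ p' (by omega)]
      exact h₁ q q' hq' p p' g₁ g₂ g₃ g₄
    · intro p hp
      rw [h₅ p hp]
      obtain ⟨p', hp', he⟩ := h₂ p hp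
      exact he ▸ hm p' hp'
    · intro e he
      obtain ⟨p, hp, rfl⟩ := hs e he
      obtain ⟨p', hp', he'⟩ := h₃ p hp
      exact ⟨p', hp', by rw [h₅ p' hp', he']⟩
    · rw [hw, hpow, Nat.log_pow (by norm_num), Nat.log_pow (by norm_num)]
      obtain ⟨r, hr⟩ : ∃ r, Nat.clog 2 n = j + 1 + r := Nat.exists_eq_add_of_le hj'
      rw [hr, show j + 1 + r - (j + 1) = r by omega, show j + 1 + r - j = r + 1 by omega,
        Nat.mul_succ]
      omega
  · rintro s₂ c₂ ⟨⟨⟨⟨j, hj, hw⟩, hb, hm, hs⟩, hge, hc⟩, hF₂⟩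
    have f0 : s₂.nreg 0 = n := by
      rw [hF₂.n 0 (by simp [mergeRound, mergeLoop, copyLoop])]; simpa using e0
    simp only [Test.Holds, NExp.eval, f0, not_lt] at hge
    refine ⟨⟨fun p _ hp => hm p hp, fun e he => ?_, fun p p' _ h₂ h₃ =>
      hb 1 0 (by omega) p p' (by omega) h₂ (by omega) h₃⟩, ?_⟩
    · obtain ⟨p, hp, h⟩ := hs e he
      exact ⟨p, by omega, hp, h⟩
    · simp at hc hc₁ ⊢
      rw [Nat.mul_succ]
      omega
end RealRAM

namespace RealRAM

/-! ### Windows into sorted arrays -/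

/-- The elements of `L` occur in the positions `lo, …, hi` of `A`, which are sorted by `key`. -/
structure Cover (key : ℕ → ℝ) (A : ℕ → ℕ) (lo hi : ℕ) (L : Finset ℕ) : Prop where
  cover : ∀ e ∈ L, ∃ p, lo ≤ p ∧ p ≤ hi ∧ A p = e
  sorted : ∀ p p', lo ≤ p → p ≤ p' → p' ≤ hi → key (A p) ≤ key (A p')

/-- A cover whose first and last position hold elements of `L`. -/
structure Window (key : ℕ → ℝ) (A : ℕ → ℕ) (lo hi : ℕ) (L : Finset ℕ) : Prop
    extends Cover key A lo hi L where
  le : lo ≤ hi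
  first : A lo ∈ L
  last : A hi ∈ L

theorem Cover.mono {key : ℕ → ℝ} {A : ℕ → ℕ} {lo hi : ℕ} {L L' : Finset ℕ}
    (h : Cover key A lo hi L) (hL : L' ⊆ L) : Cover key A lo hi L' :=
  ⟨fun e he => h.cover e (hL he), h.sorted⟩

theorem Cover.succ {key : ℕ → ℝ} {A : ℕ → ℕ} {lo hi : ℕ} {L : Finset ℕ}
    (h : Cover key A lo hi L) (hL : A lo ∉ L) : Cover key A (lo + 1) hi L where
  cover e he := by
    obtain ⟨p, h₁, h₂, rfl⟩ := h.cover e he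
    exact ⟨p, lt_of_le_of_ne h₁ fun h => hL (h ▸ he), h₂, rfl⟩
  sorted p p' h₁ h₂ h₃ := h.sorted p p' (by omega) h₂ h₃

theorem Cover.pred {key : ℕ → ℝ} {A : ℕ → ℕ} {lo hi : ℕ} {L : Finset ℕ}
    (h : Cover key A lo hi L) (hL : A hi ∉ L) : Cover key A lo (hi - 1) L where
  cover e he := by
    obtain ⟨p, h₁, h₂, rfl⟩ := h.cover e he
    exact ⟨p, h₁, Nat.le_sub_one_of_lt (lt_of_le_of_ne h₂ fun h => hL (h ▸ he)), rfl⟩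
  sorted p p' h₁ h₂ h₃ := h.sorted p p' (by omega) h₂ (by omega)

theorem Cover.le_of_nonempty {key : ℕ → ℝ} {A : ℕ → ℕ} {lo hi : ℕ} {L : Finset ℕ}
    (h : Cover key A lo hi L) (hL : L.Nonempty) : lo ≤ hi := by
  obtain ⟨e, he⟩ := hL
  obtain ⟨p, h₁, h₂, -⟩ := h.cover e he
  omega

/-- Count in register `9` how far the coordinates from both ends of the window stay on their side
of the real register `3`. -/
def scanLoop (k : ℕ) : Cmd :=
  .seq (.setN 9 (.const 0)) <|
  .loop (.and (.rlt (.read k (.read (2 * k + 20) (.add (.read 8 (.const k)) (.reg 9)))) (.reg 3))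
    (.not (.rlt (.read k (.read (2 * k + 20) (.sub (.read 9 (.const k)) (.reg 9)))) (.reg 3))))
    (.setN 9 (.add (.reg 9) (.const 1)))

/-- Both ends advance at the same speed, so the scan stops when the side of the threshold with fewer
positions is exhausted. Hence the time is linear in `i`, and `2 * i` is at most the number of
positions of the window. The last conjunct tells which side it was. -/
theorem scanLoop_spec {k : ℕ} {s : State} {L : Finset ℕ}
    (hw : Window (s.rarr k) (s.narr (2 * k + 20)) (s.narr 8 k) (s.narr 9 k) L)
    (hlo : s.rarr k (s.narr (2 * k + 20) (s.narr 8 k)) < s.rreg 3)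
    (hhi : s.rreg 3 ≤ s.rarr k (s.narr (2 * k + 20) (s.narr 9 k))) :
    Run (scanLoop k) s fun s' c => (∃ i, s' = { s with nreg := Function.update s.nreg 9 i } ∧
      1 ≤ i ∧ 2 * i ≤ s.narr 9 k + 1 - s.narr 8 k ∧ c ≤ 30 * i + 30 ∧
      s.rarr k (s.narr (2 * k + 20) (s.narr 8 k + (i - 1))) < s.rreg 3 ∧
      s.rreg 3 ≤ s.rarr k (s.narr (2 * k + 20) (s.narr 9 k - (i - 1))) ∧
      (s.rarr k (s.narr (2 * k + 20) (s.narr 8 k + i)) < s.rreg 3 →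
        s.rarr k (s.narr (2 * k + 20) (s.narr 9 k - i)) < s.rreg 3)) := by
  rw [scanLoop, run_seq, run_setN]
  set A := s.narr (2 * k + 20) with hA
  set lo := s.narr 8 k with hlo'
  set hi := s.narr 9 k with hhi'
  -- If the scans met, the position in the middle would be read from both ends and lie on both sides
  -- of the threshold.
  have bound : ∀ i, (∀ y < i, s.rarr k (A (lo + y)) < s.rreg 3 ∧
      s.rreg 3 ≤ s.rarr k (A (hi - y))) → 2 * i ≤ hi + 1 - lo := by
    intro i hi'
    have hle := hw.le
    by_contra hcon
    have h1 := (hi' ((hi + 1 - lo) / 2) (by omega)).1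
    have h2 := (hi' ((hi - lo) / 2) (by omega)).2
    rw [show hi - (hi - lo) / 2 = lo + (hi + 1 - lo) / 2 by omega] at h2
    exact absurd h1 (not_lt.2 h2)
  refine (Run.loop (fun s' => s' = { s with nreg := Function.update s.nreg 9 (s'.nreg 9) } ∧
    ∀ y < s'.nreg 9, s.rarr k (A (lo + y)) < s.rreg 3 ∧ s.rreg 3 ≤ s.rarr k (A (hi - y)))
    (fun s' => 30 * (hi + 1 - s'.nreg 9)) ?_ ?_).mono ?_
  · simp
  · rintro s' hF ⟨he, hI⟩ hb
    set i := s'.nreg 9 with hi9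
    have hstep : ∀ y < i + 1, s.rarr k (A (lo + y)) < s.rreg 3 ∧
        s.rreg 3 ≤ s.rarr k (A (hi - y)) := by
      intro y hy
      rcases Nat.lt_succ_iff_lt_or_eq.1 hy with h | rfl
      · exact hI y h
      · rw [he] at hb
        simpa [← hA, ← hlo', ← hhi'] using hb
    have := bound _ hstep
    rw [run_setN]
    refine ⟨⟨?_, ?_⟩, ?_⟩
    · rw [he]; simp
    · simpa [← hi9] using hstep
    · simp [← hi9]
      omega
  · rintro s' c ⟨⟨⟨he, hI⟩, hb, hc⟩, hF⟩
    set i := s'.nreg 9 with hi9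
    have hle := hw.le
    have hbd := bound _ hI
    rw [he] at hb
    simp [← hA, ← hlo', ← hhi'] at hb hc ⊢
    have h1 : 1 ≤ i := by
      by_contra h0
      obtain h0 : i = 0 := by omega
      rw [h0] at hb
      simp at hb
      exact absurd (hb hlo) (not_lt.2 hhi)
    exact ⟨i, he, h1, hbd, by omega, (hI (i - 1) (by omega)).1, (hI (i - 1) (by omega)).2, hb⟩
end RealRAM

/-! ### Splitting a list by relabelling its lighter side -/

namespace RealRAM

/-- Give the elements at the positions `p₀, …, p₀ + i - 1` (registers `10`, `9`) of the sorted array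
that have at most the label in register `2` the new label `J + 1`, and count them in register `8`. -/
def labelLoop (k : ℕ) : Cmd :=
  .seq (.setN 11 (.const 0)) <|
  .loop (.nlt (.reg 11) (.reg 9)) <|
    .seq (.setN 12 (.read (2 * k + 20) (.add (.reg 10) (.reg 11)))) <|
    .seq (.ite (.nlt (.reg 2) (.read 0 (.reg 12))) .skip
      (.seq (.writeN 0 (.reg 12) (.add (.reg 1) (.const 1))) (.setN 8 (.add (.reg 8) (.const 1)))))
    (.setN 11 (.add (.reg 11) (.const 1)))

/-- Elements that left the list earlier stay in the sorted arrays and carry larger labels, so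
comparing with the current label skips them. An element that has just been relabelled also fails the
test, hence none is counted twice. -/
theorem labelLoop_spec {k n : ℕ} {s : State} (r8 : s.nreg 8 = 0) (hq : s.nreg 2 ≤ s.nreg 1)
    (hlab : ∀ e < n, s.narr 0 e ≤ s.nreg 1)
    (hA : ∀ y < s.nreg 9, s.narr (2 * k + 20) (s.nreg 10 + y) < n) :
    Run (labelLoop k) s fun s' c =>
      ((∀ e, s'.narr 0 e = if (∃ y < s.nreg 9, s.narr (2 * k + 20) (s.nreg 10 + y) = e) ∧
          s.narr 0 e ≤ s.nreg 2 then s.nreg 1 + 1 else s.narr 0 e) ∧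
        s'.nreg 8 = ((Finset.range n).filter (s'.narr 0 · = s.nreg 1 + 1)).card ∧
        s'.nreg 8 ≤ s.nreg 9 ∧ c ≤ 40 * s.nreg 9 + 10) ∧ Frame (labelLoop k) s s' := by
  refine Run.frame ?_
  rw [labelLoop, run_seq, run_setN]
  refine (Run.loop (fun s' => s'.nreg 11 ≤ s.nreg 9 ∧
    (∀ e, s'.narr 0 e = if (∃ y < s'.nreg 11, s.narr (2 * k + 20) (s.nreg 10 + y) = e) ∧
          s.narr 0 e ≤ s.nreg 2 then s.nreg 1 + 1 else s.narr 0 e) ∧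
        s'.nreg 8 = ((Finset.range n).filter (s'.narr 0 · = s.nreg 1 + 1)).card ∧
        s'.nreg 8 ≤ s'.nreg 11)
    (fun s' => 40 * (s.nreg 9 - s'.nreg 11)) ?_ ?_).mono ?_
  · refine ⟨by simp, by simp, ?_, by simp [r8]⟩
    simp only [Function.update_apply, r8]
    rw [eq_comm, if_neg (by norm_num), Finset.card_eq_zero, Finset.filter_eq_empty_iff]
    intro e he
    have := hlab e (Finset.mem_range.1 he)
    omega
  · rintro s' hF ⟨hle, hL, hc, hc'⟩ hb
    have e1 : s'.nreg 1 = s.nreg 1 := by rw [hF.n 1 (by simp)]; simp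
    have e2 : s'.nreg 2 = s.nreg 2 := by rw [hF.n 2 (by simp)]; simp
    have e9 : s'.nreg 9 = s.nreg 9 := by rw [hF.n 9 (by simp)]; simp
    have e10 : s'.nreg 10 = s.nreg 10 := by rw [hF.n 10 (by simp)]; simp
    have eA : s'.narr (2 * k + 20) = s.narr (2 * k + 20) := hF.na _ (by simp)
    simp only [Test.Holds, NExp.eval, e9] at hb
    have hA' := hA _ hb
    simp [e1, e2, e9, e10, eA]
    set e₀ := s.narr (2 * k + 20) (s.nreg 10 + s'.nreg 11) with he₀
    have hex : ∀ e, (∃ y ≤ s'.nreg 11, s.narr (2 * k + 20) (s.nreg 10 + y) = e) ↔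
        (∃ y < s'.nreg 11, s.narr (2 * k + 20) (s.nreg 10 + y) = e) ∨ e₀ = e := by
      intro e
      simp only [← Nat.lt_succ_iff]
      rw [Nat.exists_lt_succ_right, he₀]
    refine ⟨fun hlt => ⟨⟨by omega, fun e => ?_, hc, by omega⟩, by omega⟩, fun hge =>
      ⟨⟨by omega, fun e => ?_, ?_, by omega⟩, by omega⟩⟩
    · simp only [hex]
      rw [hL e]
      rcases eq_or_ne e₀ e with rfl | hne
      · rw [hL e₀] at hlt
        by_cases h : (∃ y < s'.nreg 11, s.narr (2 * k + 20) (s.nreg 10 + y) = e₀) ∧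
          s.narr 0 e₀ ≤ s.nreg 2
        · rw [if_pos h, if_pos ⟨.inl h.1, h.2⟩]
        · rw [if_neg h] at hlt ⊢
          rw [if_neg fun h' => by omega]
      · simp only [hne, or_false]
    · simp only [hex]
      rcases eq_or_ne e e₀ with rfl | hne
      · rw [Function.update_self, if_pos]
        refine ⟨.inr rfl, ?_⟩
        have h := hL e₀
        split_ifs at h with h'
        · exact h'.2
        · omega
      · rw [Function.update_of_ne hne, hL e]
        simp only [hne.symm, or_false]
    · have : (Finset.range n).filter (fun e => Function.update (s'.narr 0) e₀ (s.nreg 1 + 1) e =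
          s.nreg 1 + 1) = insert e₀ ((Finset.range n).filter (s'.narr 0 · = s.nreg 1 + 1)) := by
        ext e
        rcases eq_or_ne e e₀ with rfl | hne
        · simpa using hA'
        · simp [hne]
      rw [this, Finset.card_insert_of_notMem (by simp; omega), hc]
  · rintro s' c ⟨⟨⟨hle, hL, hc, hc'⟩, hb, hcost⟩, hF⟩
    have e9 : s'.nreg 9 = s.nreg 9 := by rw [hF.n 9 (by simp)]; simp
    simp only [Test.Holds, NExp.eval, e9] at hb
    have h11 : s'.nreg 11 = s.nreg 9 := by omega
    rw [h11] at hL hc'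
    refine ⟨hL, hc, hc', ?_⟩
    simp at hcost ⊢
    omega

/-- Move the ends of the window in dimension `k` over the elements whose label exceeds
register `2`. -/
def skipLoops (k : ℕ) : Cmd :=
  .seq (.loop (.nlt (.reg 2) (.read 0 (.read (2 * k + 20) (.read 8 (.const k)))))
    (.writeN 8 (.const k) (.add (.read 8 (.const k)) (.const 1))))
  (.loop (.nlt (.reg 2) (.read 0 (.read (2 * k + 20) (.read 9 (.const k)))))
    (.writeN 9 (.const k) (.sub (.read 9 (.const k)) (.const 1))))

/-- Nonemptiness of `L` stops both loops inside the window. Every skipped position shortens the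
window, so its length pays for the loops. -/
theorem skipLoops_spec {k : ℕ} {s : State} {L : Finset ℕ} (hne : L.Nonempty)
    (hcov : Cover (s.rarr k) (s.narr (2 * k + 20)) (s.narr 8 k) (s.narr 9 k) L)
    (hmem : ∀ p, s.narr 8 k ≤ p → p ≤ s.narr 9 k →
      (s.narr (2 * k + 20) p ∈ L ↔ s.narr 0 (s.narr (2 * k + 20) p) ≤ s.nreg 2)) :
    Run (skipLoops k) s fun s' c => ∃ lo hi,
      s' = { s with
          narr :=
            Function.update (Function.update s.narr 8 (Function.update (s.narr 8) k lo)) 9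
              (Function.update (s.narr 9) k hi) } ∧
      s.narr 8 k ≤ lo ∧ hi ≤ s.narr 9 k ∧
      Window (s.rarr k) (s.narr (2 * k + 20)) lo hi L ∧
      c + 20 * (hi - lo) ≤ 20 * (s.narr 9 k - s.narr 8 k) + 20 := by
  rw [skipLoops, run_seq]
  have h28 : 2 * k + 20 ≠ 8 := by omega
  have h29 : 2 * k + 20 ≠ 9 := by omega
  refine (Run.loop (fun s' => ∃ lo, s' = { s with
          narr :=
            Function.update s.narr 8 (Function.update (s.narr 8) k lo) } ∧ s.narr 8 k ≤ lo ∧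
        Cover (s.rarr k) (s.narr (2 * k + 20)) lo (s.narr 9 k) L)
    (fun s' => 20 * (s'.narr 9 k - s'.narr 8 k)) ⟨s.narr 8 k, by simp, le_rfl, hcov⟩ ?_).mono ?_
  · rintro s' hF ⟨lo, rfl, hlo, hc⟩ hb
    simp [h28] at hb ⊢
    have hle := hc.le_of_nonempty hne
    have hnot : s.narr (2 * k + 20) lo ∉ L := fun h => by
      rw [hmem lo hlo hle] at h
      omega
    have hc' := hc.succ hnot
    have hle' := hc'.le_of_nonempty hne
    exact ⟨⟨lo + 1, rfl, by omega, hc'⟩, by omega⟩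
  · rintro s₁ c₁ ⟨⟨⟨lo, rfl, hlo, hc⟩, hb, hcost⟩, hF⟩
    have hle := hc.le_of_nonempty hne
    simp [h28] at hb hcost
    have hfirst := (hmem lo hlo hle).2 hb
    refine (Run.loop (fun s' => ∃ hi, s' = { s with
          narr :=
            Function.update (Function.update s.narr 8 (Function.update (s.narr 8) k lo)) 9
              (Function.update (s.narr 9) k hi) } ∧
          hi ≤ s.narr 9 k ∧
        Cover (s.rarr k) (s.narr (2 * k + 20)) lo hi L)
      (fun s' => 20 * (s'.narr 9 k - s'.narr 8 k)) ⟨s.narr 9 k, by simp, le_rfl, hc⟩ ?_).mono ?_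
    · rintro s' hF ⟨hi, rfl, hhi, hc⟩ hb
      simp [h28, h29] at hb ⊢
      have hle := hc.le_of_nonempty hne
      have hnot : s.narr (2 * k + 20) hi ∉ L := fun h => by
        rw [hmem hi (by omega) hhi] at h
        omega
      have hc' := hc.pred hnot
      have hle' := hc'.le_of_nonempty hne
      exact ⟨⟨hi - 1, rfl, by omega, hc'⟩, by
        have : lo ≠ hi := by rintro rfl; exact hnot hfirst
        omega⟩
    · rintro s₂ c₂ ⟨⟨⟨hi, rfl, hhi, hc⟩, hb, hcost'⟩, hF⟩
      have hle := hc.le_of_nonempty hne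
      simp [h28, h29] at hb hcost'
      have hlast := (hmem hi (by omega) hhi).2 hb
      exact ⟨lo, hi, rfl, hlo, hhi, ⟨hc, hle, hfirst, hlast⟩, by omega⟩
end RealRAM

namespace RealRAM

/-- The elements with label `l`. -/
def labelled (n : ℕ) (lab : ℕ → ℕ) (l : ℕ) : Finset ℕ := (Finset.range n).filter (lab · = l)

@[simp] theorem mem_labelled {n : ℕ} {lab : ℕ → ℕ} {l e : ℕ} :
    e ∈ labelled n lab l ↔ e < n ∧ lab e = l := by simp [labelled]

/-- Split the current list at real register `3` in dimension `k`; the side that occupies fewer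
positions gets the label `J + 1`. -/
def splitDim (k : ℕ) : Cmd :=
  .seq (scanLoop k) <|
  .seq (.ite (.rlt (.read k (.read (2 * k + 20) (.add (.read 8 (.const k)) (.reg 9)))) (.reg 3))
    (.seq (.writeN 9 (.const k) (.sub (.read 9 (.const k)) (.reg 9))) <|
      .seq (.setN 10 (.add (.read 9 (.const k)) (.const 1))) <|
      .seq (.setN 24 (.add (.add (.reg 1) (.reg 1)) (.const 2))) <|
      .setN 5 (.add (.add (.reg 1) (.reg 1)) (.const 1)))
    (.seq (.setN 10 (.read 8 (.const k))) <|
      .seq (.writeN 8 (.const k) (.add (.read 8 (.const k)) (.reg 9))) <|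
      .seq (.setN 24 (.add (.add (.reg 1) (.reg 1)) (.const 1))) <|
      .setN 5 (.add (.add (.reg 1) (.reg 1)) (.const 2)))) <|
  labelLoop k

/-- The window of dimension `k` loses exactly `i` positions and the cost is linear in `i`, so the
cost can be charged to the windows. The new list has at most `i` elements, hence at most half as
many as the window has positions. The final disjunction records whether the upper or the lower part
received the new label. -/
theorem splitDim_spec {k n : ℕ} {s : State}
    (hw : Window (s.rarr k) (s.narr (2 * k + 20)) (s.narr 8 k) (s.narr 9 k)
      (labelled n (s.narr 0) (s.nreg 2)))
    (hmem : ∀ p, s.narr 8 k ≤ p → p ≤ s.narr 9 k →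
      s.narr (2 * k + 20) p < n ∧ s.nreg 2 ≤ s.narr 0 (s.narr (2 * k + 20) p))
    (hlo : s.rarr k (s.narr (2 * k + 20) (s.narr 8 k)) < s.rreg 3)
    (hhi : s.rreg 3 ≤ s.rarr k (s.narr (2 * k + 20) (s.narr 9 k)))
    (r8 : s.nreg 8 = 0) (hq : s.nreg 2 ≤ s.nreg 1) (hlab : ∀ e < n, s.narr 0 e ≤ s.nreg 1) :
    Run (splitDim k) s fun s' c =>
      ((∃ lo hi i, s'.narr 8 = Function.update (s.narr 8) k lo ∧
          s'.narr 9 = Function.update (s.narr 9) k hi ∧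
          s.narr 8 k ≤ lo ∧ hi ≤ s.narr 9 k ∧ 1 ≤ i ∧ 2 * i ≤ s.narr 9 k + 1 - s.narr 8 k ∧
          (lo - s.narr 8 k) + (s.narr 9 k - hi) = i ∧ c ≤ 70 * i + 90 ∧ s'.nreg 8 ≤ i ∧
          Cover (s.rarr k) (s.narr (2 * k + 20)) lo hi (labelled n (s'.narr 0) (s.nreg 2))) ∧
        s'.nreg 8 = (labelled n (s'.narr 0) (s.nreg 1 + 1)).card ∧
        (s'.nreg 24 = 2 * s.nreg 1 + 2 ∧ s'.nreg 5 = 2 * s.nreg 1 + 1 ∧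
            (∀ e < n, s'.narr 0 e = if s.narr 0 e = s.nreg 2 ∧ ¬ s.rarr k e < s.rreg 3
              then s.nreg 1 + 1 else s.narr 0 e) ∨
          s'.nreg 24 = 2 * s.nreg 1 + 1 ∧ s'.nreg 5 = 2 * s.nreg 1 + 2 ∧
            (∀ e < n, s'.narr 0 e = if s.narr 0 e = s.nreg 2 ∧ s.rarr k e < s.rreg 3
              then s.nreg 1 + 1 else s.narr 0 e))) ∧ Frame (splitDim k) s s' := by
  refine Run.frame (Run.of_forall fun R hR => ?_)
  rw [splitDim, run_seq]
  have h28 : 2 * k + 20 ≠ 8 := by omega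
  have h29 : 2 * k + 20 ≠ 9 := by omega
  have hle := hw.le
  refine (scanLoop_spec hw hlo hhi).mono ?_
  rintro s₁ c₁ ⟨i, rfl, h1i, h2i, hc₁, hlow, hhigh, hor⟩
  set A := s.narr (2 * k + 20) with hA
  set lo := s.narr 8 k with hlo'
  set hi := s.narr 9 k with hhi'
  simp only [run_seq, run_ite, run_setN, run_writeN, Test.Holds, NExp.eval, RExp.eval]
  simp [h28, h29]
  rw [← hA, ← hlo', ← hhi']
  refine ⟨fun hlt => ?_, fun hge => ?_⟩
  -- The left scan could go on, so the right one stopped: the upper part occupies exactly the last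
  -- `i` positions.
  · have hlt' := hor hlt
    refine (labelLoop_spec (n := n) ?_ ?_ ?_ ?_).mono ?_
    · simpa using r8
    · simpa using hq
    · simpa using hlab
    · intro y hy
      simp [h28, h29] at hy ⊢
      rw [← hA]
      exact (hmem _ (by omega) (by omega)).1
    rintro s₂ c₂ ⟨⟨hL, hcard, hcle, hc₂⟩, hF⟩
    simp [h28, h29] at hL hcard hcle hc₂
    have hpos : ∀ e, e < n → s.narr 0 e = s.nreg 2 → ∃ p, lo ≤ p ∧ p ≤ hi ∧ A p = e ∧
        (s.rarr k e < s.rreg 3 → p ≤ hi - i) ∧ (hi - i < p → ¬ s.rarr k e < s.rreg 3) := by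
      intro e he hle
      obtain ⟨p, h₁, h₂, h₃⟩ := hw.cover e (by simp [he, hle])
      have hp : hi - i < p → ¬ s.rarr k e < s.rreg 3 := fun h => by
        rw [← h₃, not_lt]
        exact hhigh.trans (hw.sorted _ _ (by omega) (by omega) h₂)
      exact ⟨p, h₁, h₂, h₃, fun h => not_lt.1 fun h' => hp h' h, hp⟩
    have hform : ∀ e < n, s₂.narr 0 e = if s.narr 0 e = s.nreg 2 ∧ ¬ s.rarr k e < s.rreg 3
              then s.nreg 1 + 1 else s.narr 0 e := by
      intro e he
      rw [hL e]
      refine if_congr ⟨?_, ?_⟩ rfl rfl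
      · rintro ⟨⟨y, hy, rfl⟩, h⟩
        refine ⟨le_antisymm h (hmem _ (by omega) (by omega)).2, not_lt.2 ?_⟩
        exact hhigh.trans (hw.sorted _ _ (by omega) (by omega) (by omega))
      · rintro ⟨h₁, h₂⟩
        obtain ⟨p, g₁, g₂, g₃, g₄, -⟩ := hpos e he h₁
        refine ⟨⟨p - (hi - i + 1), ?_, ?_⟩, h₁.le⟩
        · have : ¬ p ≤ hi - i := fun h => h₂ (by
            rw [← g₃]
            exact (hw.sorted _ _ g₁ h (by omega)).trans_lt hlt')
          omega
        · have : ¬ p ≤ hi - i := fun h => h₂ (by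
            rw [← g₃]
            exact (hw.sorted _ _ g₁ h (by omega)).trans_lt hlt')
          rw [show hi - i + 1 + (p - (hi - i + 1)) = p by omega]
          exact g₃
    refine hR _ _ ⟨⟨lo, hi - i, i, ?_, ?_, le_rfl, by omega, h1i, h2i, by omega, by omega, hcle, ?_, ?_⟩,
      ?_, .inl ⟨?_, ?_, hform⟩⟩
    · rw [hF.na 8 (by simp [labelLoop])]
      simp [hlo']
    · rw [hF.na 9 (by simp [labelLoop])]
      simp
    · intro e he
      simp only [mem_labelled] at he
      obtain ⟨he, he'⟩ := he
      rw [hform e he] at he'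
      split_ifs at he' with h
      · omega
      · obtain ⟨p, g₁, g₂, g₃, g₄, -⟩ := hpos e he he'
        exact ⟨p, g₁, g₄ (by by_contra hh; exact h ⟨he', hh⟩), g₃⟩
    · exact fun p p' h₁ h₂ h₃ => hw.sorted p p' h₁ h₂ (by omega)
    · exact hcard
    · rw [hF.n 24 (by simp [labelLoop])]
      simp
      omega
    · rw [hF.n 5 (by simp [labelLoop])]
      simp
      omega
  -- The left scan stopped at `lo + i`, so the lower part occupies exactly the first `i` positions.
  · refine (labelLoop_spec (n := n) ?_ ?_ ?_ ?_).mono ?_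
    · simpa using r8
    · simpa using hq
    · simpa using hlab
    · intro y hy
      simp [h28, h29] at hy ⊢
      rw [← hA]
      exact (hmem _ (by omega) (by omega)).1
    rintro s₂ c₂ ⟨⟨hL, hcard, hcle, hc₂⟩, hF⟩
    simp [h28, h29] at hL hcard hcle hc₂
    have hform : ∀ e < n, s₂.narr 0 e = if s.narr 0 e = s.nreg 2 ∧ s.rarr k e < s.rreg 3
              then s.nreg 1 + 1 else s.narr 0 e := by
      intro e he
      rw [hL e]
      refine if_congr ⟨?_, ?_⟩ rfl rfl
      · rintro ⟨⟨y, hy, rfl⟩, h⟩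
        refine ⟨le_antisymm h (hmem _ (by omega) (by omega)).2, ?_⟩
        exact (hw.sorted _ _ (by omega) (by omega) (by omega)).trans_lt hlow
      · rintro ⟨h₁, h₂⟩
        obtain ⟨p, g₁, g₂, g₃⟩ := hw.cover e (by simp [he, h₁])
        have : ¬ lo + i ≤ p := fun h => absurd h₂ (not_lt.2 (by
          rw [← g₃]
          exact hge.trans (hw.sorted _ _ (by omega) h (by omega))))
        refine ⟨⟨p - lo, by omega, ?_⟩, h₁.le⟩
        rw [show lo + (p - lo) = p by omega]
        exact g₃
    refine hR _ _ ⟨⟨lo + i, hi, i, ?_, ?_, by omega, le_rfl, h1i, h2i, by omega, by omega, hcle, ?_, ?_⟩,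
      ?_, .inr ⟨?_, ?_, hform⟩⟩
    · rw [hF.na 8 (by simp [labelLoop])]
      simp [hlo']
    · rw [hF.na 9 (by simp [labelLoop])]
      simp [hhi']
    · intro e he
      simp only [mem_labelled] at he
      obtain ⟨he, he'⟩ := he
      rw [hform e he] at he'
      split_ifs at he' with h
      · omega
      · obtain ⟨p, g₁, g₂, g₃⟩ := hw.cover e (by simp [he, he'])
        refine ⟨p, not_lt.1 fun hlt => h ⟨he', ?_⟩, g₂, g₃⟩
        rw [← g₃]
        exact (hw.sorted _ _ (by omega) (by omega) (by omega)).trans_lt hlow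
    · exact fun p p' h₁ h₂ h₃ => hw.sorted p p' (by omega) h₂ (by omega)
    · exact hcard
    · rw [hF.n 24 (by simp [labelLoop])]
      simp
      omega
    · rw [hF.n 5 (by simp [labelLoop])]
      simp
      omega
end RealRAM

/-! ### The split tree and its representation in memory -/

/-- A hierarchy of sets `S 0, …, S (2 * J)` that arises by `J` splits. Split number `j` splits the
node `P j` in coordinate `kap j` at the midpoint `mid j` of its longest side, which has length
`EL (P j)`, into the nodes `2 * j + 1` (lower part) and `2 * j + 2` (upper part). -/
structure SplitTree (d : ℕ) (x : ℕ → ℕ → ℝ) (J : ℕ) (S : ℕ → Finset ℕ) (P kap : ℕ → ℕ)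
    (mid EL : ℕ → ℝ) : Prop where
  P_le : ∀ j < J, P j ≤ 2 * j
  P_inj : ∀ i < J, ∀ j < J, P i = P j → i = j
  kap_lt : ∀ j < J, kap j < d
  low : ∀ j < J, S (2 * j + 1) = (S (P j)).filter fun e => x (kap j) e < mid j
  high : ∀ j < J, S (2 * j + 2) = (S (P j)).filter fun e => ¬ x (kap j) e < mid j
  split : ∀ j < J, ∃ a ∈ S (P j), ∃ b ∈ S (P j), x (kap j) b - x (kap j) a = EL (P j) ∧
    mid j = (x (kap j) a + x (kap j) b) / 2 ∧ 0 < EL (P j)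

/-- `A` has side lengths at most `l`, and `ctr` is a centre of a bounding box. -/
structure BoxOf (d : ℕ) (x : ℕ → ℕ → ℝ) (A : Finset ℕ) (l : ℝ) (ctr : ℕ → ℝ) : Prop where
  nonneg : 0 ≤ l
  ext : ∀ k < d, ∀ e ∈ A, ∀ e' ∈ A, x k e' - x k e ≤ l
  ctr : ∀ k < d, ∀ e ∈ A, |x k e - ctr k| ≤ l / 2

namespace RealRAM

/-- The data stored for node `u` with element set `A`. -/
structure NodeData (d : ℕ) (x : ℕ → ℕ → ℝ) (s : State) (u : ℕ) (A : Finset ℕ) : Prop where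
  rep : s.narr 5 u ∈ A
  box : BoxOf d x A (s.rarr (d + 1) u) fun k => s.rarr (d + 3 + k) u
  rho_pos : 0 < s.rarr (d + 1) u → s.rarr (d + 2) u = 3 / 2 * d * s.rarr (d + 1) u
  rho_zero : s.rarr (d + 1) u = 0 → s.rarr (d + 2) u = x d (s.narr 5 u)

theorem NodeData.congr {d : ℕ} {x : ℕ → ℕ → ℝ} {s s' : State} {u : ℕ} {A : Finset ℕ}
    (h : NodeData d x s u A) (h5 : s'.narr 5 u = s.narr 5 u)
    (hr : ∀ a, d < a → s'.rarr a u = s.rarr a u) : NodeData d x s' u A where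
  rep := h5 ▸ h.rep
  box := by
    have := h.box
    rw [hr (d + 1) (by omega)]
    exact ⟨this.nonneg, this.ext, fun k hk e he => by
      rw [hr (d + 3 + k) (by omega)]; exact this.ctr k hk e he⟩
  rho_pos := by
    rw [hr (d + 1) (by omega), hr (d + 2) (by omega)]
    exact h.rho_pos
  rho_zero := by
    rw [hr (d + 1) (by omega), hr (d + 2) (by omega), h5]
    exact h.rho_zero

/-- The memory describes a tree with `J` splits; the lists `0, …, J` are its leaves, and the
first `q` of them are finished. -/
structure Core (d n : ℕ) (x : ℕ → ℕ → ℝ) (q J : ℕ) (s : State) (S : ℕ → Finset ℕ)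
    (P kap : ℕ → ℕ) (mid : ℕ → ℝ) : Prop where
  r0 : s.nreg 0 = n
  r1 : s.nreg 1 = J
  r2 : s.nreg 2 = q
  coord : ∀ k ≤ d, s.rarr k = x k
  tree : SplitTree d x J S P kap mid (s.rarr (d + 1))
  root : S 0 = Finset.range n
  lab_le : ∀ e < n, s.narr 0 e ≤ J
  front : ∀ l ≤ J, S (s.narr 3 l) = labelled n (s.narr 0) l
  ne : ∀ l ≤ J, (S (s.narr 3 l)).Nonempty
  front_le : ∀ l ≤ J, s.narr 3 l ≤ 2 * J
  nodes : ∀ u ≤ 2 * J, (∃ j < J, P j = u) ∨ ∃ l ≤ J, s.narr 3 l = u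
  disj : ∀ j < J, ∀ l ≤ J, P j ≠ s.narr 3 l
  child : ∀ j < J, s.narr 4 (P j) = 2 * j + 1 ∧ s.narr 6 j = 2 * j + 1 ∧ s.narr 7 j = 2 * j + 2
  dataP : ∀ j < J, NodeData d x s (P j) (S (P j))
  dataL : ∀ l < q, l ≤ J → NodeData d x s (s.narr 3 l) (S (s.narr 3 l)) ∧
    s.rarr (d + 1) (s.narr 3 l) = 0
  start : ∀ l < J, s.narr 1 (l + 1) = s.narr 1 l + s.narr 2 l

/-- The element set of a leaf is a nonempty label class, and distinct label classes are disjoint. -/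
theorem Core.front_inj {d n : ℕ} {x : ℕ → ℕ → ℝ} {q J : ℕ} {s : State} {S : ℕ → Finset ℕ}
    {P kap : ℕ → ℕ} {mid : ℕ → ℝ} (h : Core d n x q J s S P kap mid) {l l' : ℕ} (hl : l ≤ J)
    (hl' : l' ≤ J) (he : s.narr 3 l = s.narr 3 l') : l = l' := by
  obtain ⟨e, h₁⟩ := h.ne l hl
  have h₂ := h₁
  rw [he, h.front l' hl', mem_labelled] at h₂
  rw [h.front l hl, mem_labelled] at h₁
  omega

/-- The abstract effect of one split, free of programs: the leaf `cur` of list `q` becomes internal,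
one child inherits the list `q` and the other one becomes the list `J + 1`. In `hcase` either child
may be the one that moves. -/
theorem Core.split {d n : ℕ} {x : ℕ → ℕ → ℝ} {q J : ℕ} {s s' : State} {S : ℕ → Finset ℕ}
    {P kap : ℕ → ℕ} {mid : ℕ → ℝ} (h : Core d n x q J s S P kap mid) (hq : q ≤ J)
    {cur : ℕ} (hcur : s.narr 3 q = cur)
    (r0 : s'.nreg 0 = n) (r1 : s'.nreg 1 = J + 1) (r2 : s'.nreg 2 = q)
    (hcoord : ∀ k ≤ d, s'.rarr k = s.rarr k)
    (hrarr : ∀ a, d < a → ∀ u, u ≠ cur → s'.rarr a u = s.rarr a u)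
    (hrep : ∀ u, u ≠ cur → s'.narr 5 u = s.narr 5 u)
    (hdata : NodeData d x s' cur (S cur))
    (hch : s'.narr 4 = Function.update (s.narr 4) cur (2 * J + 1))
    (hqu : s'.narr 6 = Function.update (s.narr 6) J (2 * J + 1))
    (hqv : s'.narr 7 = Function.update (s.narr 7) J (2 * J + 2))
    (hst : ∀ l ≤ J, s'.narr 1 l = s.narr 1 l) (hst' : s'.narr 1 (J + 1) = s.narr 1 J + s.narr 2 J)
    (hsz : ∀ l ≤ J, s'.narr 2 l = s.narr 2 l)
    (hln : ∀ l ≤ J, l ≠ q → s'.narr 3 l = s.narr 3 l)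
    {k : ℕ} (hk : k < d) {m : ℝ}
    (hcase : s'.narr 3 (J + 1) = 2 * J + 2 ∧ s'.narr 3 q = 2 * J + 1 ∧
            (∀ e < n, s'.narr 0 e = if s.narr 0 e = q ∧ ¬ x k e < m
              then J + 1 else s.narr 0 e) ∨
          s'.narr 3 (J + 1) = 2 * J + 1 ∧ s'.narr 3 q = 2 * J + 2 ∧
            (∀ e < n, s'.narr 0 e = if s.narr 0 e = q ∧ x k e < m
              then J + 1 else s.narr 0 e))
    (hsplit : ∃ a ∈ S cur, ∃ b ∈ S cur, x k b - x k a = s'.rarr (d + 1) cur ∧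
      m = (x k a + x k b) / 2 ∧ 0 < s'.rarr (d + 1) cur) :
    ∃ S' P' kap' mid', Core d n x q (J + 1) s' S' P' kap' mid' := by
  set lowS := (S cur).filter fun e => x k e < m with hlow
  set highS := (S cur).filter fun e => ¬ x k e < m with hhigh
  have hcur_le : cur ≤ 2 * J := hcur ▸ h.front_le q hq
  have hScur : S cur = labelled n (s.narr 0) q := hcur ▸ h.front q hq
  let S' : ℕ → Finset ℕ := fun u => if u = 2 * J + 1 then lowS else if u = 2 * J + 2 then highS
    else S u
  have hS1 : S' (2 * J + 1) = lowS := by simp [S']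
  have hS2 : S' (2 * J + 2) = highS := by simp [S']
  have hS : ∀ u ≤ 2 * J, S' u = S u := fun u hu => by
    simp only [S']
    rw [if_neg (by omega), if_neg (by omega)]
  have hPj : ∀ j < J, Function.update P J cur j = P j := fun j hj =>
    Function.update_of_ne (by omega) _ _
  have hPne : ∀ j < J, P j ≠ cur := fun j hj => hcur ▸ h.disj j hj q hq
  have hP2 : ∀ j < J, P j ≤ 2 * J := fun j hj => by have := h.tree.P_le j hj; omega
  obtain ⟨a, ha, b, hb, hab, hm, hpos⟩ := hsplit
  -- The two elements that realise the longest side lie strictly below and above its midpoint, hence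
  -- neither part is empty.
  have hane : a ∈ lowS := by
    rw [hlow, Finset.mem_filter]; exact ⟨ha, by linarith⟩
  have hbne : b ∈ highS := by
    rw [hhigh, Finset.mem_filter]; exact ⟨hb, by linarith⟩
  have hfront : ∀ l ≤ J + 1, S' (s'.narr 3 l) = labelled n (s'.narr 0) l := by
    intro l hl
    by_cases hlq : l = q ∨ l = J + 1
    · rcases hcase with ⟨h1, h2, h3⟩ | ⟨h1, h2, h3⟩ <;> rcases hlq with rfl | rfl
      · rw [h2, hS1, hlow, hScur]
        ext e
        simp only [Finset.mem_filter, mem_labelled]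
        refine ⟨fun ⟨⟨g1, g2⟩, g3⟩ => ⟨g1, ?_⟩, fun ⟨g1, g2⟩ => ?_⟩
        · rw [h3 e g1, if_neg (by tauto), g2]
        · rw [h3 e g1] at g2
          split_ifs at g2 with g
          · omega
          · exact ⟨⟨g1, g2⟩, by tauto⟩
      · rw [h1, hS2, hhigh, hScur]
        ext e
        simp only [Finset.mem_filter, mem_labelled]
        refine ⟨fun ⟨⟨g1, g2⟩, g3⟩ => ⟨g1, ?_⟩, fun ⟨g1, g2⟩ => ?_⟩
        · rw [h3 e g1, if_pos ⟨g2, g3⟩]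
        · rw [h3 e g1] at g2
          split_ifs at g2 with g
          · exact ⟨⟨g1, g.1⟩, g.2⟩
          · have := h.lab_le e g1; omega
      · rw [h2, hS2, hhigh, hScur]
        ext e
        simp only [Finset.mem_filter, mem_labelled]
        refine ⟨fun ⟨⟨g1, g2⟩, g3⟩ => ⟨g1, ?_⟩, fun ⟨g1, g2⟩ => ?_⟩
        · rw [h3 e g1, if_neg (by tauto), g2]
        · rw [h3 e g1] at g2
          split_ifs at g2 with g
          · omega
          · exact ⟨⟨g1, g2⟩, by tauto⟩
      · rw [h1, hS1, hlow, hScur]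
        ext e
        simp only [Finset.mem_filter, mem_labelled]
        refine ⟨fun ⟨⟨g1, g2⟩, g3⟩ => ⟨g1, ?_⟩, fun ⟨g1, g2⟩ => ?_⟩
        · rw [h3 e g1, if_pos ⟨g2, g3⟩]
        · rw [h3 e g1] at g2
          split_ifs at g2 with g
          · exact ⟨⟨g1, g.1⟩, g.2⟩
          · have := h.lab_le e g1; omega
    · rw [hln l (by omega) (by omega), hS _ (h.front_le l (by omega)), h.front l (by omega)]
      ext e
      simp only [mem_labelled]
      refine and_congr_right fun g1 => ?_
      rcases hcase with ⟨-, -, h3⟩ | ⟨-, -, h3⟩ <;>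
      · rw [h3 e g1]
        split_ifs <;> omega
  refine ⟨S', Function.update P J cur, Function.update kap J k, Function.update mid J m,
    r0, r1, r2, fun k hk => (hcoord k hk).trans (h.coord k hk), ?_, ?_, ?_, hfront, ?_, ?_, ?_, ?_,
    ?_, ?_, ?_, ?_⟩
  · refine ⟨?_, ?_, ?_, ?_, ?_, ?_⟩
    · intro j hj
      rcases Nat.lt_succ_iff_lt_or_eq.1 hj with hj | rfl
      · rw [hPj j hj]; exact h.tree.P_le j hj
      · simpa using hcur_le
    · intro i hi j hj hij
      rcases Nat.lt_succ_iff_lt_or_eq.1 hi with hi | rfl <;>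
        rcases Nat.lt_succ_iff_lt_or_eq.1 hj with hj | rfl
      · rw [hPj i hi, hPj j hj] at hij
        exact h.tree.P_inj i hi j hj hij
      · rw [hPj i hi, Function.update_self] at hij
        exact absurd hij (hPne i hi)
      · rw [hPj j hj, Function.update_self] at hij
        exact absurd hij.symm (hPne j hj)
      · rfl
    · intro j hj
      rcases Nat.lt_succ_iff_lt_or_eq.1 hj with hj | rfl
      · rw [Function.update_of_ne (by omega)]; exact h.tree.kap_lt j hj
      · simpa using hk
    · intro j hj
      rcases Nat.lt_succ_iff_lt_or_eq.1 hj with hj | rfl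
      · rw [hPj j hj, Function.update_of_ne (by omega), Function.update_of_ne (by omega),
          hS _ (by omega), hS _ (hP2 j hj)]
        exact h.tree.low j hj
      · rw [Function.update_self, Function.update_self, Function.update_self, hS1, hS _ hcur_le]
    · intro j hj
      rcases Nat.lt_succ_iff_lt_or_eq.1 hj with hj | rfl
      · rw [hPj j hj, Function.update_of_ne (by omega), Function.update_of_ne (by omega),
          hS _ (by omega), hS _ (hP2 j hj)]
        exact h.tree.high j hj
      · rw [Function.update_self, Function.update_self, Function.update_self, hS2, hS _ hcur_le]
    · intro j hj
      rcases Nat.lt_succ_iff_lt_or_eq.1 hj with hj | rfl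
      · rw [hPj j hj, Function.update_of_ne (by omega), Function.update_of_ne (by omega),
          hS _ (hP2 j hj), hrarr _ (by omega) _ (hPne j hj)]
        exact h.tree.split j hj
      · rw [Function.update_self, Function.update_self, Function.update_self, hS _ hcur_le]
        exact ⟨a, ha, b, hb, hab, hm, hpos⟩
  · rw [hS 0 (by omega)]; exact h.root
  · intro e he
    have := h.lab_le e he
    rcases hcase with ⟨-, -, h3⟩ | ⟨-, -, h3⟩ <;>
    · rw [h3 e he]
      split_ifs <;> omega
  · intro l hl
    by_cases hlq : l = q ∨ l = J + 1
    · rcases hcase with ⟨h1, h2, -⟩ | ⟨h1, h2, -⟩ <;> rcases hlq with rfl | rfl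
      · rw [h2, hS1]; exact ⟨a, hane⟩
      · rw [h1, hS2]; exact ⟨b, hbne⟩
      · rw [h2, hS2]; exact ⟨b, hbne⟩
      · rw [h1, hS1]; exact ⟨a, hane⟩
    · rw [hln l (by omega) (by omega), hS _ (h.front_le l (by omega))]
      exact h.ne l (by omega)
  · intro l hl
    by_cases hlq : l = q ∨ l = J + 1
    · rcases hcase with ⟨h1, h2, -⟩ | ⟨h1, h2, -⟩ <;> rcases hlq with rfl | rfl <;> omega
    · rw [hln l (by omega) (by omega)]
      have := h.front_le l (by omega)
      omega
  · intro u hu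
    by_cases hu2 : u ≤ 2 * J
    · rcases h.nodes u hu2 with ⟨j, hj, rfl⟩ | ⟨l, hl, rfl⟩
      · exact .inl ⟨j, by omega, hPj j hj⟩
      · by_cases hlq : l = q
        · exact .inl ⟨J, by omega, by rw [Function.update_self, hlq, hcur]⟩
        · exact .inr ⟨l, by omega, hln l hl hlq⟩
    · right
      obtain rfl | rfl : u = 2 * J + 1 ∨ u = 2 * J + 2 := by omega
      · rcases hcase with ⟨h1, h2, -⟩ | ⟨h1, h2, -⟩
        · exact ⟨q, by omega, h2⟩
        · exact ⟨J + 1, le_rfl, h1⟩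
      · rcases hcase with ⟨h1, h2, -⟩ | ⟨h1, h2, -⟩
        · exact ⟨J + 1, le_rfl, h1⟩
        · exact ⟨q, by omega, h2⟩
  · intro j hj l hl
    have hPle : Function.update P J cur j ≤ 2 * J := by
      rcases Nat.lt_succ_iff_lt_or_eq.1 hj with hj | rfl
      · rw [hPj j hj]; exact hP2 j hj
      · simpa using hcur_le
    by_cases hlq : l = q ∨ l = J + 1
    · rcases hcase with ⟨h1, h2, -⟩ | ⟨h1, h2, -⟩ <;> rcases hlq with rfl | rfl <;> omega
    · rw [hln l (by omega) (by omega)]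
      rcases Nat.lt_succ_iff_lt_or_eq.1 hj with hj | rfl
      · rw [hPj j hj]; exact h.disj j hj l (by omega)
      · rw [Function.update_self, ← hcur]
        exact fun he => hlq (.inl (h.front_inj (by omega) (by omega) he).symm)
  · intro j hj
    rw [hch, hqu, hqv]
    rcases Nat.lt_succ_iff_lt_or_eq.1 hj with hj | rfl
    · rw [hPj j hj, Function.update_of_ne (hPne j hj), Function.update_of_ne (by omega),
        Function.update_of_ne (by omega)]
      exact h.child j hj
    · simp
  · intro j hj
    rcases Nat.lt_succ_iff_lt_or_eq.1 hj with hj | rfl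
    · rw [hPj j hj, hS _ (hP2 j hj)]
      exact (h.dataP j hj).congr (hrep _ (hPne j hj)) fun a ha => hrarr a ha _ (hPne j hj)
    · rw [Function.update_self, hS _ hcur_le]
      exact hdata
  · intro l hl _
    have hne : s.narr 3 l ≠ cur := fun he => by
      have := h.front_inj (l := l) (l' := q) (by omega) hq (he.trans hcur.symm)
      omega
    rw [hln l (by omega) (by omega), hS _ (h.front_le l (by omega))]
    obtain ⟨g1, g2⟩ := h.dataL l hl (by omega)
    exact ⟨g1.congr (hrep _ hne) fun a ha => hrarr a ha _ hne, by
      rw [hrarr _ (by omega) _ hne, g2]⟩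
  · intro l hl
    rcases Nat.lt_succ_iff_lt_or_eq.1 hl with hl | rfl
    · rw [hst _ (by omega), hst _ (by omega), hsz _ (by omega)]
      exact h.start l hl
    · rw [hst', hst _ le_rfl, hsz _ le_rfl]
end RealRAM

/-! ### Bounding boxes and trimmed windows -/

namespace RealRAM

/-- Extent and centre of the current node in dimension `k`; real register `2` holds the largest
extent so far, register `7` its dimension and real register `3` the midpoint. -/
def boxDim (d k : ℕ) : Cmd :=
  .seq (.setR 4 (.read k (.read (2 * k + 20) (.read 8 (.const k))))) <|
  .seq (.setR 5 (.read k (.read (2 * k + 20) (.read 9 (.const k))))) <|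
  .seq (.writeR (d + 3 + k) (.reg 5) (.div (.add (.reg 4) (.reg 5)) (.const 2))) <|
  .ite (.rlt (.reg 2) (.sub (.reg 5) (.reg 4)))
    (.seq (.setR 2 (.sub (.reg 5) (.reg 4))) <| .seq (.setN 7 (.const k)) <|
      .setR 3 (.div (.add (.reg 4) (.reg 5)) (.const 2)))
    .skip

/-- Representative, bounding box and longest side of the node in register `5`. -/
def computeBox (d : ℕ) : Cmd :=
  .seq (.setR 2 (.const 0)) <|
  .seq (.writeN 5 (.reg 5) (.read 20 (.read 8 (.const 0)))) <|
  .seq (forK d (boxDim d)) <|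
  .writeR (d + 1) (.reg 5) (.reg 2)

theorem Window.le_le {key : ℕ → ℝ} {A : ℕ → ℕ} {lo hi : ℕ} {L : Finset ℕ}
    (h : Window key A lo hi L) {e : ℕ} (he : e ∈ L) :
    key (A lo) ≤ key e ∧ key e ≤ key (A hi) := by
  obtain ⟨p, h₁, h₂, rfl⟩ := h.cover e he
  exact ⟨h.sorted _ _ le_rfl h₁ h₂, h.sorted _ _ h₁ h₂ le_rfl⟩

/-- State after `j` dimensions. In a window the first and last entries belong to the list, so their
coordinates are the extremes of the list. The dimension and midpoint are meaningful only once a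
positive extent has been found. -/
structure BoxInv (d : ℕ) (x : ℕ → ℕ → ℝ) (s₀ : State) (j : ℕ) (s : State) : Prop where
  nonneg : 0 ≤ s.rreg 2
  ext : ∀ k < j, x k (s₀.narr (2 * k + 20) (s₀.narr 9 k)) -
    x k (s₀.narr (2 * k + 20) (s₀.narr 8 k)) ≤ s.rreg 2
  ctr : ∀ k < j, s.rarr (d + 3 + k) (s₀.nreg 5) = (x k (s₀.narr (2 * k + 20) (s₀.narr 8 k)) +
    x k (s₀.narr (2 * k + 20) (s₀.narr 9 k))) / 2
  dim : 0 < s.rreg 2 → s.nreg 7 < j ∧ x (s.nreg 7) (s₀.narr (2 * s.nreg 7 + 20)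
      (s₀.narr 9 (s.nreg 7))) - x (s.nreg 7) (s₀.narr (2 * s.nreg 7 + 20)
      (s₀.narr 8 (s.nreg 7))) = s.rreg 2 ∧
    s.rreg 3 = (x (s.nreg 7) (s₀.narr (2 * s.nreg 7 + 20) (s₀.narr 8 (s.nreg 7))) +
      x (s.nreg 7) (s₀.narr (2 * s.nreg 7 + 20) (s₀.narr 9 (s.nreg 7)))) / 2
  other : ∀ a u, (u ≠ s₀.nreg 5 ∨ a < d + 3) → s.rarr a u = s₀.rarr a u

theorem computeBox_spec {d : ℕ} (hd : 0 < d) {x : ℕ → ℕ → ℝ} {s : State} {L : Finset ℕ}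
    (hx : ∀ k ≤ d, s.rarr k = x k)
    (hw : ∀ k < d, Window (x k) (s.narr (2 * k + 20)) (s.narr 8 k) (s.narr 9 k) L) :
    Run (computeBox d) s fun s' c =>
      ((∃ r ∈ L, s'.narr 5 = Function.update (s.narr 5) (s.nreg 5) r) ∧
        BoxOf d x L (s'.rreg 2) (fun k => s'.rarr (d + 3 + k) (s.nreg 5)) ∧
        s'.rarr (d + 1) (s.nreg 5) = s'.rreg 2 ∧
        (∀ k ≤ d, s'.rarr k = x k) ∧
        (∀ a u, u ≠ s.nreg 5 → s'.rarr a u = s.rarr a u) ∧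
        (0 < s'.rreg 2 → s'.nreg 7 < d ∧ x (s'.nreg 7) (s.narr (2 * s'.nreg 7 + 20)
          (s.narr 9 (s'.nreg 7))) - x (s'.nreg 7) (s.narr (2 * s'.nreg 7 + 20)
          (s.narr 8 (s'.nreg 7))) = s'.rreg 2 ∧
          s'.rreg 3 = (x (s'.nreg 7) (s.narr (2 * s'.nreg 7 + 20) (s.narr 8 (s'.nreg 7))) +
          x (s'.nreg 7) (s.narr (2 * s'.nreg 7 + 20) (s.narr 9 (s'.nreg 7)))) / 2) ∧
        c ≤ 60 * d + 20) ∧ Frame (computeBox d) s s' := by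
  refine Run.frame (Run.of_forall fun R hR => ?_)
  rw [computeBox, run_seq, run_setR, run_seq, run_writeN, run_seq]
  refine (Run.forK (BoxInv d x s) (fun _ => 0) 60 ?_ ?_).mono ?_
  · refine ⟨by simp, by simp, by simp, by simp, by simp⟩
  · rintro k s₁ hk hF ⟨i1, i2, i3, i4, i5⟩
    refine Run.of_forall fun R hR => ?_
    have e5 : s₁.nreg 5 = s.nreg 5 := by rw [hF.n 5 (by simp [boxDim])]
    have e8 : s₁.narr 8 = s.narr 8 := by rw [hF.na 8 (by simp [boxDim])]; simp
    have e9 : s₁.narr 9 = s.narr 9 := by rw [hF.na 9 (by simp [boxDim])]; simp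
    have eA : s₁.narr (2 * k + 20) = s.narr (2 * k + 20) := by
      rw [hF.na _ (by simp [boxDim])]
      simp only
      rw [Function.update_of_ne (by omega)]
    have eX : s₁.rarr k = x k := by
      rw [← hx k hk.le]; funext u; exact i5 k u (.inr (by omega))
    have hne : k ≠ d + 3 + k := by omega
    simp only [boxDim, run_seq, run_setR, run_writeR, run_ite, run_setN, run_skip, Test.Holds,
      NExp.eval, RExp.eval]
    simp [e5, e8, e9, eA, eX]
    set a := x k (s.narr (2 * k + 20) (s.narr 8 k)) with ha
    set b := x k (s.narr (2 * k + 20) (s.narr 9 k)) with hb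
    refine ⟨fun hlt => hR _ _ ⟨⟨?_, ?_, ?_, ?_, ?_⟩, ?_⟩,
      fun hge => hR _ _ ⟨⟨?_, ?_, ?_, ?_, ?_⟩, ?_⟩⟩
    · simp; linarith
    · intro k' hk'
      rcases Nat.lt_succ_iff_lt_or_eq.1 hk' with hk' | rfl
      · have := i2 k' hk'
        simp
        linarith
      · simp [← ha, ← hb]
    · intro k' hk'
      rcases Nat.lt_succ_iff_lt_or_eq.1 hk' with hk' | rfl
      · have := i3 k' hk'
        simp [show k' ≠ k by omega, this]
      · simp [← ha, ← hb]
    · intro _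
      simp [← ha, ← hb]
    · intro a' u hau
      simp only
      by_cases h : a' = d + 3 + k
      · subst h
        rw [Function.update_self, Function.update_of_ne (by omega)]
        exact i5 _ _ hau
      · rw [Function.update_of_ne h]
        exact i5 _ _ hau
    · simp
    · simpa using i1
    · intro k' hk'
      rcases Nat.lt_succ_iff_lt_or_eq.1 hk' with hk' | rfl
      · have := i2 k' hk'
        simpa using this
      · simpa [← ha, ← hb] using hge
    · intro k' hk'
      rcases Nat.lt_succ_iff_lt_or_eq.1 hk' with hk' | rfl
      · have := i3 k' hk'
        simp [show k' ≠ k by omega, this]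
      · simp [← ha, ← hb]
    · intro h
      simp at h ⊢
      exact ⟨(i4 h).1.le, (i4 h).2⟩
    · intro a' u hau
      simp only
      by_cases h : a' = d + 3 + k
      · subst h
        rw [Function.update_self, Function.update_of_ne (by omega)]
        exact i5 _ _ hau
      · rw [Function.update_of_ne h]
        exact i5 _ _ hau
    · simp
  · rintro s₁ c₁ ⟨⟨⟨i1, i2, i3, i4, i5⟩, hc⟩, hF⟩
    have e5 : s₁.nreg 5 = s.nreg 5 := by rw [hF.n 5 (by simp [boxDim])]
    have e5' : s₁.narr 5 = Function.update (s.narr 5) (s.nreg 5) (s.narr 20 (s.narr 8 0)) := by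
      rw [hF.na _ (by simp [boxDim])]; simp
    rw [run_writeR]
    refine hR _ _ ⟨⟨_, (hw 0 hd).first, e5'⟩, ⟨i1, ?_, ?_⟩, ?_, ?_, ?_, i4, ?_⟩
    · intro k hk e he e' he'
      have h1 := (hw k hk).le_le he
      have h2 := (hw k hk).le_le he'
      exact le_trans (by linarith) (i2 k hk)
    · intro k hk e he
      have h1 := (hw k hk).le_le he
      have h2 := i2 k hk
      simp only [NExp.eval, RExp.eval, e5]
      rw [Function.update_of_ne (by omega), i3 k hk, abs_le]
      constructor <;> linarith
    · simp [e5]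
    · intro k hk
      simp only
      rw [Function.update_of_ne (by omega), ← hx k hk]
      funext u
      exact i5 k u (.inr (by omega))
    · intro a u hu
      simp only [NExp.eval, e5]
      by_cases h : a = d + 1
      · subst h
        rw [Function.update_self, Function.update_of_ne hu]
        exact i5 _ _ (.inl hu)
      · rw [Function.update_of_ne h]
        exact i5 _ _ (.inl hu)
    · simp
      omega

/-- Prepare the next split: in every dimension set the filling pointer of the new list and move
the ends of the window to elements that are still in the list. -/
def trim (d : ℕ) : Cmd :=
  forK d fun k => .seq (.writeN (2 * k + 21) (.reg 1) (.read 1 (.reg 1))) (skipLoops k)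

/-- Total length of the windows. -/
def spread (d : ℕ) (s : State) : ℕ := ∑ k ∈ Finset.range d, (s.narr 9 k - s.narr 8 k)

/-- If only the window of dimension `k` changes its length, so does the total; stated additively
because subtraction truncates. -/
theorem spread_eq {d : ℕ} {s s' : State} {k : ℕ} (hk : k < d)
    (h : ∀ k' < d, k' ≠ k → s'.narr 9 k' - s'.narr 8 k' = s.narr 9 k' - s.narr 8 k') :
    spread d s' + (s.narr 9 k - s.narr 8 k) = spread d s + (s'.narr 9 k - s'.narr 8 k) := by
  have hk' := Finset.mem_range.2 hk
  rw [spread, spread, ← Finset.add_sum_erase _ _ hk', ← Finset.add_sum_erase _ _ hk']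
  rw [Finset.sum_congr rfl fun k' hk' => h k' (Finset.mem_range.1 (Finset.mem_of_mem_erase hk'))
    (Finset.ne_of_mem_erase hk')]
  omega

theorem spread_update {d : ℕ} {s s' : State} {k lo hi : ℕ} (hk : k < d)
    (h8 : s'.narr 8 = Function.update (s.narr 8) k lo)
    (h9 : s'.narr 9 = Function.update (s.narr 9) k hi) :
    spread d s' + (s.narr 9 k - s.narr 8 k) = spread d s + (hi - lo) := by
  have := spread_eq (s := s) (s' := s') hk fun k' _ hne => by simp [h8, h9, hne]
  simpa [h8, h9] using this

structure TrimInv (d : ℕ) (x : ℕ → ℕ → ℝ) (s₀ : State) (L : Finset ℕ) (j : ℕ) (s : State) :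
    Prop where
  win : ∀ k < j, Window (x k) (s₀.narr (2 * k + 20)) (s.narr 8 k) (s.narr 9 k) L
  bound : ∀ k < d, s₀.narr 8 k ≤ s.narr 8 k ∧ s.narr 9 k ≤ s₀.narr 9 k
  rest : ∀ k, j ≤ k → s.narr 8 k = s₀.narr 8 k ∧ s.narr 9 k = s₀.narr 9 k
  fill : ∀ k < j, s.narr (2 * k + 21) = Function.update (s₀.narr (2 * k + 21)) (s₀.nreg 1)
    (s₀.narr 1 (s₀.nreg 1))
  fill' : ∀ k, j ≤ k → s.narr (2 * k + 21) = s₀.narr (2 * k + 21)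

/-- A split in one dimension removes elements in the middle of the windows of the others. Only the
end positions have to be repaired, and the shortening of the windows pays for that. -/
theorem trim_spec {d : ℕ} {x : ℕ → ℕ → ℝ} {s : State} {L : Finset ℕ} (hne : L.Nonempty)
    (hx : ∀ k < d, s.rarr k = x k)
    (hcov : ∀ k < d, Cover (x k) (s.narr (2 * k + 20)) (s.narr 8 k) (s.narr 9 k) L)
    (hmem : ∀ k < d, ∀ p, s.narr 8 k ≤ p → p ≤ s.narr 9 k →
      (s.narr (2 * k + 20) p ∈ L ↔ s.narr 0 (s.narr (2 * k + 20) p) ≤ s.nreg 2)) :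
    Run (trim d) s fun s' c =>
      (TrimInv d x s L d s' ∧ c + 20 * spread d s' ≤ 20 * spread d s + 30 * d + 1) ∧
        Frame (trim d) s s' := by
  rw [trim]
  refine (Run.forK (TrimInv d x s L) (fun s => 20 * spread d s) 30 ?_ ?_).mono ?_
  · exact ⟨by simp, fun _ _ => ⟨le_rfl, le_rfl⟩, fun _ _ => ⟨rfl, rfl⟩, by simp, fun _ _ => rfl⟩
  · rintro k s₁ hk hF ⟨i1, i2, i3, i4, i5⟩
    refine Run.of_forall fun R hR => ?_
    have e8 := (i3 k le_rfl).1
    have e9 := (i3 k le_rfl).2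
    have e0 : s₁.narr 0 = s.narr 0 := by rw [hF.na 0 (by simp [skipLoops])]
    have e1 : s₁.narr 1 = s.narr 1 := by rw [hF.na 1 (by simp [skipLoops])]
    have eA : s₁.narr (2 * k + 20) = s.narr (2 * k + 20) := by
      rw [hF.na _ (by simp [skipLoops]; omega)]
    have f1 : s₁.nreg 1 = s.nreg 1 := by rw [hF.n 1 (by simp [skipLoops])]
    have f2 : s₁.nreg 2 = s.nreg 2 := by rw [hF.n 2 (by simp [skipLoops])]
    have eX : s₁.rarr k = x k := by rw [hF.ra k (by simp [skipLoops]), hx k hk]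
    have hA : ∀ f, Function.update s₁.narr (2 * k + 21) f (2 * k + 20) = s.narr (2 * k + 20) :=
      fun f => by rw [Function.update_of_ne (by omega), eA]
    rw [run_seq, run_writeN]
    refine (skipLoops_spec (L := L) hne ?_ ?_).mono ?_
    · simp only [hA, eX, NExp.eval]
      simpa [e8, e9] using hcov k hk
    · simp only [hA, eX, NExp.eval, f2]
      simpa [e8, e9, e0] using hmem k hk
    · rintro s₂ c₂ ⟨lo, hi, rfl, hlo, hhi, hwin, hc⟩
      simp only [hA, eX, NExp.eval, f2, f1] at hwin hlo hhi hc
      simp [e8, e9] at hlo hhi hc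
      have hle := hwin.le
      refine hR _ _ ⟨⟨?_, ?_, ?_, ?_, ?_⟩, ?_⟩
      · intro k' hk'
        rcases Nat.lt_succ_iff_lt_or_eq.1 hk' with hk' | rfl
        · simpa [show k' ≠ k by omega] using i1 k' hk'
        · simpa using hwin
      · intro k' hk'
        rcases eq_or_ne k' k with rfl | hne
        · simpa using ⟨hlo, hhi⟩
        · simpa [hne] using i2 k' hk'
      · intro k' hk'
        simpa [show k' ≠ k by omega] using i3 k' (by omega)
      · intro k' hk'
        simp only
        rw [Function.update_of_ne (by omega), Function.update_of_ne (by omega)]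
        rcases Nat.lt_succ_iff_lt_or_eq.1 hk' with hk' | rfl
        · rw [Function.update_of_ne (by omega)]
          exact i4 k' hk'
        · rw [Function.update_self, i5 k' le_rfl, NExp.eval, NExp.eval, NExp.eval, f1, e1]
      · intro k' hk'
        simp only
        rw [Function.update_of_ne (by omega), Function.update_of_ne (by omega),
          Function.update_of_ne (by omega)]
        exact i5 k' (by omega)
      · have key : ∀ s' : State, ∀ c', c' ≤ c₂ + 8 → s'.narr 8 = Function.update (s₁.narr 8) k lo →
            s'.narr 9 = Function.update (s₁.narr 9) k hi →
            c' + 20 * spread d s' ≤ 20 * spread d s₁ + 30 := by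
          intro s' c' h1 h2 h3
          have := spread_update hk h2 h3
          omega
        exact key _ _ (by simp; omega) (by simp) (by simp)
  · rintro s' c ⟨⟨h, hc⟩, hF⟩
    exact ⟨⟨h, by omega⟩, hF⟩
end RealRAM

/-! ### Following the heavy path of a list -/

namespace RealRAM

/-- Split the current node, whose bounding box is known. -/
def splitNode (d : ℕ) : Cmd :=
  .seq (.writeR (d + 2) (.reg 5) (.mul (.const (3 / 2 * d)) (.reg 2))) <|
  .seq (.writeN 4 (.reg 5) (.add (.add (.reg 1) (.reg 1)) (.const 1))) <|
  .seq (.writeN 6 (.reg 1) (.add (.add (.reg 1) (.reg 1)) (.const 1))) <|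
  .seq (.writeN 7 (.reg 1) (.add (.add (.reg 1) (.reg 1)) (.const 2))) <|
  .seq (.setN 8 (.const 0)) <|
  .seq (.writeN 1 (.add (.reg 1) (.const 1)) (.add (.read 1 (.reg 1)) (.read 2 (.reg 1)))) <|
  .seq (switchK 7 d splitDim) <|
  .seq (.setN 1 (.add (.reg 1) (.const 1))) <|
  .seq (.writeN 3 (.reg 1) (.reg 24)) <|
  .seq (.writeN 3 (.reg 2) (.reg 5)) <|
  .seq (.writeN 2 (.reg 1) (.reg 8)) <|
  trim d

/-- A leaf has a single ball, and its radius replaces the multiple of the side length. Register `6`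
is the flag that keeps the heavy path running. -/
def finishLeaf (d : ℕ) : Cmd :=
  .seq (.writeR (d + 2) (.reg 5) (.read d (.read 5 (.reg 5)))) (.setN 6 (.const 0))

/-- One step down the tree along the list in register `2`. -/
def heavyStep (d : ℕ) : Cmd :=
  .seq (computeBox d) (.ite (.rlt (.const 0) (.reg 2)) (splitNode d) (finishLeaf d))

/-- The state while list `q` is processed; `s₀` is the state before. -/
structure Inner (d n : ℕ) (x : ℕ → ℕ → ℝ) (q J₀ st en : ℕ) (s₀ s : State) : Prop where
  core : ∃ S P kap mid, Core d n x q (s.nreg 1) s S P kap mid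
  le : J₀ ≤ s.nreg 1
  cur : s.nreg 5 = s.narr 3 q
  arr : ∀ k, s.narr (2 * k + 20) = s₀.narr (2 * k + 20)
  lab : ∀ e < n, s.narr 0 e = s₀.narr 0 e ∨ s₀.narr 0 e = q ∧ J₀ < s.narr 0 e
  old : ∀ l ≤ J₀, s.narr 1 l = s₀.narr 1 l ∧ s.narr 2 l = s₀.narr 2 l
  size : ∀ l, J₀ < l → l ≤ s.nreg 1 → s.narr 2 l = (labelled n (s.narr 0) l).card ∧
    2 * s.narr 2 l ≤ en - st
  fill : ∀ l, J₀ < l → l ≤ s.nreg 1 → ∀ k < d, s.narr (2 * k + 21) l = s.narr 1 l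
  win : 0 < s.nreg 6 → ∀ k < d, Window (x k) (s.narr (2 * k + 20)) (s.narr 8 k) (s.narr 9 k)
    (labelled n (s.narr 0) q) ∧ st ≤ s.narr 8 k ∧ s.narr 9 k < en
  done : s.nreg 6 = 0 → NodeData d x s (s.narr 3 q) (labelled n (s.narr 0) q) ∧
    s.rarr (d + 1) (s.narr 3 q) = 0

theorem Core.congr {d n : ℕ} {x : ℕ → ℕ → ℝ} {q J : ℕ} {s s' : State} {S : ℕ → Finset ℕ}
    {P kap : ℕ → ℕ} {mid : ℕ → ℝ} (h : Core d n x q J s S P kap mid)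
    (hn : ∀ a < 3, s'.nreg a = s.nreg a) (hr : s'.rarr = s.rarr)
    (hna : ∀ a < 8, s'.narr a = s.narr a) : Core d n x q J s' S P kap mid := by
  have hd : ∀ u A, NodeData d x s u A → NodeData d x s' u A := fun u A h =>
    h.congr (by rw [hna 5 (by norm_num)]) fun a _ => by rw [hr]
  obtain ⟨h1, h2, h3, h4, h5, h6, h7, h8, h9, h10, h11, h12, h13, h14, h15, h16⟩ := h
  simp only [← hn 0 (by norm_num), ← hn 1 (by norm_num), ← hn 2 (by norm_num), ← hr,
    ← hna 0 (by norm_num), ← hna 1 (by norm_num), ← hna 2 (by norm_num), ← hna 3 (by norm_num),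
    ← hna 4 (by norm_num), ← hna 6 (by norm_num), ← hna 7 (by norm_num)]
    at h1 h2 h3 h4 h5 h7 h8 h9 h10 h11 h12 h13 h15 h16
  exact ⟨h1, h2, h3, h4, h5, h6, h7, h8, h9, h10, h11, h12, h13, fun j hj => hd _ _ (h14 j hj),
    fun l hl hl' => ⟨hd _ _ (h15 l hl hl').1, (h15 l hl hl').2⟩, h16⟩

theorem trim_frame {d : ℕ} {s s' : State} (h : Frame (trim d) s s') :
    s'.nreg = s.nreg ∧ s'.rreg = s.rreg ∧ s'.rarr = s.rarr ∧
      ∀ a, a ≠ 8 → a ≠ 9 → (∀ k, a ≠ 2 * k + 21) → s'.narr a = s.narr a := by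
  refine ⟨funext fun y => h.n y ?_, funext fun y => h.r y ?_, funext fun y => h.ra y ?_,
    fun a h8 h9 hk => h.na a ?_⟩ <;> simp [trim, skipLoops]
  simp [h8, h9, hk]

theorem splitDim_frame {k : ℕ} {s s' : State} (h : Frame (splitDim k) s s') :
    s'.rreg = s.rreg ∧ s'.rarr = s.rarr ∧
      (∀ a, a ≠ 0 → a ≠ 8 → a ≠ 9 → s'.narr a = s.narr a) ∧
      ∀ a, (a < 5 ∨ a = 6 ∨ a = 7) → s'.nreg a = s.nreg a := by
  refine ⟨funext fun y => h.r y ?_, funext fun y => h.ra y ?_,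
    fun a h0 h8 h9 => h.na a ?_, fun a ha => h.n a ?_⟩ <;>
      simp [splitDim, scanLoop, labelLoop]
  · simp [h0, h8, h9]
  · omega

theorem computeBox_frame {d : ℕ} {s s' : State} (h : Frame (computeBox d) s s') :
    (∀ a, a ≠ 5 → s'.narr a = s.narr a) ∧ ∀ a, a ≠ 7 → s'.nreg a = s.nreg a := by
  refine ⟨fun a ha => h.na a ?_, fun a ha => h.n a ?_⟩ <;> simp [computeBox, boxDim, ha]

/-- Potential: the total window length plus the flag in register `6`. A split shortens a window by
`i ≥ 1` positions, which pays for the cost linear in `i` and for the overhead of order `d`; the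
final step, at a leaf, is paid by the flag. -/
theorem heavyStep_spec {d n : ℕ} (hd : 0 < d) {x : ℕ → ℕ → ℝ} {q J₀ st en : ℕ} {s₀ s : State}
    (hq : q ≤ J₀)
    (hseg : ∀ k < d, ∀ p, st ≤ p → p < en → s₀.narr (2 * k + 20) p < n ∧
      s₀.narr 0 (s₀.narr (2 * k + 20) p) = q)
    (hI : Inner d n x q J₀ st en s₀ s) (hgo : 0 < s.nreg 6) :
    Run (heavyStep d) s fun s' c => Inner d n x q J₀ st en s₀ s' ∧
      c + 4 + (100 * d + 400) * (spread d s' + s'.nreg 6) ≤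
        (100 * d + 400) * (spread d s + s.nreg 6) := by
  obtain ⟨⟨S, P, kap, mid, hcore⟩, hle, hcur, harr, hlab, hold, hsize, hfill, hwin, -⟩ := id hI
  have hwin := hwin hgo
  set J := s.nreg 1 with hJ
  set cur := s.nreg 5 with hcur'
  have hfront : S cur = labelled n (s.narr 0) q := by rw [hcur]; exact hcore.front q (by omega)
  refine Run.of_forall fun R hR => ?_
  rw [heavyStep, run_seq]
  refine (computeBox_spec (L := labelled n (s.narr 0) q) hd hcore.coord
    fun k hk => (hwin k hk).1).mono ?_
  rintro s₁ c₁ ⟨⟨⟨r, hr, hrep⟩, hbox, hel, hcoord, hother, hdim, hc₁⟩, hF₁⟩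
  obtain ⟨fna₁, fn₁⟩ := computeBox_frame hF₁
  rw [← hcur'] at hrep hbox hel hother
  have h15 : s₁.nreg 5 = cur := fn₁ 5 (by norm_num)
  have h11 : s₁.nreg 1 = J := fn₁ 1 (by norm_num)
  have h12 : s₁.nreg 2 = q := (fn₁ 2 (by norm_num)).trans hcore.r2
  rw [run_ite]
  refine ⟨fun hpos => ?_, fun hzero => ?_⟩
  · simp only [Test.Holds, RExp.eval, Rat.cast_zero] at hpos
    obtain ⟨hk, hext, hmid⟩ := hdim hpos
    set k := s₁.nreg 7 with hk7
    simp only [splitNode, run_seq, run_writeR, run_writeN, run_setN, NExp.eval, RExp.eval, h15, h11]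
    set s₂ : State := ⟨Function.update s₁.nreg 8 0, s₁.rreg, _, _, s₁.out⟩ with hs₂
    have n2 : ∀ a, a ≠ 8 → s₂.nreg a = s₁.nreg a := fun a ha => Function.update_of_ne ha _ _
    have na2 : ∀ a, a ≠ 1 → a ≠ 4 → a ≠ 6 → a ≠ 7 → s₂.narr a = s₁.narr a := by
      intro a h1 h4 h6 h7
      simp [hs₂, h1, h4, h6, h7]
    have a2 : ∀ k, s₂.narr (2 * k + 20) = s.narr (2 * k + 20) := fun k => by
      rw [na2 _ (by omega) (by omega) (by omega) (by omega), fna₁ _ (by omega)]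
    have b2 : ∀ a, a = 0 ∨ a = 3 ∨ a = 2 ∨ a = 8 ∨ a = 9 → s₂.narr a = s.narr a := by
      intro a ha
      rw [na2 _ (by omega) (by omega) (by omega) (by omega), fna₁ _ (by omega)]
    have x2 : ∀ k ≤ d, s₂.rarr k = x k := fun k hk => by
      simp only [hs₂]
      rw [Function.update_of_ne (by omega), hcoord k hk]
    have hwk := hwin k hk
    refine Run.switchK (k := k) (n2 7 (by norm_num)) hk ?_
    have hmem : ∀ k' < d, ∀ p, st ≤ p → p < en → s.narr (2 * k' + 20) p < n ∧
        q ≤ s.narr 0 (s.narr (2 * k' + 20) p) ∧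
        s₀.narr 0 (s.narr (2 * k' + 20) p) = q := by
      intro k' hk' p h1 h2
      obtain ⟨h3, h4⟩ := hseg k' hk' p h1 h2
      rw [harr]
      have := hlab _ h3
      exact ⟨h3, by omega, h4⟩
    refine (splitDim_spec (n := n) ?_ ?_ ?_ ?_ ?_ ?_ ?_).mono ?_
    · rw [x2 k hk.le, a2, b2 0 (by simp), b2 8 (by simp), b2 9 (by simp), n2 2 (by norm_num), h12]
      exact hwk.1
    · intro p h1 h2
      rw [b2 8 (by simp)] at h1
      rw [b2 9 (by simp)] at h2
      rw [a2, b2 0 (by simp), n2 2 (by norm_num), h12]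
      have := hmem k hk p (by omega) (by omega)
      exact ⟨this.1, this.2.1⟩
    · rw [x2 k hk.le, a2, b2 8 (by simp)]
      change _ < s₁.rreg 3
      rw [hmid]
      linarith
    · rw [x2 k hk.le, a2, b2 9 (by simp)]
      change s₁.rreg 3 ≤ _
      rw [hmid]
      linarith
    · simp [hs₂]
    · rw [n2 2 (by norm_num), n2 1 (by norm_num), h12, h11]
      omega
    · rw [b2 0 (by simp), n2 1 (by norm_num), h11]
      exact hcore.lab_le
    rintro s₃ c₃ ⟨⟨⟨lo, hi, i, h38, h39, hlo, hhi, hi1, hi2, hdrop, hc₃, h3i, hcov⟩, hcard, hcase⟩,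
      hF₃⟩ c₃' hc₃'
    obtain ⟨fr₃, fra₃, fna₃, fn₃⟩ := splitDim_frame hF₃
    have h31 : s₃.nreg 1 = J := by rw [fn₃ 1 (by norm_num), n2 1 (by norm_num), h11]
    have h32 : s₃.nreg 2 = q := by rw [fn₃ 2 (by norm_num), n2 2 (by norm_num), h12]
    simp only [Function.update_self, h31]
    set s₄ : State := ⟨Function.update s₃.nreg 1 (J + 1), s₃.rreg, _, s₃.rarr, s₃.out⟩ with hs₄
    have n4 : ∀ a, a ≠ 1 → s₄.nreg a = s₃.nreg a := fun a ha => Function.update_of_ne ha _ _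
    have h41 : s₄.nreg 1 = J + 1 := by simp [hs₄]
    have h42 : s₄.nreg 2 = q := (n4 2 (by norm_num)).trans h32
    have na4 : ∀ a, a ≠ 2 → a ≠ 3 → s₄.narr a = s₃.narr a := by
      intro a h2 h3
      simp [hs₄, h2, h3]
    have h43 : s₄.narr 3 = Function.update (Function.update (s.narr 3) (J + 1) (s₃.nreg 24)) q
        (s₃.nreg 5) := by
      simp [hs₄, h32, fna₃ 3, b2 3]
    have h4s : s₄.narr 2 = Function.update (s.narr 2) (J + 1) (s₃.nreg 8) := by
      simp [hs₄, fna₃ 2, b2 2]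
    have x4 : s₄.rarr = Function.update s₁.rarr (d + 2) (Function.update (s₁.rarr (d + 2)) cur
        ((3 / 2 * d : ℚ) * s₁.rreg 2)) := fra₃
    have a4 : ∀ k, s₄.narr (2 * k + 20) = s.narr (2 * k + 20) := fun k => by
      rw [na4 _ (by omega) (by omega), fna₃ _ (by omega) (by omega) (by omega), a2]
    have h45 : s₄.narr 5 = Function.update (s.narr 5) cur r := by
      rw [na4 _ (by omega) (by omega), fna₃ _ (by omega) (by omega) (by omega),
        na2 _ (by omega) (by omega) (by omega) (by omega), hrep]
    have h4st : s₄.narr 1 = Function.update (s.narr 1) (J + 1) (s.narr 1 J + s.narr 2 J) := by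
      rw [na4 _ (by omega) (by omega), fna₃ _ (by omega) (by omega) (by omega)]
      simp [hs₂, fna₁, h11]
    have h40 : s₄.narr 0 = s₃.narr 0 := na4 _ (by omega) (by omega)
    have hqJ : q ≠ J + 1 := by omega
    rw [h31] at *
    rw [n2 2 (by norm_num), h12] at hcov hcase
    rw [n2 1 (by norm_num), h11] at hcard hcase
    rw [b2 0 (by simp)] at hcase
    rw [x2 k hk.le] at hcase hcov
    have hcore₄ : ∃ S' P' kap' mid', Core d n x q (J + 1) s₄ S' P' kap' mid' := by
      refine hcore.split (by omega) hcur.symm ?_ h41 h42 ?_ ?_ ?_ ?_ ?_ ?_ ?_ ?_ ?_ ?_ ?_ hk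
        (m := s₁.rreg 3) ?_ ?_
      · rw [n4 0 (by norm_num), fn₃ 0 (by norm_num), n2 0 (by norm_num), fn₁ 0 (by norm_num)]
        exact hcore.r0
      · intro k hk
        rw [x4, Function.update_of_ne (by omega), hcoord k hk, hcore.coord k hk]
      · intro a ha u hu
        rw [x4]
        rcases eq_or_ne a (d + 2) with rfl | hne
        · rw [Function.update_self, Function.update_of_ne hu, hother _ _ hu]
        · rw [Function.update_of_ne hne, hother _ _ hu]
      · intro u hu
        rw [h45, Function.update_of_ne hu]
      · rw [hfront]
        have e1 : s₄.rarr (d + 1) cur = s₁.rreg 2 := by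
          rw [x4, Function.update_of_ne (by omega), hel]
        refine ⟨by rw [h45, Function.update_self]; exact hr, ?_, ?_, ?_⟩
        · rw [e1]
          convert hbox using 2 with k
          rw [x4, Function.update_of_ne (by omega)]
        · intro _
          rw [e1, x4, Function.update_self, Function.update_self]
          push_cast
          rfl
        · intro h
          rw [e1] at h
          exact absurd h hpos.ne'
      · rw [na4 _ (by omega) (by omega), fna₃ _ (by omega) (by omega) (by omega)]
        simp [hs₂, fna₁, two_mul]
      · rw [na4 _ (by omega) (by omega), fna₃ _ (by omega) (by omega) (by omega)]
        simp [hs₂, fna₁, two_mul]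
      · rw [na4 _ (by omega) (by omega), fna₃ _ (by omega) (by omega) (by omega)]
        simp [hs₂, fna₁, two_mul]
      · intro l hl
        rw [h4st, Function.update_of_ne (by omega)]
      · rw [h4st, Function.update_self]
      · intro l hl
        rw [h4s, Function.update_of_ne (by omega)]
      · intro l hl hlq
        rw [h43, Function.update_of_ne hlq, Function.update_of_ne (by omega)]
      · rw [h43, Function.update_self, Function.update_of_ne hqJ.symm, Function.update_self, h40]
        exact hcase
      · rw [hfront, x4, Function.update_of_ne (by omega), hel]
        exact ⟨_, hwk.1.first, _, hwk.1.last, hext, hmid, hpos⟩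
    obtain ⟨S', P', kap', mid', hcore₄⟩ := hcore₄
    have hlab₃ : ∀ e < n, s₃.narr 0 e = s.narr 0 e ∨ s.narr 0 e = q ∧ s₃.narr 0 e = J + 1 := by
      intro e he
      rcases hcase with ⟨-, -, h⟩ | ⟨-, -, h⟩ <;>
      · rw [h e he]
        split_ifs with h'
        · exact .inr ⟨h'.1, rfl⟩
        · exact .inl rfl
    have hsub : labelled n (s₃.narr 0) q ⊆ labelled n (s.narr 0) q := by
      intro e he
      rw [mem_labelled] at he ⊢
      have := hlab₃ e he.1
      exact ⟨he.1, by omega⟩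
    have b4 : ∀ a, a = 8 ∨ a = 9 → s₄.narr a = s₃.narr a := fun a ha => na4 a (by omega) (by omega)
    rw [b2 8 (by simp)] at h38 hlo hi2 hdrop
    rw [b2 9 (by simp)] at h39 hhi hi2 hdrop
    have hlohi : ∀ k' < d, s.narr 8 k' ≤ s₄.narr 8 k' ∧ s₄.narr 9 k' ≤ s.narr 9 k' := by
      intro k' hk'
      rw [b4 8 (by simp), b4 9 (by simp), h38, h39]
      rcases eq_or_ne k' k with rfl | hne
      · simpa using ⟨hlo, hhi⟩
      · simp [hne]
    have hcov₄ : ∀ k' < d, Cover (x k') (s₄.narr (2 * k' + 20)) (s₄.narr 8 k') (s₄.narr 9 k')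
        (labelled n (s₃.narr 0) q) := by
      intro k' hk'
      rw [b4 8 (by simp), b4 9 (by simp), h38, h39, a4]
      rcases eq_or_ne k' k with rfl | hne
      · simpa [a2] using hcov
      · simpa [hne] using (hwin k' hk').1.toCover.mono hsub
    refine (trim_spec (x := x) (L := labelled n (s₃.narr 0) q) ?_ ?_ hcov₄ ?_).mono ?_
    · have := hcore₄.ne q (by omega)
      rwa [hcore₄.front q (by omega), h40] at this
    · exact fun k hk => hcore₄.coord k hk.le
    · intro k' hk' p h1 h2
      have h3 := hlohi k' hk'
      have h4 := hwin k' hk'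
      rw [a4, h40, h42, mem_labelled]
      obtain ⟨g1, g2, g3⟩ := hmem k' hk' p (by omega) (by omega)
      have := hlab₃ _ g1
      exact ⟨fun h => h.2.le, fun h => ⟨g1, by omega⟩⟩
    rintro s₅ c₅ ⟨⟨⟨hwin₅, hbd₅, -, hfill₅, -⟩, hc₅⟩, hF₅⟩
    obtain ⟨fn₅, -, fra₅, fna₅⟩ := trim_frame hF₅
    have h51 : s₅.nreg 1 = J + 1 := by rw [fn₅, h41]
    have m5 : ∀ a < 8, s₅.narr a = s₄.narr a := fun a ha =>
      fna₅ a (by omega) (by omega) (fun k => by omega)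
    have a5 : ∀ k, s₅.narr (2 * k + 20) = s.narr (2 * k + 20) := fun k =>
      (fna₅ _ (by omega) (by omega) (fun k => by omega)).trans (a4 k)
    have h56 : s₅.nreg 6 = s.nreg 6 := by
      rw [fn₅, n4 6 (by norm_num), fn₃ 6 (by norm_num), n2 6 (by norm_num), fn₁ 6 (by norm_num)]
    refine hR _ _ ⟨⟨?_, ?_, ?_, ?_, ?_, ?_, ?_, ?_, ?_, ?_⟩, ?_⟩
    · rw [h51]
      exact ⟨S', P', kap', mid', hcore₄.congr (fun a _ => by rw [fn₅]) fra₅ m5⟩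
    · omega
    · rw [m5 3 (by norm_num), h43, Function.update_self, fn₅, n4 5 (by norm_num)]
    · intro k
      rw [a5, harr]
    · intro e he
      rw [m5 0 (by norm_num), h40]
      have h1 := hlab₃ e he
      have h2 := hlab e he
      omega
    · intro l hl
      rw [m5 1 (by norm_num), m5 2 (by norm_num), h4st, h4s, Function.update_of_ne (by omega),
        Function.update_of_ne (by omega)]
      exact hold l hl
    · intro l hl hl'
      rw [h51] at hl'
      rw [m5 0 (by norm_num), m5 2 (by norm_num), h4s, h40]
      rcases Nat.lt_succ_iff_lt_or_eq.1 (Nat.lt_succ_of_le hl') with hlt | rfl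
      · rw [Function.update_of_ne (by omega)]
        convert hsize l hl (by omega) using 3
        ext e
        simp only [mem_labelled]
        refine and_congr_right fun he => ?_
        have := hlab₃ e he
        omega
      · rw [Function.update_self]
        -- The window lies inside `[st, en)`, so half of its length bounds the new size by half of
        -- `en - st`.
        exact ⟨hcard, by have := hwin k hk; omega⟩
    · intro l hl hl' k' hk'
      rw [h51] at hl'
      rw [hfill₅ k' hk', m5 1 (by norm_num), h41]
      rcases Nat.lt_succ_iff_lt_or_eq.1 (Nat.lt_succ_of_le hl') with hlt | rfl
      · rw [Function.update_of_ne (by omega), na4 _ (by omega) (by omega),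
          fna₃ _ (by omega) (by omega) (by omega),
          na2 _ (by omega) (by omega) (by omega) (by omega), fna₁ _ (by omega), h4st,
          Function.update_of_ne (by omega)]
        exact hfill l hl (by omega) k' hk'
      · rw [Function.update_self]
    · intro _ k' hk'
      have h1 := hwin₅ k' hk'
      have h2 := hbd₅ k' hk'
      have h3 := hlohi k' hk'
      have h4 := hwin k' hk'
      rw [a5, m5 0 (by norm_num), h40]
      rw [a4] at h1
      exact ⟨h1, by omega, by omega⟩
    · intro h
      omega
    · have hsp := spread_update (d := d) (s := s) (s' := s₄) hk
        (by rw [b4 8 (by simp), h38]) (by rw [b4 9 (by simp), h39])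
      have hle₅ : spread d s₅ ≤ spread d s₄ := Finset.sum_le_sum fun k' hk' => by
        have := hbd₅ k' (Finset.mem_range.1 hk')
        omega
      -- Before trimming, the windows are shorter by exactly `i`; the further shortening `w` is
      -- spent on the skipping loops.
      have hle' := hwk.1.le
      have hlohi' := ((hcov₄ k hk).le_of_nonempty (by
        have := hcore₄.ne q (by omega)
        rwa [hcore₄.front q (by omega), h40] at this))
      simp only [b4, true_or, or_true, h38, h39, Function.update_self] at hlohi'
      have hsum : spread d s = spread d s₄ + i := by omega
      obtain ⟨w, hw⟩ := Nat.exists_eq_add_of_le hle₅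
      rw [h56, hsum, hw]
      have hdi : d ≤ d * i := Nat.le_mul_of_pos_right d hi1
      have e1 : (100 * d + 400) * (spread d s₅ + w + i + s.nreg 6) =
        (100 * d + 400) * (spread d s₅ + s.nreg 6) + 100 * (d * w) + 400 * w + 100 * (d * i)
          + 400 * i := by ring
      rw [e1]
      simp at hc₃' hc₅ ⊢
      omega
  · simp only [Test.Holds, RExp.eval, Rat.cast_zero, not_lt] at hzero
    have hz : s₁.rreg 2 = 0 := le_antisymm hzero hbox.nonneg
    simp only [finishLeaf, run_seq, run_writeR, run_setN, NExp.eval, RExp.eval, h15]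
    set s₂ : State := ⟨Function.update s₁.nreg 6 0, s₁.rreg, s₁.narr, _, s₁.out⟩ with hs₂
    have n2 : ∀ a, a ≠ 6 → a ≠ 7 → s₂.nreg a = s.nreg a := fun a ha ha' =>
      (Function.update_of_ne ha _ _).trans (fn₁ a ha')
    have na2 : ∀ a, a ≠ 5 → s₂.narr a = s.narr a := fun a ha => fna₁ a ha
    have h26 : s₂.nreg 6 = 0 := by simp [hs₂]
    have h21 : s₂.nreg 1 = J := n2 1 (by norm_num) (by norm_num)
    have h25 : s₂.narr 5 = Function.update (s.narr 5) cur r := hrep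
    have x2 : s₂.rarr = Function.update s₁.rarr (d + 2) (Function.update (s₁.rarr (d + 2)) cur
        (s₁.rarr d (s₁.narr 5 cur))) := rfl
    have hrarr : ∀ a u, u ≠ cur → s₂.rarr a u = s.rarr a u := by
      intro a u hu
      rw [x2]
      rcases eq_or_ne a (d + 2) with rfl | hne
      · rw [Function.update_self, Function.update_of_ne hu, hother _ _ hu]
      · rw [Function.update_of_ne hne, hother _ _ hu]
    have e1 : s₂.rarr (d + 1) cur = 0 := by
      rw [x2, Function.update_of_ne (by omega), hel, hz]
    have hcong : ∀ u A, u ≠ cur → NodeData d x s u A → NodeData d x s₂ u A := fun u A hu h =>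
      h.congr (by rw [h25, Function.update_of_ne hu]) fun a _ => hrarr a u hu
    refine hR _ _ ⟨⟨⟨S, P, kap, mid, ?_⟩, ?_, ?_, ?_, ?_, ?_, ?_, ?_, ?_, ?_⟩, ?_⟩
    · rw [h21]
      have hPne : ∀ j < J, P j ≠ cur := fun j hj => hcur ▸ hcore.disj j hj q (by omega)
      refine ⟨?_, h21, ?_, ?_, ?_, hcore.root, ?_, ?_, ?_, ?_, ?_, ?_, ?_, ?_, ?_, ?_⟩
      · rw [n2 0 (by norm_num) (by norm_num), hcore.r0]
      · rw [n2 2 (by norm_num) (by norm_num), hcore.r2]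
      · intro k hk
        rw [x2, Function.update_of_ne (by omega), hcoord k hk]
      · obtain ⟨t1, t2, t3, t4, t5, t6⟩ := hcore.tree
        refine ⟨t1, t2, t3, t4, t5, fun j hj => ?_⟩
        rw [hrarr _ _ (hPne j hj)]
        exact t6 j hj
      · rw [na2 0 (by norm_num)]; exact hcore.lab_le
      · rw [na2 0 (by norm_num), na2 3 (by norm_num)]; exact hcore.front
      · rw [na2 3 (by norm_num)]; exact hcore.ne
      · rw [na2 3 (by norm_num)]; exact hcore.front_le
      · rw [na2 3 (by norm_num)]; exact hcore.nodes
      · rw [na2 3 (by norm_num)]; exact hcore.disj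
      · rw [na2 4 (by norm_num), na2 6 (by norm_num), na2 7 (by norm_num)]; exact hcore.child
      · exact fun j hj => hcong _ _ (hPne j hj) (hcore.dataP j hj)
      · intro l hl hl'
        have hne : s.narr 3 l ≠ cur := fun he => by
          have := hcore.front_inj (l := l) (l' := q) (by omega) (by omega) (he.trans hcur)
          omega
        rw [na2 3 (by norm_num), hrarr _ _ hne]
        exact ⟨hcong _ _ hne (hcore.dataL l hl hl').1, (hcore.dataL l hl hl').2⟩
      · rw [na2 1 (by norm_num), na2 2 (by norm_num)]; exact hcore.start
    · omega
    · rw [n2 5 (by norm_num) (by norm_num), na2 3 (by norm_num), ← hcur]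
    · intro k
      rw [na2 _ (by omega), harr]
    · rw [na2 0 (by norm_num)]; exact hlab
    · rw [na2 1 (by norm_num), na2 2 (by norm_num)]; exact hold
    · rw [na2 0 (by norm_num), na2 2 (by norm_num), h21]; exact hsize
    · intro l hl hl' k hk
      rw [na2 _ (by omega), na2 1 (by norm_num)]
      exact hfill l hl (by omega) k hk
    · intro h
      omega
    · intro _
      rw [na2 3 (by norm_num), na2 0 (by norm_num), ← hcur]
      refine ⟨⟨by rw [h25, Function.update_self]; exact hr, ?_, ?_, ?_⟩, e1⟩
      · rw [e1, ← hz]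
        convert hbox using 2 with k
        rw [x2, Function.update_of_ne (by omega)]
      · intro h
        rw [e1] at h
        exact absurd h (lt_irrefl _)
      · intro _
        rw [x2, Function.update_self, Function.update_self, hcoord d le_rfl]
    · have hsp : spread d s₂ = spread d s := by
        simp only [spread, na2 8 (by norm_num), na2 9 (by norm_num)]
      rw [hsp, h26, Nat.mul_add _ _ (s.nreg 6)]
      have := Nat.le_mul_of_pos_right (100 * d + 400) hgo
      simp
      omega
end RealRAM

/-! ### Distributing the relabelled elements to sorted lists -/

namespace RealRAM

/-- Append the elements at the positions `st, …, en - 1` (registers `3`, `4`) with a label beyond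
register `2` to the segments of their new lists, in dimension `k`. -/
def distribute (k : ℕ) : Cmd :=
  .seq (.setN 11 (.reg 3)) <|
  .loop (.nlt (.reg 11) (.reg 4)) <|
    .seq (.setN 12 (.read (2 * k + 20) (.reg 11))) <|
    .seq (.setN 13 (.read 0 (.reg 12))) <|
    .seq (.ite (.nlt (.reg 2) (.reg 13))
      (.seq (.writeN (2 * k + 20) (.read (2 * k + 21) (.reg 13)) (.reg 12)) <|
        .writeN (2 * k + 21) (.reg 13) (.add (.read (2 * k + 21) (.reg 13)) (.const 1)))
      .skip) <|
    .setN 11 (.add (.reg 11) (.const 1))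

/-- After the positions before `y` have been read, every new list holds those of its elements that
occurred among them. Writing takes place at positions from `base` on, so the segment that is being
read, which lies below `base`, stays intact. -/
structure DistInv (key : ℕ → ℝ) (lab A₀ start : ℕ → ℕ) (J₀ J st base y : ℕ) (A fill : ℕ → ℕ) :
    Prop where
  ptr : ∀ l, J₀ < l → l ≤ J →
    fill l = start l + (((Finset.Ico st y).image A₀).filter (lab · = l)).card
  seg : ∀ l, J₀ < l → l ≤ J →
    Seg key A (start l) (fill l) (((Finset.Ico st y).image A₀).filter (lab · = l))
  other : ∀ p < base, A p = A₀ p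

/-- Appending in the order of the old list keeps each new list sorted, so nothing is sorted again.
The sizes are known from the splits, and they keep the target segments disjoint. -/
theorem distribute_spec {k n J₀ J q st en base : ℕ} {s : State} {start size : ℕ → ℕ}
    (h2 : s.nreg 2 = q) (h3 : s.nreg 3 = st) (h4 : s.nreg 4 = en) (hqJ : q ≤ J₀)
    (hbase : en ≤ base) (hst : ∀ l, J₀ < l → l ≤ J → base ≤ start l)
    (hst' : ∀ l l', J₀ < l → l < l' → l' ≤ J → start l + size l ≤ start l')
    (hfill : ∀ l, J₀ < l → l ≤ J → s.narr (2 * k + 21) l = start l)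
    (hsize : ∀ l, J₀ < l → l ≤ J → size l = (labelled n (s.narr 0) l).card)
    (hA : ∀ p, st ≤ p → p < en → s.narr (2 * k + 20) p < n ∧
      (s.narr 0 (s.narr (2 * k + 20) p) = q ∨ J₀ < s.narr 0 (s.narr (2 * k + 20) p) ∧
        s.narr 0 (s.narr (2 * k + 20) p) ≤ J))
    (hinj : ∀ p p', st ≤ p → p < p' → p' < en →
      s.narr (2 * k + 20) p ≠ s.narr (2 * k + 20) p')
    (hsorted : ∀ p p', st ≤ p → p ≤ p' → p' < en →
      s.rarr k (s.narr (2 * k + 20) p) ≤ s.rarr k (s.narr (2 * k + 20) p'))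
    (hsurj : ∀ e < n, J₀ < s.narr 0 e → ∃ p, st ≤ p ∧ p < en ∧ s.narr (2 * k + 20) p = e) :
    Run (distribute k) s fun s' c =>
      ((∀ l, J₀ < l → l ≤ J → Seg (s.rarr k) (s'.narr (2 * k + 20)) (start l) (start l + size l)
          {e | e < n ∧ s.narr 0 e = l}) ∧
        (∀ p < base, s'.narr (2 * k + 20) p = s.narr (2 * k + 20) p) ∧
        c ≤ 40 * (en - st) + 10) ∧ Frame (distribute k) s s' := by
  refine Run.frame (Run.of_forall fun R hR => ?_)
  rw [distribute, run_seq, run_setN]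
  have hlt' : ∀ y, y ≤ en → ∀ l, J₀ < l → l ≤ J →
      ((Finset.Ico st y).image (s.narr (2 * k + 20))).filter (s.narr 0 · = l) ⊆
        labelled n (s.narr 0) l := by
    intro y hy l hl hl' e he
    simp only [Finset.mem_filter, Finset.mem_image, Finset.mem_Ico] at he
    obtain ⟨⟨p, ⟨h1, h2⟩, rfl⟩, h3⟩ := he
    rw [mem_labelled]
    exact ⟨(hA p h1 (by omega)).1, h3⟩
  -- The alternative `= st` covers `en < st`, when no position is read.
  refine (Run.loop (fun s' => (st ≤ s'.nreg 11 ∧ (s'.nreg 11 ≤ en ∨ s'.nreg 11 = st)) ∧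
    DistInv (s.rarr k) (s.narr 0) (s.narr (2 * k + 20)) start J₀ J st base
      (s'.nreg 11) (s'.narr (2 * k + 20)) (s'.narr (2 * k + 21)))
    (fun s' => 40 * (en - s'.nreg 11)) ?_ ?_).mono ?_
  · refine ⟨by simp [h3], ?_, ?_, ?_⟩
    · intro l hl hl'
      simp [h3, hfill l hl hl']
    · intro l hl hl'
      simp only [NExp.eval, h3, Function.update_self, hfill l hl hl']
      convert Seg.empty _ _ _
      simp
    · exact fun _ _ => rfl
  · rintro s₁ hF ⟨⟨hy, -⟩, i1, i2, i3⟩ hb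
    refine Run.of_forall fun R hR => ?_
    have e2 : s₁.nreg 2 = q := by rw [hF.n 2 (by simp)]; simpa using h2
    have e4 : s₁.nreg 4 = en := by rw [hF.n 4 (by simp)]; simpa using h4
    have e0 : s₁.narr 0 = s.narr 0 := by rw [hF.na 0 (by simp)]
    simp only [Test.Holds, NExp.eval, e4] at hb
    set y := s₁.nreg 11 with hy'
    have hAy : s₁.narr (2 * k + 20) y = s.narr (2 * k + 20) y := i3 y (by omega)
    set e := s.narr (2 * k + 20) y with he
    have hIco : Finset.Ico st (y + 1) = insert y (Finset.Ico st y) := by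
      ext p
      simp only [Finset.mem_Ico, Finset.mem_insert]
      omega
    have hne21 : 2 * k + 21 ≠ 2 * k + 20 := by omega
    have hne20 : 2 * k + 20 ≠ 2 * k + 21 := by omega
    have hAe := hA y hy hb
    rw [← he] at hAe
    simp only [run_seq, run_ite, run_setN, run_writeN, run_skip, Test.Holds, NExp.eval]
    simp [← hy', hAy, e0, e2, hne21, hne20]
    refine ⟨fun hlt => hR _ _ ⟨⟨⟨by simp; omega, by simp; omega⟩, ?_⟩, ?_⟩,
      fun hge => hR _ _ ⟨⟨⟨by simp; omega, by simp; omega⟩, ?_⟩, ?_⟩⟩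
    · have hl₁ : J₀ < s.narr 0 e ∧ s.narr 0 e ≤ J := by omega
      set l₁ := s.narr 0 e with hl₁'
      have hnot : e ∉ (Finset.Ico st y).image (s.narr (2 * k + 20)) := by
        simp only [Finset.mem_image, Finset.mem_Ico, not_exists, not_and]
        rintro p ⟨g1, g2⟩ h
        exact hinj p y g1 g2 hb h
      -- The element at `y` is new by injectivity, so its list is not yet full and the write stays
      -- inside the segment of that list.
      have hcard : (((Finset.Ico st y).image (s.narr (2 * k + 20))).filter
          (s.narr 0 · = l₁)).card + 1 ≤ size l₁ := by
        rw [hsize l₁ hl₁.1 hl₁.2, ← Finset.card_insert_of_notMem (a := e)]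
        · refine Finset.card_le_card (Finset.insert_subset ?_ (hlt' y hb.le l₁ hl₁.1 hl₁.2))
          rw [mem_labelled]
          exact ⟨hAe.1, rfl⟩
        · simp [hnot]
      have hfl := i1 l₁ hl₁.1 hl₁.2
      refine ⟨?_, ?_, ?_⟩
      · intro l hl hl'
        simp only [Function.update_self, hIco, Finset.image_insert, Finset.filter_insert, ← he,
          ← hl₁']
        rcases eq_or_ne l l₁ with rfl | hne
        · rw [Function.update_self, if_pos rfl, Finset.card_insert_of_notMem (by simp [hnot]), hfl]
          rfl
        · rw [Function.update_of_ne hne, if_neg hne.symm]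
          exact i1 l hl hl'
      · intro l hl hl'
        simp only [Function.update_self, hIco, Finset.image_insert, Finset.filter_insert, ← he,
          ← hl₁', Function.update_of_ne hne20]
        rcases eq_or_ne l l₁ with rfl | hne
        · rw [Function.update_self, if_pos rfl, Finset.coe_insert]
          refine (i2 _ hl hl').push (by omega) fun e' he' => ?_
          simp only [Finset.coe_filter, Finset.mem_image, Finset.mem_Ico, Set.mem_ofPred_eq] at he'
          obtain ⟨⟨p, ⟨g1, g2⟩, rfl⟩, -⟩ := he'
          exact hsorted p y g1 g2.le hb
        · rw [Function.update_of_ne hne, if_neg hne.symm]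
          refine (i2 l hl hl').congr fun p g1 g2 => Function.update_of_ne ?_ _ _
          have hfl' := i1 l hl hl'
          have hcard' := Finset.card_le_card (hlt' y hb.le l hl hl')
          rw [← hsize l hl hl'] at hcard'
          rcases lt_or_gt_of_ne hne with h | h
          · have := hst' l l₁ hl h hl₁.2
            omega
          · have := hst' l₁ l hl₁.1 h hl'
            omega
      · intro p hp
        simp only [Function.update_self, Function.update_of_ne hne20]
        have := hst l₁ hl₁.1 hl₁.2
        rw [Function.update_of_ne (by omega)]
        exact i3 p hp
    · simp
      omega
    · have hl₁ : s.narr 0 e = q := by omega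
      refine ⟨?_, ?_, i3⟩
      · intro l hl hl'
        simp only [Function.update_self, hIco, Finset.image_insert, Finset.filter_insert, ← he]
        rw [if_neg (by omega)]
        exact i1 l hl hl'
      · intro l hl hl'
        simp only [Function.update_self, hIco, Finset.image_insert, Finset.filter_insert, ← he]
        rw [if_neg (by omega)]
        exact i2 l hl hl'
    · simp
      omega
  · rintro s₁ c ⟨⟨⟨⟨hy, hy'⟩, i1, i2, i3⟩, hb, hc⟩, hF⟩
    have e4 : s₁.nreg 4 = en := by rw [hF.n 4 (by simp)]; simpa using h4
    simp only [Test.Holds, NExp.eval, e4] at hb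
    refine hR _ _ ⟨fun l hl hl' => ?_, i3, ?_⟩
    · have hD : ((Finset.Ico st (s₁.nreg 11)).image (s.narr (2 * k + 20))).filter
          (s.narr 0 · = l) = labelled n (s.narr 0) l := by
        rcases hy' with hy' | hy'
        · refine Finset.Subset.antisymm (hlt' _ hy' l hl hl') fun e he => ?_
          rw [mem_labelled] at he
          obtain ⟨p, g1, g2, g3⟩ := hsurj e he.1 (by omega)
          simp only [Finset.mem_filter, Finset.mem_image, Finset.mem_Ico]
          exact ⟨⟨p, ⟨g1, by omega⟩, g3⟩, he.2⟩
        · symm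
          rw [hy', Finset.Ico_self, Finset.image_empty, Finset.filter_empty]
          rw [Finset.eq_empty_iff_forall_notMem]
          intro e he
          rw [mem_labelled] at he
          obtain ⟨p, g1, g2, g3⟩ := hsurj e he.1 (by omega)
          omega
      have h1 := i1 l hl hl'
      have h2 := i2 l hl hl'
      rw [hD, ← hsize l hl hl'] at h1
      rw [hD, h1] at h2
      convert h2 using 1
      ext e
      simp
    · simp [h3] at hc ⊢
      omega
end RealRAM

namespace RealRAM

/-- Sorted segments are only known to contain all elements; if the number of positions is the number
of elements, no element can occur twice. -/
theorem Seg.ne {key : ℕ → ℝ} {A : ℕ → ℕ} {st en : ℕ} {L : Finset ℕ}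
    (h : Seg key A st en L) (hc : en = st + L.card) {p p' : ℕ} (h₁ : st ≤ p) (h₂ : p < p')
    (h₃ : p' < en) : A p ≠ A p' := by
  intro he
  have hinj : Set.InjOn A (Finset.Ico st en : Finset ℕ) := by
    refine Finset.injOn_of_surjOn_of_card_le (t := L) A ?_ ?_ ?_
    · intro q hq
      simp only [Finset.coe_Ico, Set.mem_Ico] at hq
      exact h.mem q hq.1 hq.2
    · intro e he
      obtain ⟨q, g₁, g₂, g₃⟩ := h.surj e he
      exact ⟨q, by simp [g₁, g₂], g₃⟩
    · simp [hc]
  have := hinj (x₁ := p) (x₂ := p') (by simp; omega) (by simp; omega) he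
  omega

/-- The segments are laid out one after the other in the order of their labels; the space of
finished lists is not used again. -/
theorem Core.start_le {d n : ℕ} {x : ℕ → ℕ → ℝ} {q J : ℕ} {s : State} {S : ℕ → Finset ℕ}
    {P kap : ℕ → ℕ} {mid : ℕ → ℝ} (h : Core d n x q J s S P kap mid) {l l' : ℕ} (hl : l < l')
    (hl' : l' ≤ J) : s.narr 1 l + s.narr 2 l ≤ s.narr 1 l' := by
  induction l' with
  | zero => omega
  | succ l' ih =>
    have := h.start l' (by omega)
    rcases Nat.lt_succ_iff_lt_or_eq.1 hl with hlt | rfl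
    · have := ih hlt (by omega)
      omega
    · omega

/-- The lists `q, …, J` are stored as sorted segments. -/
structure Outer (d n : ℕ) (x : ℕ → ℕ → ℝ) (q : ℕ) (s : State) : Prop where
  core : ∃ S P kap mid, Core d n x q (s.nreg 1) s S P kap mid
  q_le : q ≤ s.nreg 1 + 1
  size : ∀ l, q ≤ l → l ≤ s.nreg 1 → s.narr 2 l = (labelled n (s.narr 0) l).card
  seg : ∀ l, q ≤ l → l ≤ s.nreg 1 → ∀ k < d, Seg (x k) (s.narr (2 * k + 20)) (s.narr 1 l)
    (s.narr 1 l + s.narr 2 l) {e | e < n ∧ s.narr 0 e = l}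

/-- Credit for a list with `m` elements. -/
def credit (m : ℕ) : ℕ := m * (Nat.log 2 m + 1)

/-- A list of size `f l ≤ m / 2` has `log (f l) + 1 ≤ log m`, so the new lists need at most `m * log
m` in total. One unit per element of the old list is set free. -/
theorem sum_credit_le {ι : Type*} (T : Finset ι) (f : ι → ℕ) {m : ℕ}
    (h : ∀ l ∈ T, 2 * f l ≤ m) (hs : ∑ l ∈ T, f l ≤ m) :
    ∑ l ∈ T, credit (f l) + m ≤ credit m := by
  have : ∑ l ∈ T, credit (f l) ≤ ∑ l ∈ T, f l * Nat.log 2 m := by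
    refine Finset.sum_le_sum fun l hl => ?_
    rcases Nat.eq_zero_or_pos (f l) with h0 | h0
    · simp [credit, h0]
    · refine Nat.mul_le_mul_left _ ?_
      rw [← Nat.log_mul_base (by norm_num) h0.ne', mul_comm]
      exact Nat.log_mono_right (h l hl)
  rw [← Finset.sum_mul] at this
  have h2 := Nat.mul_le_mul_right (Nat.log 2 m) hs
  rw [credit, Nat.mul_add, mul_one]
  omega

def heavyLoop (d : ℕ) : Cmd := .loop (.nlt (.const 0) (.reg 6)) (heavyStep d)

/-- Set the windows to the segment of the list in register `2`. -/
def openList (d : ℕ) : Cmd :=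
  .seq (.setN 3 (.read 1 (.reg 2))) <|
  .seq (.setN 4 (.add (.reg 3) (.read 2 (.reg 2)))) <|
  .seq (.setN 5 (.read 3 (.reg 2))) <|
  .seq (.setN 6 (.const 1)) <|
  forK d fun k => .seq (.writeN 8 (.const k) (.reg 3))
    (.writeN 9 (.const k) (.sub (.reg 4) (.const 1)))

def processList (d : ℕ) : Cmd :=
  .seq (openList d) <| .seq (heavyLoop d) <| .seq (forK d distribute) <|
    .setN 2 (.add (.reg 2) (.const 1))

/-- At the start the windows are the whole segment of the list, in which every element still has the
label `q`; nonemptiness makes the last position well defined. -/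
theorem openList_spec {d n : ℕ} {x : ℕ → ℕ → ℝ} {q : ℕ} {s : State} (h : Outer d n x q s)
    (hq : q ≤ s.nreg 1) :
    Run (openList d) s fun s' c => Outer d n x q s' ∧
      s'.nreg 1 = s.nreg 1 ∧ (∀ a < 3, s'.narr a = s.narr a) ∧
      s'.nreg 3 = s'.narr 1 q ∧ s'.nreg 4 = s'.narr 1 q + s'.narr 2 q ∧ s'.nreg 6 = 1 ∧
      Inner d n x q (s'.nreg 1) (s'.nreg 3) (s'.nreg 4) s' s' ∧
      spread d s' + d = d * s'.narr 2 q ∧ c ≤ 20 * d + 40 := by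
  obtain ⟨⟨S, P, kap, mid, hcore⟩, hql, hsize, hseg⟩ := id h
  refine Run.of_forall fun R hR => ?_
  simp only [openList, run_seq, run_setN, NExp.eval, hcore.r2]
  set s₁ : State := ⟨_, s.rreg, s.narr, s.rarr, s.out⟩ with hs₁
  have n1 : ∀ a < 3, s₁.nreg a = s.nreg a := fun a ha => by
    simp [hs₁, show a ≠ 6 by omega, show a ≠ 5 by omega, show a ≠ 4 by omega,
      show a ≠ 3 by omega]
  have h13 : s₁.nreg 3 = s.narr 1 q := by simp [hs₁, hcore.r2]
  have h14 : s₁.nreg 4 = s.narr 1 q + s.narr 2 q := by simp [hs₁, hcore.r2]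
  have h15 : s₁.nreg 5 = s.narr 3 q := by simp [hs₁, hcore.r2]
  have h16 : s₁.nreg 6 = 1 := by simp [hs₁]
  refine (Run.forK (fun j s' => ∀ k < j, s'.narr 8 k = s.narr 1 q ∧
    s'.narr 9 k = s.narr 1 q + s.narr 2 q - 1) (fun _ => 0) 20 (by simp) ?_).mono ?_
  · intro k s' hk hF hI
    have e3 : s'.nreg 3 = s.narr 1 q := by rw [hF.n 3 (by simp), h13]
    have e4 : s'.nreg 4 = s.narr 1 q + s.narr 2 q := by rw [hF.n 4 (by simp), h14]
    simp [e3, e4]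
    intro k' hk'
    rcases eq_or_ne k' k with rfl | hne
    · simp
    · simpa [hne] using hI k' (by omega)
  · rintro s' c ⟨⟨hI, hc⟩, hF⟩
    have fn : s'.nreg = s₁.nreg := funext fun a => hF.n a (by simp)
    have fra : s'.rarr = s.rarr := funext fun a => hF.ra a (by simp)
    have fna : ∀ a, a ≠ 8 → a ≠ 9 → s'.narr a = s.narr a := fun a h8 h9 =>
      hF.na a (by simp [h8, h9])
    have hcore' : Core d n x q (s.nreg 1) s' S P kap mid := hcore.congr
      (fun a ha => by rw [fn, n1 a ha]) fra fun a ha => fna a (by omega) (by omega)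
    have hpos : 0 < s.narr 2 q := by
      rw [hsize q le_rfl hq, Finset.card_pos, ← hcore.front q hq]
      exact hcore.ne q hq
    refine hR _ _ ⟨⟨⟨S, P, kap, mid, ?_⟩, ?_, ?_, ?_⟩, ?_, ?_, ?_, ?_, ?_,
      ⟨⟨S, P, kap, mid, ?_⟩, le_rfl, ?_, ?_, ?_, ?_, ?_, ?_, ?_, ?_⟩, ?_, ?_⟩
    · rw [fn, n1 1 (by norm_num)]; exact hcore'
    · rw [fn, n1 1 (by norm_num)]; exact hql
    · rw [fn, n1 1 (by norm_num), fna 0 (by norm_num) (by norm_num),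
        fna 2 (by norm_num) (by norm_num)]; exact hsize
    · rw [fn, n1 1 (by norm_num), fna 0 (by norm_num) (by norm_num),
        fna 2 (by norm_num) (by norm_num), fna 1 (by norm_num) (by norm_num)]
      intro l hl hl' k hk
      rw [fna _ (by omega) (by omega)]
      exact hseg l hl hl' k hk
    · rw [fn, n1 1 (by norm_num)]
    · exact fun a ha => fna a (by omega) (by omega)
    · rw [fn, h13, fna 1 (by norm_num) (by norm_num)]
    · rw [fn, h14, fna 1 (by norm_num) (by norm_num), fna 2 (by norm_num) (by norm_num)]
    · rw [fn, h16]
    · rw [fn, n1 1 (by norm_num)]; exact hcore'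
    · rw [fn, h15, fna 3 (by norm_num) (by norm_num)]
    · exact fun _ => rfl
    · exact fun _ _ => .inl rfl
    · exact fun _ _ => ⟨rfl, rfl⟩
    · intro l h1 h2; omega
    · intro l h1 h2; omega
    · intro _ k hk
      obtain ⟨g1, g2⟩ := hI k hk
      rw [g1, g2, fn, h13, h14, fna 0 (by norm_num) (by norm_num), fna _ (by omega) (by omega)]
      have hs := hseg q le_rfl hq k hk
      have hmem : ∀ p, s.narr 1 q ≤ p → p < s.narr 1 q + s.narr 2 q →
          s.narr (2 * k + 20) p ∈ labelled n (s.narr 0) q := fun p hp hp' => by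
        simpa using hs.mem p hp hp'
      refine ⟨⟨⟨fun e he => ?_, fun p p' a1 a2 a3 => hs.sorted p p' a1 a2 (by omega)⟩, by omega,
        hmem _ le_rfl (by omega), hmem _ (by omega) (by omega)⟩, le_rfl, by omega⟩
      obtain ⟨p, a1, a2, a3⟩ := hs.surj e (by simpa using he)
      exact ⟨p, a1, by omega, a3⟩
    · intro h
      rw [fn, h16] at h
      omega
    · rw [spread, Finset.sum_congr rfl (g := fun _ => s.narr 2 q - 1), Finset.sum_const,
        Finset.card_range, fna 2 (by norm_num) (by norm_num), smul_eq_mul, ← Nat.mul_succ]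
      · congr 1; omega
      · intro k hk
        obtain ⟨g1, g2⟩ := hI k (Finset.mem_range.1 hk)
        omega
    · simp
      omega
end RealRAM

/-! ### Amortised cost of the whole tree -/

namespace RealRAM

/-- Credit of the unfinished lists. -/
def credits (q : ℕ) (s : State) : ℕ := ∑ l ∈ Finset.Ico q (s.nreg 1 + 1), credit (s.narr 2 l)

theorem heavyLoop_spec {d n : ℕ} (hd : 0 < d) {x : ℕ → ℕ → ℝ} {q J₀ st en : ℕ} {s₀ s : State}
    (hq : q ≤ J₀)
    (hseg : ∀ k < d, ∀ p, st ≤ p → p < en → s₀.narr (2 * k + 20) p < n ∧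
      s₀.narr 0 (s₀.narr (2 * k + 20) p) = q)
    (hI : Inner d n x q J₀ st en s₀ s) :
    Run (heavyLoop d) s fun s' c => (Inner d n x q J₀ st en s₀ s' ∧ s'.nreg 6 = 0 ∧
      c ≤ (100 * d + 400) * (spread d s + s.nreg 6) + 4) ∧ Frame (heavyLoop d) s s' := by
  refine (Run.loop (Inner d n x q J₀ st en s₀)
    (fun s => (100 * d + 400) * (spread d s + s.nreg 6)) hI ?_).mono ?_
  · intro s' _ hI hb
    refine (heavyStep_spec hd hq hseg hI (by simpa using hb)).mono ?_
    rintro s'' c ⟨h1, h2⟩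
    exact ⟨h1, by simpa using h2⟩
  · rintro s' c ⟨⟨h1, h2, h3⟩, hF⟩
    simp at h2 h3
    exact ⟨⟨h1, h2, by omega⟩, hF⟩

theorem heavyLoop_frame {d : ℕ} {s s' : State} (h : Frame (heavyLoop d) s s') :
    s'.nreg 3 = s.nreg 3 ∧ s'.nreg 4 = s.nreg 4 := by
  constructor <;>
  · refine h.n _ ?_
    simp [heavyLoop, heavyStep, computeBox, boxDim, splitNode, finishLeaf, splitDim, scanLoop,
      labelLoop, trim, skipLoops]

theorem forK_distribute_frame {d : ℕ} {s s' : State} (h : Frame (forK d distribute) s s') :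
    (∀ a < 11, s'.nreg a = s.nreg a) ∧ (∀ a < 20, s'.narr a = s.narr a) ∧ s'.rarr = s.rarr := by
  refine ⟨fun a ha => h.n a ?_, fun a ha => h.na a ?_, funext fun a => h.ra a ?_⟩ <;>
    simp [distribute] <;> omega

/-- Segments of older lists end at `s₀.narr 1 J₀ + s₀.narr 2 J₀`, which is where the new ones start.
Hence they survive, and so does the segment of `q` that is read. -/
theorem distributeAll_spec {d n : ℕ} {x : ℕ → ℕ → ℝ} {q J₀ : ℕ} {s₀ s : State}
    (hO : Outer d n x q s₀) (hJ₀ : s₀.nreg 1 = J₀) (hq : q ≤ J₀)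
    (h3 : s₀.nreg 3 = s₀.narr 1 q) (h4 : s₀.nreg 4 = s₀.narr 1 q + s₀.narr 2 q)
    (h3' : s.nreg 3 = s₀.nreg 3) (h4' : s.nreg 4 = s₀.nreg 4)
    (hI : Inner d n x q J₀ (s₀.nreg 3) (s₀.nreg 4) s₀ s) :
    Run (forK d distribute) s fun s' c => ((∀ k < d,
      (∀ l, J₀ < l → l ≤ s.nreg 1 → Seg (x k) (s'.narr (2 * k + 20)) (s.narr 1 l)
        (s.narr 1 l + s.narr 2 l) {e | e < n ∧ s.narr 0 e = l}) ∧
      ∀ p < s₀.narr 1 J₀ + s₀.narr 2 J₀, s'.narr (2 * k + 20) p = s₀.narr (2 * k + 20) p) ∧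
      c ≤ d * (40 * s₀.narr 2 q + 10) + 1) ∧ Frame (forK d distribute) s s' := by
  obtain ⟨⟨S₀, P₀, kap₀, mid₀, hcore₀⟩, -, hsize₀, hseg₀⟩ := hO
  rw [hJ₀] at hcore₀ hsize₀ hseg₀
  obtain ⟨⟨S, P, kap, mid, hcore⟩, hle, -, harr, hlab, hold, hsize, hfill, -, -⟩ := hI
  set J := s.nreg 1 with hJ
  refine (Run.forK (fun j s' => (∀ k < j,
      (∀ l, J₀ < l → l ≤ J → Seg (x k) (s'.narr (2 * k + 20)) (s.narr 1 l)
        (s.narr 1 l + s.narr 2 l) {e | e < n ∧ s.narr 0 e = l}) ∧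
      ∀ p < s₀.narr 1 J₀ + s₀.narr 2 J₀, s'.narr (2 * k + 20) p = s₀.narr (2 * k + 20) p) ∧
      ∀ k, j ≤ k → s'.narr (2 * k + 20) = s₀.narr (2 * k + 20) ∧
        s'.narr (2 * k + 21) = s.narr (2 * k + 21)) (fun _ => 0)
    (40 * s₀.narr 2 q + 10) ?_ ?_).mono ?_
  · exact ⟨by simp, fun k _ => ⟨harr k, rfl⟩⟩
  · rintro k s₁ hk hF ⟨i1, i2⟩
    obtain ⟨fn, fna, fra⟩ := forK_distribute_frame hF
    obtain ⟨eA, eF⟩ := i2 k le_rfl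
    have hsegq := hseg₀ q le_rfl hq k hk
    have hlab' : ∀ e < n, s.narr 0 e ≤ J := hcore.lab_le
    have hJ₀e := hold J₀ le_rfl
    have hs₀ := hcore₀.lab_le
    have hqend : s₀.narr 1 q + s₀.narr 2 q ≤ s₀.narr 1 J₀ + s₀.narr 2 J₀ := by
      rcases Nat.lt_or_eq_of_le hq with h | rfl
      · have := hcore₀.start_le h le_rfl
        omega
      · exact le_rfl
    refine (distribute_spec (n := n) (J₀ := J₀) (J := J) (q := q) (st := s₀.narr 1 q)
      (en := s₀.narr 1 q + s₀.narr 2 q) (base := s₀.narr 1 J₀ + s₀.narr 2 J₀)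
      (start := s.narr 1) (size := s.narr 2) ?_ ?_ ?_ hq hqend ?_ ?_ ?_ ?_ ?_ ?_ ?_ ?_).mono ?_
    · rw [fn 2 (by norm_num), hcore.r2]
    · rw [fn 3 (by norm_num), h3', h3]
    · rw [fn 4 (by norm_num), h4', h4]
    · intro l hl hl'
      rw [← hJ₀e.1, ← hJ₀e.2]
      exact hcore.start_le hl hl'
    · intro l l' _ h1 h2
      exact hcore.start_le h1 h2
    · intro l hl hl'
      rw [eF]
      exact hfill l hl hl' k hk
    · intro l hl hl'
      rw [fna 0 (by norm_num)]
      exact (hsize l hl hl').1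
    · intro p g1 g2
      rw [eA, fna 0 (by norm_num)]
      obtain ⟨g3, g4⟩ := hsegq.mem p g1 g2
      have a1 := hlab _ g3
      have a2 := hlab' _ g3
      exact ⟨g3, by omega⟩
    · intro p p' g1 g2 g3
      rw [eA]
      refine Seg.ne (key := x k) (L := labelled n (s₀.narr 0) q) ?_ (by rw [← hsize₀ q le_rfl hq]) g1 g2 g3
      convert hsegq using 1
      ext e
      simp
    · intro p p' g1 g2 g3
      rw [eA, fra, hcore.coord k hk.le]
      exact hsegq.sorted p p' g1 g2 g3
    · intro e he hlt
      rw [fna 0 (by norm_num)] at hlt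
      rw [eA]
      refine hsegq.surj e ⟨he, ?_⟩
      have := hlab e he
      have := hs₀ e he
      omega
    · rintro s₂ c ⟨⟨g1, g2, g3⟩, hF₂⟩
      refine ⟨⟨fun k' hk' => ?_, fun k' hk' => ?_⟩, by omega⟩
      · rcases Nat.lt_succ_iff_lt_or_eq.1 hk' with hlt | rfl
        · rw [hF₂.na _ (by simp [distribute]; omega)]
          exact i1 k' hlt
        · rw [eA] at g2
          rw [fra, hcore.coord k' hk.le, fna 0 (by norm_num)] at g1
          exact ⟨g1, g2⟩
      · rw [hF₂.na _ (by simp [distribute]; omega), hF₂.na _ (by simp [distribute]; omega)]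
        exact i2 k' (by omega)
  · rintro s' c ⟨⟨⟨h, -⟩, hc⟩, hF⟩
    exact ⟨⟨h, by omega⟩, hF⟩

/-- A list with `m` elements costs `O(d * m)` steps for the heavy path, where each step has overhead
of order `d`, and `O(d * m)` for the distribution. Both are covered by the `m` units of credit that
the passage to the new lists sets free. -/
theorem processList_spec {d n : ℕ} (hd : 0 < d) {x : ℕ → ℕ → ℝ} {q : ℕ} {s : State}
    (h : Outer d n x q s) (hq : q ≤ s.nreg 1) :
    Run (processList d) s fun s' c => Outer d n x (q + 1) s' ∧
      c + 10 + (100 * (d * d) + 600 * d + 600) * credits (q + 1) s' ≤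
        (100 * (d * d) + 600 * d + 600) * credits q s := by
  refine Run.of_forall fun R hR => ?_
  rw [processList, run_seq]
  refine (openList_spec h hq).mono ?_
  rintro s₀ c₀ ⟨hO, e1, e3, g3, g4, g6, hI₀, hsp, hc₀⟩
  rw [run_seq]
  obtain ⟨⟨S₀, P₀, kap₀, mid₀, hcore₀⟩, hql, hsize₀, hseg₀⟩ := id hO
  set J₀ := s₀.nreg 1 with hJ₀
  have hqJ : q ≤ J₀ := by omega
  refine (heavyLoop_spec hd hqJ (fun k hk p h1 h2 => hseg₀ q le_rfl hqJ k hk |>.mem p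
    (by omega) (by omega)) hI₀).mono ?_
  rintro s₁ c₁ ⟨⟨hI, h16, hc₁⟩, hF₁⟩
  obtain ⟨f3, f4⟩ := heavyLoop_frame hF₁
  rw [run_seq]
  refine (distributeAll_spec hO hJ₀.symm hqJ g3 g4 f3 f4 hI).mono ?_
  rintro s₂ c₂ ⟨⟨hD, hc₂⟩, hF₂⟩
  obtain ⟨fn, fna, fra⟩ := forK_distribute_frame hF₂
  obtain ⟨⟨S, P, kap, mid, hcore⟩, hle, -, harr, hlab, hold, hsize, hfill, -, hdone⟩ := id hI
  set J := s₁.nreg 1 with hJ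
  have h21 : s₂.nreg 1 = J := fn 1 (by norm_num)
  have h22 : s₂.nreg 2 = q := (fn 2 (by norm_num)).trans hcore.r2
  simp only [run_setN, NExp.eval, h22]
  set s₃ : State := ⟨Function.update s₂.nreg 2 (q + 1), s₂.rreg, s₂.narr, s₂.rarr, s₂.out⟩ with hs₃
  have h31 : s₃.nreg 1 = J := by simp [hs₃, h21]
  have e0 : s₃.narr 0 = s₁.narr 0 := fna 0 (by norm_num)
  have e1' : s₃.narr 1 = s₁.narr 1 := fna 1 (by norm_num)
  have e2' : s₃.narr 2 = s₁.narr 2 := fna 2 (by norm_num)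
  have hm : 1 ≤ s₀.narr 2 q := by
    have := hcore₀.ne q hqJ
    rw [hsize₀ q le_rfl hqJ, Nat.one_le_iff_ne_zero, ← Nat.pos_iff_ne_zero, Finset.card_pos,
      ← hcore₀.front q hqJ]
    exact this
  -- Only elements of list `q` change their labels, and their new labels exceed `J₀`.
  have hlabold : ∀ l, l ≤ J₀ → l ≠ q → ∀ e < n, (s₁.narr 0 e = l ↔ s₀.narr 0 e = l) := by
    intro l hl hlq e he
    have := hlab e he
    omega
  refine hR _ _ ⟨⟨⟨S, P, kap, mid, ?_⟩, by omega, ?_, ?_⟩, ?_⟩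
  · have hdn := hdone h16
    have hcong : ∀ u A, NodeData d x s₁ u A → NodeData d x s₃ u A := fun u A h =>
      h.congr (congrFun (fna 5 (by norm_num)) u) fun a _ => congrFun (congrFun fra a) u
    rw [h31]
    obtain ⟨h1, h2, h3, h4, h5, h6, h7, h8, h9, h10, h11, h12, h13, h14, h15, h16⟩ := id hcore
    have a3 : s₃.narr 3 = s₁.narr 3 := fna 3 (by norm_num)
    have ar : s₃.rarr = s₁.rarr := fra
    refine ⟨?_, h31, by simp [hs₃], ?_, ?_, h6, ?_, ?_, ?_, ?_, ?_, ?_, ?_, ?_, ?_, ?_⟩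
    · rw [← h1, ← fn 0 (by norm_num)]; simp [hs₃]
    · rw [ar]; exact h4
    · rw [ar]; exact h5
    · rw [e0]; exact h7
    · rw [a3, e0]; exact h8
    · rw [a3]; exact h9
    · rw [a3]; exact h10
    · rw [a3]; exact h11
    · rw [a3]; exact h12
    · have b4 : s₃.narr 4 = s₁.narr 4 := fna 4 (by norm_num)
      have b6 : s₃.narr 6 = s₁.narr 6 := fna 6 (by norm_num)
      have b7 : s₃.narr 7 = s₁.narr 7 := fna 7 (by norm_num)
      rw [b4, b6, b7]
      exact h13
    · exact fun j hj => hcong _ _ (h14 j hj)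
    · intro l hl hl'
      rw [a3, ar]
      rcases Nat.lt_succ_iff_lt_or_eq.1 hl with hlt | rfl
      · exact ⟨hcong _ _ (h15 l hlt hl').1, (h15 l hlt hl').2⟩
      · rw [h8 l hl']
        exact ⟨hcong _ _ hdn.1, hdn.2⟩
    · rw [e1', e2']
      exact h16
  · intro l hl hl'
    rw [h31] at hl'
    rw [e0, e2']
    by_cases hlJ : l ≤ J₀
    · rw [(hold l hlJ).2, hsize₀ l (by omega) hlJ]
      congr 1
      ext e
      simp only [mem_labelled]
      exact and_congr_right fun he => (hlabold l hlJ (by omega) e he).symm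
    · exact (hsize l (by omega) hl').1
  · intro l hl hl' k hk
    rw [h31] at hl'
    rw [e0, e1', e2']
    by_cases hlJ : l ≤ J₀
    · have hend : s₀.narr 1 l + s₀.narr 2 l ≤ s₀.narr 1 J₀ + s₀.narr 2 J₀ := by
        rcases Nat.lt_or_eq_of_le hlJ with h | rfl
        · have := hcore₀.start_le h le_rfl
          omega
        · exact le_rfl
      rw [(hold l hlJ).1, (hold l hlJ).2]
      have hset : {e | e < n ∧ s₁.narr 0 e = l} = {e | e < n ∧ s₀.narr 0 e = l} := by
        ext e
        exact and_congr_right fun he => hlabold l hlJ (by omega) e he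
      rw [hset]
      exact (hseg₀ l (by omega) hlJ k hk).congr fun p _ hp => (hD k hk).2 p (by omega)
    · exact (hD k hk).1 l (by omega) hl'
  · set m := s₀.narr 2 q with hm'
    have hcr : credits q s = credits q s₀ := by
      rw [credits, credits, ← hJ₀, e1, e3 2 (by norm_num)]
    have hcr₀ : credits q s₀ = credit m + ∑ l ∈ Finset.Ico (q + 1) (J₀ + 1), credit (s₀.narr 2 l) := by
      rw [credits, ← hJ₀, Finset.sum_eq_sum_Ico_succ_bot (by omega)]
    have hcr₃ : credits (q + 1) s₃ = ∑ l ∈ Finset.Ico (q + 1) (J₀ + 1), credit (s₀.narr 2 l) +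
        ∑ l ∈ Finset.Ico (J₀ + 1) (J + 1), credit (s₁.narr 2 l) := by
      rw [credits, h31, ← Finset.sum_Ico_consecutive _ (show q + 1 ≤ J₀ + 1 by omega)
        (show J₀ + 1 ≤ J + 1 by omega)]
      congr 1
      · refine Finset.sum_congr rfl fun l hl => ?_
        rw [Finset.mem_Ico] at hl
        rw [e2', (hold l (by omega)).2]
      · rw [e2']
    -- The new lists are disjoint label classes inside the old list `q`.
    have hsum : ∑ l ∈ Finset.Ico (J₀ + 1) (J + 1), s₁.narr 2 l ≤ m := by
      have h1 : ∑ l ∈ Finset.Ico (J₀ + 1) (J + 1), s₁.narr 2 l =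
          ((Finset.Ico (J₀ + 1) (J + 1)).biUnion fun l => labelled n (s₁.narr 0) l).card := by
        rw [Finset.card_biUnion]
        · refine Finset.sum_congr rfl fun l hl => ?_
          rw [Finset.mem_Ico] at hl
          exact (hsize l (by omega) (by omega)).1
        · intro l _ l' _ hne
          rw [Function.onFun, Finset.disjoint_left]
          intro e he he'
          rw [mem_labelled] at he he'
          omega
      rw [h1, hm', hsize₀ q le_rfl hqJ]
      refine Finset.card_le_card fun e he => ?_
      simp only [Finset.mem_biUnion, Finset.mem_Ico, mem_labelled] at he ⊢
      obtain ⟨l, hl, he, hel⟩ := he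
      have := hlab e he
      have := hcore₀.lab_le e he
      exact ⟨he, by omega⟩
    have hcred := sum_credit_le (Finset.Ico (J₀ + 1) (J + 1)) (fun l => s₁.narr 2 l) (m := m)
      (fun l hl => by
        rw [Finset.mem_Ico] at hl
        have := (hsize l (by omega) (by omega)).2
        omega) hsum
    obtain ⟨w, hw⟩ := Nat.exists_eq_add_of_le hcred
    rw [hcr, hcr₀, hcr₃, hw]
    have hspm : spread d s₀ ≤ d * m := by omega
    rw [g6] at hc₁
    have hc₁' : c₁ ≤ (100 * d + 400) * (d * m + 1) + 4 :=
      hc₁.trans (by gcongr)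
    have hdm : d ≤ d * m := Nat.le_mul_of_pos_right d hm
    have hddm : d * d ≤ d * d * m := Nat.le_mul_of_pos_right _ hm
    set Y := ∑ l ∈ Finset.Ico (J₀ + 1) (J + 1), credit (s₁.narr 2 l)
    set X := ∑ l ∈ Finset.Ico (q + 1) (J₀ + 1), credit (s₀.narr 2 l)
    set K := 100 * (d * d) + 600 * d + 600 with hK
    have e1 : K * (Y + m + w + X) = K * (X + Y) + K * m + K * w := by ring
    have e2 : K * m = 100 * (d * d * m) + 600 * (d * m) + 600 * m := by rw [hK]; ring
    have e3 : (100 * d + 400) * (d * m + 1) = 100 * (d * d * m) + 400 * (d * m) + 100 * d + 400 := by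
      ring
    have e4 : d * (40 * m + 10) = 40 * (d * m) + 10 * d := by ring
    rw [e1, e2]
    rw [e3] at hc₁'
    rw [e4] at hc₂
    simp
    omega

/-- Build the tree. -/
def treeLoop (d : ℕ) : Cmd := .loop (.nlt (.reg 2) (.add (.reg 1) (.const 1))) (processList d)

/-- When the loop ends, `q = J + 1`: all lists are finished, so every leaf has side length `0` and
carries its data. The initial credit bounds the total time. -/
theorem treeLoop_spec {d n : ℕ} (hd : 0 < d) {x : ℕ → ℕ → ℝ} {s : State}
    (h : Outer d n x 0 s) :
    Run (treeLoop d) s fun s' c => (∃ J S P kap mid, Core d n x (J + 1) J s' S P kap mid) ∧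
      c ≤ (100 * (d * d) + 600 * d + 600) * credits 0 s + 10 := by
  refine (Run.loop (fun s => Outer d n x (s.nreg 2) s)
    (fun s => (100 * (d * d) + 600 * d + 600) * credits (s.nreg 2) s) ?_ ?_).mono ?_
  · obtain ⟨S, P, kap, mid, hcore⟩ := h.core
    rwa [hcore.r2]
  · intro s' _ hI hb
    simp only [Test.Holds, NExp.eval] at hb
    refine (processList_spec hd hI (by omega)).mono ?_
    rintro s'' c ⟨h1, h2⟩
    obtain ⟨S, P, kap, mid, hcore⟩ := h1.core
    rw [hcore.r2]
    refine ⟨h1, ?_⟩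
    simp
    omega
  · rintro s' c ⟨⟨h1, h2, h3⟩, hF⟩
    simp only [Test.Holds, NExp.eval] at h2
    obtain ⟨S₀, P₀, kap₀, mid₀, hcore₀⟩ := h.core
    obtain ⟨S, P, kap, mid, hcore⟩ := h1.core
    have := h1.q_le
    rw [show s'.nreg 2 = s'.nreg 1 + 1 by omega] at hcore
    rw [hcore₀.r2] at h3
    refine ⟨⟨_, S, P, kap, mid, hcore⟩, ?_⟩
    simp at h3
    omega
end RealRAM

/-! ### Combinatorics of the split tree -/

/-- The point with the coordinates `f 0 e, …, f (d - 1) e`. -/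
noncomputable def pt (d : ℕ) (f : ℕ → ℕ → ℝ) (e : ℕ) : EuclideanSpace ℝ (Fin d) :=
  WithLp.toLp 2 fun k => f k e

theorem dist_pt_sq {d : ℕ} (f g : ℕ → ℕ → ℝ) (u v : ℕ) :
    dist (pt d f u) (pt d g v) ^ 2 = ∑ k ∈ Finset.range d, (f k u - g k v) * (f k u - g k v) := by
  rw [EuclideanSpace.dist_eq, Real.sq_sqrt (Finset.sum_nonneg fun _ _ => sq_nonneg _),
    Finset.sum_range]
  refine Finset.sum_congr rfl fun k _ => ?_
  simp [pt, Real.dist_eq, sq]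

/-- The crude factor `d` in place of the square root of `d` keeps the constants of the program
rational. -/
theorem dist_le_mul_of_abs_le {d : ℕ} (v w : EuclideanSpace ℝ (Fin d)) {l : ℝ} (hl : 0 ≤ l)
    (h : ∀ k, |v k - w k| ≤ l) : dist v w ≤ d * l := by
  rw [EuclideanSpace.dist_eq]
  refine Real.sqrt_le_iff.2 ⟨by positivity, ?_⟩
  calc ∑ i, dist (v i) (w i) ^ 2 ≤ ∑ _i : Fin d, l ^ 2 := by
        refine Finset.sum_le_sum fun k _ => ?_
        rw [Real.dist_eq]
        exact pow_le_pow_left₀ (abs_nonneg _) (h k) 2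
    _ = d * l ^ 2 := by simp
    _ ≤ (d * l) ^ 2 := by
        rw [mul_pow]
        refine mul_le_mul_of_nonneg_right ?_ (sq_nonneg l)
        exact_mod_cast Nat.le_self_pow two_ne_zero d

theorem abs_sub_le_dist {d : ℕ} (v w : EuclideanSpace ℝ (Fin d)) (k : Fin d) :
    |v k - w k| ≤ dist v w := by
  rw [dist_eq_norm]
  simpa using EuclideanSpace.norm_eq (v - w) ▸ PiLp.norm_apply_le (v - w) k

/-- A split tree of `n` disjoint balls, with the data that are stored at its nodes. Centres and
radii of the balls are given by `x`. -/
structure FairTree (d n : ℕ) (x : ℕ → ℕ → ℝ) (J : ℕ) (S : ℕ → Finset ℕ) (P kap : ℕ → ℕ)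
    (mid EL RHO : ℕ → ℝ) (XC : ℕ → ℕ → ℝ) (REP : ℕ → ℕ) : Prop where
  tree : SplitTree d x J S P kap mid EL
  J_lt : J < n
  root : S 0 = Finset.range n
  rep : ∀ u ≤ 2 * J, REP u ∈ S u
  box : ∀ u ≤ 2 * J, BoxOf d x (S u) (EL u) fun k => XC k u
  rho_pos : ∀ u ≤ 2 * J, 0 < EL u → RHO u = 3 / 2 * d * EL u
  rho_zero : ∀ u ≤ 2 * J, EL u = 0 → RHO u = x d (REP u)
  internal : ∀ u ≤ 2 * J, 0 < EL u → ∃ j < J, P j = u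
  apart : ∀ i < n, ∀ j < n, i ≠ j → x d i + x d j < dist (pt d x i) (pt d x j)
  radius : ∀ i < n, 0 ≤ x d i

namespace FairTree

variable {d n : ℕ} {x : ℕ → ℕ → ℝ} {J : ℕ} {S : ℕ → Finset ℕ} {P kap : ℕ → ℕ}
  {mid EL RHO : ℕ → ℝ} {XC : ℕ → ℕ → ℝ} {REP : ℕ → ℕ}

theorem P_le (h : FairTree d n x J S P kap mid EL RHO XC REP) {j : ℕ} (hj : j < J) :
    P j ≤ 2 * j := h.tree.P_le j hj

theorem mem_low (h : FairTree d n x J S P kap mid EL RHO XC REP) {j e : ℕ} (hj : j < J) :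
    e ∈ S (2 * j + 1) ↔ e ∈ S (P j) ∧ x (kap j) e < mid j := by
  rw [h.tree.low j hj, Finset.mem_filter]

theorem mem_high (h : FairTree d n x J S P kap mid EL RHO XC REP) {j e : ℕ} (hj : j < J) :
    e ∈ S (2 * j + 2) ↔ e ∈ S (P j) ∧ mid j ≤ x (kap j) e := by
  rw [h.tree.high j hj, Finset.mem_filter, not_lt]

theorem disjoint_children (h : FairTree d n x J S P kap mid EL RHO XC REP) {j : ℕ} (hj : j < J) :
    Disjoint (S (2 * j + 1)) (S (2 * j + 2)) := by
  rw [Finset.disjoint_left]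
  intro e he he'
  rw [h.mem_low hj] at he
  rw [h.mem_high hj] at he'
  linarith [he.2, he'.2]

/-- `v` is a child of `u`. -/
def _root_.IsChild (J : ℕ) (P : ℕ → ℕ) (u v : ℕ) : Prop :=
  ∃ j < J, P j = u ∧ (v = 2 * j + 1 ∨ v = 2 * j + 2)

/-- `u` is an ancestor of `v`, possibly `v` itself. -/
def _root_.Anc (J : ℕ) (P : ℕ → ℕ) : ℕ → ℕ → Prop := Relation.ReflTransGen (IsChild J P)

theorem _root_.isChild_par {J : ℕ} {P : ℕ → ℕ} {v : ℕ} (h₁ : 1 ≤ v) (h₂ : v ≤ 2 * J) :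
    IsChild J P (P ((v - 1) / 2)) v :=
  ⟨(v - 1) / 2, by omega, rfl, by omega⟩

theorem _root_.IsChild.eq_par {J : ℕ} {P : ℕ → ℕ} {u v : ℕ} (h : IsChild J P u v) :
    u = P ((v - 1) / 2) ∧ 1 ≤ v ∧ v ≤ 2 * J := by
  obtain ⟨j, hj, rfl, hv⟩ := h
  exact ⟨by congr 1; omega, by omega, by omega⟩

theorem child_lt (h : FairTree d n x J S P kap mid EL RHO XC REP) {u v : ℕ}
    (hc : IsChild J P u v) : u < v := by
  obtain ⟨j, hj, rfl, hv⟩ := hc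
  have := h.P_le hj
  omega

theorem child_subset (h : FairTree d n x J S P kap mid EL RHO XC REP) {u v : ℕ}
    (hc : IsChild J P u v) : S v ⊆ S u := by
  obtain ⟨j, hj, rfl, rfl | rfl⟩ := hc <;> intro e he
  · exact ((h.mem_low hj).1 he).1
  · exact ((h.mem_high hj).1 he).1

/-- The side length of an internal node is attained by two of its elements, so any node that
contains it has a side at least as long. -/
theorem el_mono (h : FairTree d n x J S P kap mid EL RHO XC REP) {u v : ℕ} (hu : u ≤ 2 * J)
    (hv : v ≤ 2 * J) (hs : S v ⊆ S u) : EL v ≤ EL u := by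
  rcases (h.box v hv).nonneg.lt_or_eq with h0 | h0
  · obtain ⟨j, hj, rfl⟩ := h.internal v hv h0
    obtain ⟨a, ha, b, hb, hab, -⟩ := h.tree.split j hj
    rw [← hab]
    exact (h.box u hu).ext _ (h.tree.kap_lt j hj) _ (hs ha) _ (hs hb)
  · rw [← h0]
    exact (h.box u hu).nonneg

theorem anc_subset (h : FairTree d n x J S P kap mid EL RHO XC REP) {u v : ℕ}
    (ha : Anc J P u v) : S v ⊆ S u := by
  induction ha with
  | refl => exact subset_rfl
  | tail _ hc ih => exact (h.child_subset hc).trans ih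

theorem anc_le (h : FairTree d n x J S P kap mid EL RHO XC REP) {u v : ℕ}
    (ha : Anc J P u v) : u ≤ v := by
  induction ha with
  | refl => exact le_rfl
  | tail _ hc ih => exact ih.trans (h.child_lt hc).le

theorem _root_.Anc.child {J : ℕ} {P : ℕ → ℕ} {u v : ℕ} (ha : Anc J P u v) (hne : u ≠ v) :
    ∃ c, IsChild J P u c ∧ Anc J P c v := by
  rcases Relation.ReflTransGen.cases_head ha with rfl | h
  · exact absurd rfl hne
  · exact h

theorem _root_.Anc.par {J : ℕ} {P : ℕ → ℕ} {u v : ℕ} (ha : Anc J P u v) (hne : u ≠ v) :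
    Anc J P u (P ((v - 1) / 2)) := by
  rcases Relation.ReflTransGen.cases_tail ha with rfl | ⟨c, h₁, h₂⟩
  · exact absurd rfl hne
  · rwa [← h₂.eq_par.1]

/-- Children have larger indices than their parents, so the node with the larger index can be
replaced by its parent in an induction on the sum of the indices. Incomparable nodes are separated
by the split at which their paths part. -/
theorem trichotomy (h : FairTree d n x J S P kap mid EL RHO XC REP) :
    ∀ m u v, u + v = m → u ≤ 2 * J → v ≤ 2 * J → Anc J P u v ∨ Anc J P v u ∨
      ∃ j < J, Anc J P (2 * j + 1) u ∧ Anc J P (2 * j + 2) v ∨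
        Anc J P (2 * j + 2) u ∧ Anc J P (2 * j + 1) v := by
  intro m
  induction m using Nat.strong_induction_on with
  | _ m ih =>
    have key : ∀ u v, u + v = m → u ≤ 2 * J → v ≤ 2 * J → u < v → Anc J P u v ∨ Anc J P v u ∨
        ∃ j < J, Anc J P (2 * j + 1) u ∧ Anc J P (2 * j + 2) v ∨
          Anc J P (2 * j + 2) u ∧ Anc J P (2 * j + 1) v := by
      intro u v hm hu hv hlt
      have hc := isChild_par (P := P) (show 1 ≤ v by omega) hv
      have hpl := h.child_lt hc
      rcases ih (u + P ((v - 1) / 2)) (by omega) u _ rfl hu (by omega) with h1 | h1 | ⟨j, hj, h1⟩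
      · exact Or.inl (h1.tail hc)
      · by_cases hne : P ((v - 1) / 2) = u
        · exact Or.inl (.single (hne ▸ hc))
        · obtain ⟨c, hpc, hcu⟩ := h1.child hne
          obtain ⟨j, hj, hPj, hcj⟩ := hpc
          obtain ⟨j', hj', hPj', hvj⟩ := hc
          obtain rfl := h.tree.P_inj _ hj _ hj' (hPj.trans hPj'.symm)
          by_cases hcv : c = v
          · exact Or.inr (Or.inl (hcv ▸ hcu))
          · refine Or.inr (Or.inr ⟨j, hj, ?_⟩)
            rcases hcj with rfl | rfl <;> rcases hvj with rfl | rfl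
            · exact absurd rfl hcv
            · exact Or.inl ⟨hcu, .refl⟩
            · exact Or.inr ⟨hcu, .refl⟩
            · exact absurd rfl hcv
      · refine Or.inr (Or.inr ⟨j, hj, ?_⟩)
        exact h1.imp (fun g => ⟨g.1, g.2.tail hc⟩) fun g => ⟨g.1, g.2.tail hc⟩
    intro u v hm hu hv
    rcases lt_trichotomy u v with hlt | rfl | hlt
    · exact key u v hm hu hv hlt
    · exact Or.inl .refl
    · rcases key v u (by omega) hv hu hlt with h1 | h1 | ⟨j, hj, h1⟩
      · exact Or.inr (Or.inl h1)
      · exact Or.inl h1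
      · exact Or.inr (Or.inr ⟨j, hj, h1.symm.imp And.symm And.symm⟩)

theorem disjoint_of_separated (h : FairTree d n x J S P kap mid EL RHO XC REP) {j u v : ℕ}
    (hj : j < J) (hs : Anc J P (2 * j + 1) u ∧ Anc J P (2 * j + 2) v ∨
        Anc J P (2 * j + 2) u ∧ Anc J P (2 * j + 1) v) : Disjoint (S u) (S v) := by
  rcases hs with ⟨h1, h2⟩ | ⟨h1, h2⟩
  · exact (h.disjoint_children hj).mono (h.anc_subset h1) (h.anc_subset h2)
  · exact (h.disjoint_children hj).symm.mono (h.anc_subset h1) (h.anc_subset h2)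

/-- Nodes with a common element are comparable. -/
theorem anc_or_anc (h : FairTree d n x J S P kap mid EL RHO XC REP) {u v e : ℕ}
    (hu : u ≤ 2 * J) (hv : v ≤ 2 * J) (he : e ∈ S u) (he' : e ∈ S v) :
    Anc J P u v ∨ Anc J P v u := by
  rcases h.trichotomy _ u v rfl hu hv with h1 | h1 | ⟨j, hj, h1⟩
  · exact Or.inl h1
  · exact Or.inr h1
  · exact absurd he' (Finset.disjoint_left.1 (h.disjoint_of_separated hj h1) he)

theorem mem_lt (h : FairTree d n x J S P kap mid EL RHO XC REP) {u e : ℕ} (hu : u ≤ 2 * J)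
    (he : e ∈ S u) : e < n := by
  induction u using Nat.strong_induction_on with
  | _ u ih =>
    rcases Nat.eq_zero_or_pos u with rfl | h0
    · rwa [h.root, Finset.mem_range] at he
    · have hc := isChild_par (P := P) h0 hu
      have := h.child_lt hc
      exact ih _ this (by omega) (h.child_subset hc he)

/-- A box of side length `0` is a point, and disjoint balls have different centres. -/
theorem eq_of_el_eq_zero (h : FairTree d n x J S P kap mid EL RHO XC REP) {u i j : ℕ}
    (hu : u ≤ 2 * J) (h0 : EL u = 0) (hi : i ∈ S u) (hj : j ∈ S u) : i = j := by
  by_contra hne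
  have h1 := h.apart i (h.mem_lt hu hi) j (h.mem_lt hu hj) hne
  have h2 : pt d x i = pt d x j := by
    ext k
    have g1 := (h.box u hu).ext k k.2 i hi j hj
    have g2 := (h.box u hu).ext k k.2 j hj i hi
    simp only [pt]
    linarith
  rw [h2, dist_self] at h1
  linarith [h.radius i (h.mem_lt hu hi), h.radius j (h.mem_lt hu hj)]

/-- The pair of nodes `u`, `v` covers the pair `i`, `j`. -/
def _root_.Covers (S : ℕ → Finset ℕ) (u v i j : ℕ) : Prop :=
  i ∈ S u ∧ j ∈ S v ∨ j ∈ S u ∧ i ∈ S v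

/-- The node with the largest index that contains both elements is internal, and no child contains
both, because a child has a larger index. -/
theorem exists_split_covers (h : FairTree d n x J S P kap mid EL RHO XC REP) {i j : ℕ}
    (hi : i < n) (hj : j < n) (hne : i ≠ j) :
    ∃ a < J, Covers S (2 * a + 1) (2 * a + 2) i j := by
  classical
  let T := (Finset.range (2 * J + 1)).filter fun u => i ∈ S u ∧ j ∈ S u
  have h0 : 0 ∈ T := by simp [T, h.root, hi, hj]
  obtain ⟨u, hu, hmax⟩ := T.exists_max_image id ⟨0, h0⟩
  simp only [T, Finset.mem_filter, Finset.mem_range, id] at hu hmax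
  obtain ⟨hu2, hiu, hju⟩ := hu
  have hpos : 0 < EL u := by
    rcases (h.box u (by omega)).nonneg.lt_or_eq with g | g
    · exact g
    · exact absurd (h.eq_of_el_eq_zero (by omega) g.symm hiu hju) hne
  obtain ⟨a, ha, rfl⟩ := h.internal u (by omega) hpos
  have hP := h.P_le ha
  refine ⟨a, ha, ?_⟩
  have c1 : ∀ e ∈ S (P a), e ∈ S (2 * a + 1) ∨ e ∈ S (2 * a + 2) := by
    intro e he
    rw [h.mem_low ha, h.mem_high ha]
    rcases lt_or_ge (x (kap a) e) (mid a) with g | g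
    · exact Or.inl ⟨he, g⟩
    · exact Or.inr ⟨he, g⟩
  rcases c1 i hiu with g | g <;> rcases c1 j hju with g' | g'
  · have := hmax (2 * a + 1) ⟨by omega, g, g'⟩
    omega
  · exact Or.inl ⟨g, g'⟩
  · exact Or.inr ⟨g', g⟩
  · have := hmax (2 * a + 2) ⟨by omega, g, g'⟩
    omega

/-- Two such split nodes share an element, hence are comparable. If one were strictly below the
other, both elements would lie in the same child of the upper node. -/
theorem split_covers_unique (h : FairTree d n x J S P kap mid EL RHO XC REP) {i j a b : ℕ}
    (ha : a < J) (hb : b < J) (ca : Covers S (2 * a + 1) (2 * a + 2) i j)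
    (cb : Covers S (2 * b + 1) (2 * b + 2) i j) : a = b := by
  have both : ∀ {a}, a < J → Covers S (2 * a + 1) (2 * a + 2) i j → i ∈ S (P a) ∧ j ∈ S (P a) := by
    intro a ha ca
    simp only [Covers, h.mem_low ha, h.mem_high ha] at ca
    tauto
  have key : ∀ {a b}, a < J → b < J → Covers S (2 * a + 1) (2 * a + 2) i j →
      Covers S (2 * b + 1) (2 * b + 2) i j → Anc J P (P a) (P b) → a = b := by
    intro a b ha hb ca cb hanc
    by_contra hne
    obtain ⟨c, ⟨a', ha', hPa, hc⟩, hcb⟩ := hanc.child fun g => hne (h.tree.P_inj _ ha _ hb g)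
    obtain rfl := h.tree.P_inj _ ha' _ ha hPa
    obtain ⟨hi, hj⟩ := both hb cb
    replace hi := h.anc_subset hcb hi
    replace hj := h.anc_subset hcb hj
    have hd := Finset.disjoint_left.1 (h.disjoint_children ha)
    rcases hc with rfl | rfl <;> rcases ca with ⟨g1, g2⟩ | ⟨g1, g2⟩
    · exact hd hj g2
    · exact hd hi g2
    · exact hd g1 hi
    · exact hd g1 hj
  have hPa := h.P_le ha
  have hPb := h.P_le hb
  rcases h.anc_or_anc (u := P a) (v := P b) (by omega) (by omega) (both ha ca).1 (both hb cb).1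
    with g | g
  · exact key ha hb ca cb g
  · exact (key hb ha cb ca g).symm

end FairTree

/-! ### Packing bounds for the inspected pairs -/

/-- Volume bound for the number of points with large mutual distances in a ball. -/
theorem card_mul_pow_le_of_separated {d : ℕ} {ι : Type*} (T : Finset ι)
    (f : ι → EuclideanSpace ℝ (Fin d)) (c : EuclideanSpace ℝ (Fin d)) {σ R : ℝ} (hσ : 0 < σ)
    (hR : 0 ≤ R) (hf : ∀ i ∈ T, dist (f i) c ≤ R)
    (hs : ∀ i ∈ T, ∀ j ∈ T, i ≠ j → 2 * σ ≤ dist (f i) (f j)) :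
    (T.card : ℝ) * σ ^ d ≤ (R + σ) ^ d := by
  open MeasureTheory in
  let μ : Measure (EuclideanSpace ℝ (Fin d)) := Measure.addHaar
  have hRσ : 0 < R + σ := by linarith
  have D : Set.Pairwise (T : Set ι) (Function.onFun Disjoint fun i => Metric.ball (f i) σ) := by
    intro i hi j hj hij
    refine Metric.ball_disjoint_ball ?_
    linarith [hs i hi j hj hij]
  have I : (T.card : ℝ≥0∞) * ENNReal.ofReal (σ ^ d) * μ (Metric.ball 0 1) ≤
      ENNReal.ofReal ((R + σ) ^ d) * μ (Metric.ball 0 1) :=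
    calc (T.card : ℝ≥0∞) * ENNReal.ofReal (σ ^ d) * μ (Metric.ball 0 1)
        = μ (⋃ i ∈ T, Metric.ball (f i) σ) := by
          rw [measure_biUnion_finset D fun c _ => measurableSet_ball]
          simp only [μ.addHaar_ball_of_pos _ hσ, finrank_euclideanSpace, Fintype.card_fin]
          simp only [Finset.sum_const, nsmul_eq_mul, mul_assoc]
      _ ≤ μ (Metric.ball c (R + σ)) := by
          refine measure_mono (Set.iUnion₂_subset fun i hi => Metric.ball_subset_ball' ?_)
          linarith [hf i hi]
      _ = _ := by
          simp only [μ.addHaar_ball_of_pos _ hRσ, finrank_euclideanSpace, Fintype.card_fin]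
  have K : (T.card : ℝ≥0∞) * ENNReal.ofReal (σ ^ d) ≤ ENNReal.ofReal ((R + σ) ^ d) :=
    (ENNReal.mul_le_mul_iff_left (Metric.measure_ball_pos _ _ zero_lt_one).ne'
      measure_ball_lt_top.ne).1 I
  have := ENNReal.toReal_le_of_le_ofReal (by positivity) K
  rwa [ENNReal.toReal_mul, ENNReal.toReal_natCast, ENNReal.toReal_ofReal (by positivity)] at this

/-- Used to move from the centre of a large ball towards a given point, so that a smaller ball
placed there still lies in the large one but close to that point. -/
theorem exists_point_towards {d : ℕ} (p q : EuclideanSpace ℝ (Fin d)) {s : ℝ} (hs : 0 ≤ s) :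
    ∃ w, dist w p ≤ s ∧ dist w q ≤ max 0 (dist p q - s) := by
  rcases le_or_gt (dist p q) s with h | h
  · exact ⟨q, by rwa [dist_comm], by simp⟩
  · have h0 : 0 < dist p q := hs.trans_lt h
    have h1 : s / dist p q ≤ 1 := (div_le_one h0).2 h.le
    refine ⟨AffineMap.lineMap p q (s / dist p q), ?_, le_max_of_le_right ?_⟩
    · rw [dist_lineMap_left, Real.norm_of_nonneg (by positivity), div_mul_cancel₀ _ h0.ne']
    · rw [dist_lineMap_right, Real.norm_of_nonneg (by linarith), sub_mul, one_mul,
        div_mul_cancel₀ _ h0.ne']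

/-- The order in which nodes are split. -/
def Bigger (EL : ℕ → ℝ) (u v : ℕ) : Prop := EL v < EL u ∨ EL u = EL v ∧ u < v

theorem Bigger.trans {EL : ℕ → ℝ} {u v w : ℕ} (h₁ : Bigger EL u v) (h₂ : Bigger EL v w) :
    Bigger EL u w := by
  rcases h₁ with h₁ | ⟨h₁, g₁⟩ <;> rcases h₂ with h₂ | ⟨h₂, g₂⟩
  · exact Or.inl (h₂.trans h₁)
  · exact Or.inl (h₂ ▸ h₁)
  · exact Or.inl (h₁ ▸ h₂)
  · exact Or.inr ⟨h₁.trans h₂, g₁.trans g₂⟩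

theorem Bigger.le {EL : ℕ → ℝ} {u v : ℕ} (h : Bigger EL u v) : EL v ≤ EL u :=
  h.elim le_of_lt fun h => h.1.ge

theorem Bigger.or {EL : ℕ → ℝ} {u v : ℕ} (h : u ≠ v) : Bigger EL u v ∨ Bigger EL v u := by
  rcases lt_trichotomy (EL u) (EL v) with h1 | h1 | h1
  · exact Or.inr (Or.inl h1)
  · rcases lt_or_gt_of_ne h with h2 | h2
    · exact Or.inl (Or.inr ⟨h1, h2⟩)
    · exact Or.inr (Or.inr ⟨h1.symm, h2⟩)
  · exact Or.inl (Or.inl h1)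

/-- The regions around the nodes `u` and `v` are far apart, relative to their sizes. -/
def Far (d : ℕ) (EL RHO : ℕ → ℝ) (XC : ℕ → ℕ → ℝ) (τ : ℝ) (u v : ℕ) : Prop :=
  RHO u + RHO v + τ * max (EL u) (EL v) ≤ dist (pt d XC u) (pt d XC v)

theorem Far.symm {d : ℕ} {EL RHO : ℕ → ℝ} {XC : ℕ → ℕ → ℝ} {τ : ℝ} {u v : ℕ}
    (h : Far d EL RHO XC τ u v) : Far d EL RHO XC τ v u := by
  rw [Far] at *
  rw [dist_comm, max_comm]
  linarith

/-- The pairs of nodes that are inspected and split, the bigger node first. -/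
structure Crossing (d J : ℕ) (S : ℕ → Finset ℕ) (P : ℕ → ℕ) (EL RHO : ℕ → ℝ) (XC : ℕ → ℕ → ℝ)
    (τ : ℝ) (a y : ℕ) : Prop where
  a_le : a ≤ 2 * J
  y_pos : 1 ≤ y
  y_le : y ≤ 2 * J
  disj : Disjoint (S a) (S y)
  par : Bigger EL (P ((y - 1) / 2)) a
  bigger : Bigger EL a y
  near : ¬ Far d EL RHO XC τ a y

namespace FairTree

variable {d n : ℕ} {x : ℕ → ℕ → ℝ} {J : ℕ} {S : ℕ → Finset ℕ} {P kap : ℕ → ℕ}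
  {mid EL RHO : ℕ → ℝ} {XC : ℕ → ℕ → ℝ} {REP : ℕ → ℕ}

/-- Of the two splits take the later one. Its node lies on one side of the earlier cut, and its
midpoint is half of a side of length at least `l` away from both of its extremes. Hence two cuts
that bound `y` from opposite sides in the same coordinate are at least `l / 2` apart. -/
theorem gap (h : FairTree d n x J S P kap mid EL RHO XC REP) {y e : ℕ} {l : ℝ}
    (hy2 : y ≤ 2 * J) (he : e ∈ S y) (hl : l ≤ EL (P ((y - 1) / 2))) {i j : ℕ}
    (hi : i < J) (hj : j < J) (hk : kap i = kap j) (ai : Anc J P (2 * i + 1) y)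
    (aj : Anc J P (2 * j + 2) y) : mid j + l / 2 ≤ mid i := by
  have hd : ∀ {i}, i < J → e ∈ S (2 * i + 1) → e ∉ S (2 * i + 2) := fun hi g =>
    Finset.disjoint_left.1 (h.disjoint_children hi) g
  have ei := h.anc_subset ai he
  have ej := h.anc_subset aj he
  have hne : i ≠ j := by
    rintro rfl
    exact hd hi ei ej
  have hPi := h.P_le hi
  have hPj := h.P_le hj
  have hpar : 1 ≤ y := by have := h.anc_le ai; omega
  have hci : IsChild J P (P i) (2 * i + 1) := ⟨i, hi, rfl, Or.inl rfl⟩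
  have hcj : IsChild J P (P j) (2 * j + 2) := ⟨j, hj, rfl, Or.inr rfl⟩
  have hlt := h.child_lt (isChild_par (P := P) hpar hy2)
  have hEi : l ≤ EL (P i) := by
    have h1 := h.anc_le ai
    refine hl.trans (h.el_mono (by omega) (by omega) (h.anc_subset ?_))
    exact Anc.par (Relation.ReflTransGen.head hci ai) (by omega)
  have hEj : l ≤ EL (P j) := by
    have h1 := h.anc_le aj
    refine hl.trans (h.el_mono (by omega) (by omega) (h.anc_subset ?_))
    exact Anc.par (Relation.ReflTransGen.head hcj aj) (by omega)
  rcases h.anc_or_anc (u := P i) (v := P j) (by omega) (by omega) (h.child_subset hci ei)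
    (h.child_subset hcj ej) with g | g
  · obtain ⟨c, ⟨i', hi', hPi', hc⟩, hcb⟩ := g.child fun g => hne (h.tree.P_inj _ hi _ hj g)
    obtain rfl := h.tree.P_inj _ hi' _ hi hPi'
    have hsub := h.anc_subset hcb
    rcases hc with rfl | rfl
    · obtain ⟨a, ha, b, hb, hab, hm, -⟩ := h.tree.split j hj
      have := ((h.mem_low hi).1 (hsub hb)).2
      rw [hk] at this
      linarith
    · exact absurd (hsub (h.child_subset hcj ej)) (hd hi ei)
  · obtain ⟨c, ⟨j', hj', hPj', hc⟩, hcb⟩ := g.child fun g => hne (h.tree.P_inj _ hj _ hi g).symm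
    obtain rfl := h.tree.P_inj _ hj' _ hj hPj'
    have hsub := h.anc_subset hcb
    rcases hc with rfl | rfl
    · exact absurd ej (hd hj (hsub (h.child_subset hci ei)))
    · obtain ⟨a, ha, b, hb, hab, hm, -⟩ := h.tree.split i hi
      have := ((h.mem_high hj).1 (hsub ha)).2
      rw [← hk] at this
      linarith

/-- Every node has a cube of side `l / 2`, where `l` is at most the length of its parent, that is
separated by all splits from the cubes of disjoint nodes. -/
theorem exists_cube (h : FairTree d n x J S P kap mid EL RHO XC REP) {y e : ℕ} {l : ℝ}
    (hy2 : y ≤ 2 * J) (he : e ∈ S y) (hl0 : 0 ≤ l) (hl : l ≤ EL (P ((y - 1) / 2))) :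
    ∃ z : EuclideanSpace ℝ (Fin d), (∀ k : Fin d, |z k - x k e| ≤ l / 4) ∧
      ∀ j, j < J → ∀ k : Fin d, (k : ℕ) = kap j →
        (Anc J P (2 * j + 1) y → z k + l / 4 ≤ mid j) ∧
        (Anc J P (2 * j + 2) y → mid j + l / 4 ≤ z k) := by
  have key : ∀ k : Fin d, ∃ z : ℝ, |z - x k e| ≤ l / 4 ∧ ∀ j, j < J → (k : ℕ) = kap j →
      (Anc J P (2 * j + 1) y → z + l / 4 ≤ mid j) ∧
      (Anc J P (2 * j + 2) y → mid j + l / 4 ≤ z) := by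
    intro k
    -- The constraints on the centre of an interval of length `l / 2`: lower bounds in `A`, upper
    -- bounds in `B`. By `gap` each lower bound is at most each upper bound, so all can be met
    -- together.
    let A : Set ℝ := {a | a = x k e - l / 4 ∨ ∃ j < J, (k : ℕ) = kap j ∧ Anc J P (2 * j + 2) y ∧
      a = mid j + l / 4}
    let B : Set ℝ := {b | b = x k e + l / 4 ∨ ∃ j < J, (k : ℕ) = kap j ∧ Anc J P (2 * j + 1) y ∧
      b = mid j - l / 4}
    have hlow : ∀ j < J, (k : ℕ) = kap j → Anc J P (2 * j + 1) y → x k e < mid j := by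
      intro j hj hk ha
      rw [hk]
      exact ((h.mem_low hj).1 (h.anc_subset ha he)).2
    have hhigh : ∀ j < J, (k : ℕ) = kap j → Anc J P (2 * j + 2) y → mid j ≤ x k e := by
      intro j hj hk ha
      rw [hk]
      exact ((h.mem_high hj).1 (h.anc_subset ha he)).2
    obtain ⟨z, hzA, hzB⟩ := exists_between_of_forall_le (s := A) (t := B) ⟨_, Or.inl rfl⟩
      ⟨_, Or.inl rfl⟩ (by
        rintro a (rfl | ⟨j, hj, hk, ha, rfl⟩) b (rfl | ⟨i, hi, hk', hb, rfl⟩)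
        · linarith
        · linarith [hlow i hi hk' hb]
        · linarith [hhigh j hj hk ha]
        · linarith [h.gap hy2 he hl hi hj (hk'.symm.trans hk) hb ha])
    refine ⟨z, ?_, fun j hj hk => ⟨fun ha => ?_, fun ha => hzA (Or.inr ⟨j, hj, hk, ha, rfl⟩)⟩⟩
    · have h1 := hzA (Or.inl rfl)
      have h2 := hzB (Or.inl rfl)
      rw [abs_le]
      constructor <;> linarith
    · have := hzB (Or.inr ⟨j, hj, hk, ha, rfl⟩)
      linarith
  choose z hz hz' using key
  exact ⟨WithLp.toLp 2 z, hz, fun j hj k hk => hz' k j hj hk⟩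

theorem dist_centre_le (h : FairTree d n x J S P kap mid EL RHO XC REP) {u e : ℕ}
    (hu : u ≤ 2 * J) (he : e ∈ S u) : dist (pt d x e) (pt d XC u) ≤ d * (EL u / 2) := by
  have := (h.box u hu).nonneg
  exact dist_le_mul_of_abs_le _ _ (by linarith) fun k => (h.box u hu).ctr k k.2 e he

theorem rho_nonneg (h : FairTree d n x J S P kap mid EL RHO XC REP) {u : ℕ} (hu : u ≤ 2 * J) :
    0 ≤ RHO u := by
  rcases (h.box u hu).nonneg.lt_or_eq with g | g
  · rw [h.rho_pos u hu g]
    positivity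
  · rw [h.rho_zero u hu g.symm]
    exact h.radius _ (h.mem_lt hu (h.rep u hu))

/-- With both side lengths `0` the term with `τ` vanishes, and what remains is the disjointness of
two balls. It follows that the bigger node of a pair that is not far can be split. -/
theorem far_of_el_eq_zero (h : FairTree d n x J S P kap mid EL RHO XC REP) {u v : ℕ} {τ : ℝ}
    (hu : u ≤ 2 * J) (hv : v ≤ 2 * J) (hd : Disjoint (S u) (S v)) (hu0 : EL u = 0)
    (hv0 : EL v = 0) : Far d EL RHO XC τ u v := by
  have centre : ∀ {u}, u ≤ 2 * J → EL u = 0 → pt d XC u = pt d x (REP u) := by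
    intro u hu h0
    have := h.dist_centre_le hu (h.rep u hu)
    rw [h0, zero_div, mul_zero] at this
    exact (dist_le_zero.1 this).symm
  have hne : REP u ≠ REP v := fun g =>
    Finset.disjoint_left.1 hd (h.rep u hu) (g ▸ h.rep v hv)
  rw [Far, hu0, hv0, centre hu hu0, centre hv hv0, h.rho_zero u hu hu0, h.rho_zero v hv hv0]
  have := h.apart _ (h.mem_lt hu (h.rep u hu)) _ (h.mem_lt hv (h.rep v hv)) hne
  simp
  linarith

theorem _root_.Crossing.pos {a y : ℕ} {τ : ℝ} (hc : Crossing d J S P EL RHO XC τ a y)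
    (h : FairTree d n x J S P kap mid EL RHO XC REP) : 0 < EL a := by
  by_contra hn
  have ha := (h.box a hc.a_le).nonneg
  have hy := (h.box y hc.y_le).nonneg
  have := hc.bigger.le
  exact hc.near (h.far_of_el_eq_zero hc.a_le hc.y_le hc.disj (by linarith) (by linarith))

/-- If `y` were a proper ancestor of `y'`, the parent of `y'` would lie weakly below `y`; but it is
bigger than `a`, which is bigger than `y`. So partners of one node `a` are pairwise incomparable. -/
theorem _root_.Crossing.separated {a y y' : ℕ} {τ : ℝ} (hc : Crossing d J S P EL RHO XC τ a y)
    (hc' : Crossing d J S P EL RHO XC τ a y')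
    (h : FairTree d n x J S P kap mid EL RHO XC REP) (hne : y ≠ y') :
    ∃ j < J, Anc J P (2 * j + 1) y ∧ Anc J P (2 * j + 2) y' ∨
      Anc J P (2 * j + 2) y ∧ Anc J P (2 * j + 1) y' := by
  have key : ∀ {y y'}, Crossing d J S P EL RHO XC τ a y → Crossing d J S P EL RHO XC τ a y' →
      y ≠ y' → ¬ Anc J P y y' := by
    intro y y' hc hc' hne ha
    have hp := ha.par hne
    have hlt := h.child_lt (isChild_par (P := P) hc'.y_pos hc'.y_le)
    have hle := h.anc_le hp
    have hel := h.el_mono hc.y_le (by have := hc'.y_le; omega) (h.anc_subset hp)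
    have hb := hc'.par.trans hc.bigger
    rcases hb with hb | ⟨hb, hb'⟩
    · linarith
    · omega
  rcases h.trichotomy _ y y' rfl hc.y_le hc'.y_le with g | g | g
  · exact absurd g (key hc hc' hne)
  · exact absurd g (key hc' hc hne.symm)
  · exact g

/-- The parent of a partner `y` has side at least `l = EL a`, which gives `y` a cube of side `l / 2`
near its representative. Cubes of different partners are separated by a split, so their centres are
`2 * (l / 4)` apart. As the pair is not far and `RHO y ≤ τ * l`, the centres lie within `3 * τ * l`
of `a`. -/
theorem card_crossing_small (h : FairTree d n x J S P kap mid EL RHO XC REP) {τ : ℝ}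
    (hτ : 18 * d ≤ τ) (hd : 0 < d) (a : ℕ) (T : Finset ℕ)
    (hT : ∀ y ∈ T, Crossing d J S P EL RHO XC τ a y ∧ RHO y ≤ τ * EL a) :
    (T.card : ℝ) ≤ (13 * τ) ^ d := by
  rcases T.eq_empty_or_nonempty with rfl | ⟨y₀, hy₀⟩
  · have : (0 : ℝ) ≤ τ := le_trans (by positivity) hτ
    simp
    positivity
  have hd1 : (1 : ℝ) ≤ d := by exact_mod_cast hd
  have ha := (hT y₀ hy₀).1.a_le
  have hpos := (hT y₀ hy₀).1.pos h
  set l := EL a with hl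
  have hz : ∀ y, ∃ z : EuclideanSpace ℝ (Fin d), y ∈ T →
      (∀ k : Fin d, |z k - x k (REP y)| ≤ l / 4) ∧
      ∀ j, j < J → ∀ k : Fin d, (k : ℕ) = kap j →
        (Anc J P (2 * j + 1) y → z k + l / 4 ≤ mid j) ∧
        (Anc J P (2 * j + 2) y → mid j + l / 4 ≤ z k) := by
    intro y
    by_cases hy : y ∈ T
    · have hc := (hT y hy).1
      obtain ⟨z, hz⟩ := h.exists_cube hc.y_le (h.rep y hc.y_le) hpos.le hc.par.le
      exact ⟨z, fun _ => hz⟩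
    · exact ⟨0, fun g => absurd g hy⟩
  choose z hz using hz
  have hdl : d * l ≤ τ * l / 18 := by nlinarith
  have hτl : 0 ≤ τ * l := by nlinarith
  have hcount := card_mul_pow_le_of_separated T z (pt d XC a) (σ := l / 4) (R := 3 * (τ * l))
    (by linarith) (by linarith) ?_ ?_
  · have h1 : 3 * (τ * l) + l / 4 ≤ 13 * τ * (l / 4) := by nlinarith
    have h2 : (T.card : ℝ) * (l / 4) ^ d ≤ (13 * τ) ^ d * (l / 4) ^ d := by
      rw [← mul_pow]
      exact hcount.trans (pow_le_pow_left₀ (by linarith) h1 d)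
    exact le_of_mul_le_mul_right h2 (by positivity)
  · intro y hy
    obtain ⟨hc, hρ⟩ := hT y hy
    have h1 : dist (z y) (pt d x (REP y)) ≤ d * (l / 4) :=
      dist_le_mul_of_abs_le _ _ (by linarith) (hz y hy).1
    have h2 := h.dist_centre_le hc.y_le (h.rep y hc.y_le)
    have h3 := hc.near
    rw [Far, not_le, max_eq_left hc.bigger.le, h.rho_pos a ha hpos, ← hl, dist_comm] at h3
    have h4 : (d : ℝ) * (EL y / 2) ≤ d * (l / 2) := by
      have := hc.bigger.le
      gcongr
    have h5 := dist_triangle4 (z y) (pt d x (REP y)) (pt d XC y) (pt d XC a)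
    linarith
  · intro y hy y' hy' hne
    obtain ⟨j, hj, hs⟩ := (hT y hy).1.separated (hT y' hy').1 h hne
    let k : Fin d := ⟨kap j, h.tree.kap_lt j hj⟩
    have g := (hz y hy).2 j hj k rfl
    have g' := (hz y' hy').2 j hj k rfl
    refine le_trans ?_ (abs_sub_le_dist (z y) (z y') k)
    rcases hs with ⟨s1, s2⟩ | ⟨s1, s2⟩
    · rw [abs_sub_comm]
      refine le_trans ?_ (le_abs_self _)
      linarith [g.1 s1, g'.2 s2]
    · refine le_trans ?_ (le_abs_self _)
      linarith [g.2 s1, g'.1 s2]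

/-- Here cubes would be too far away from `a`. But `RHO y` exceeds what an internal node no bigger
than `a` can have, so `y` is a leaf, and its ball contains a ball of radius `σ = τ * EL a` with
centre within `3 * σ` of `a`. The balls of the leaves are disjoint. -/
theorem card_crossing_big (h : FairTree d n x J S P kap mid EL RHO XC REP) {τ : ℝ}
    (hτ : 18 * d ≤ τ) (hd : 0 < d) (a : ℕ) (T : Finset ℕ)
    (hT : ∀ y ∈ T, Crossing d J S P EL RHO XC τ a y ∧ τ * EL a < RHO y) :
    (T.card : ℝ) ≤ 4 ^ d := by
  rcases T.eq_empty_or_nonempty with rfl | ⟨y₀, hy₀⟩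
  · simp
  have hd1 : (1 : ℝ) ≤ d := by exact_mod_cast hd
  have ha := (hT y₀ hy₀).1.a_le
  have hpos := (hT y₀ hy₀).1.pos h
  set l := EL a with hl
  have hdl : d * l ≤ τ * l / 18 := by nlinarith
  have hτl : 0 < τ * l := mul_pos (by linarith) hpos
  set σ := τ * l with hσ
  -- For an internal `y`, `RHO y = 3/2 * d * EL y ≤ 3/2 * d * l`, which is less than `18 * d * l ≤ τ
  -- * l`.
  have hleaf : ∀ y ∈ T, EL y = 0 := by
    intro y hy
    obtain ⟨hc, hρ⟩ := hT y hy
    rcases (h.box y hc.y_le).nonneg.lt_or_eq with g | g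
    · rw [h.rho_pos y hc.y_le g] at hρ
      have : (d : ℝ) * EL y ≤ d * l := by
        have := hc.bigger.le
        gcongr
      linarith
    · exact g.symm
  have hw : ∀ y, ∃ w : EuclideanSpace ℝ (Fin d), y ∈ T → dist w (pt d x (REP y)) ≤ RHO y - σ ∧
      dist w (pt d XC a) ≤ 3 * σ := by
    intro y
    by_cases hy : y ∈ T
    · obtain ⟨hc, hρ⟩ := hT y hy
      obtain ⟨w, h1, h2⟩ := exists_point_towards (pt d x (REP y)) (pt d XC a)
        (s := RHO y - σ) (by linarith)
      refine ⟨w, fun _ => ⟨h1, h2.trans (max_le (by linarith) ?_)⟩⟩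
      have g2 := h.dist_centre_le hc.y_le (h.rep y hc.y_le)
      rw [hleaf y hy, zero_div, mul_zero] at g2
      rw [dist_le_zero.1 g2, dist_comm]
      have h3 := hc.near
      rw [Far, not_le, max_eq_left hc.bigger.le, h.rho_pos a ha hpos, ← hl] at h3
      linarith
    · exact ⟨0, fun g => absurd g hy⟩
  choose w hw using hw
  have hcount := card_mul_pow_le_of_separated T w (pt d XC a) (σ := σ) (R := 3 * σ)
    hτl (by linarith) (fun y hy => (hw y hy).2) ?_
  · have h2 : (T.card : ℝ) * σ ^ d ≤ 4 ^ d * σ ^ d := by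
      rw [← mul_pow]
      refine hcount.trans (le_of_eq ?_)
      congr 1
      ring
    exact le_of_mul_le_mul_right h2 (by positivity)
  · intro y hy y' hy' hne
    have hc := (hT y hy).1
    have hc' := (hT y' hy').1
    obtain ⟨j, hj, hs⟩ := hc.separated hc' h hne
    have hdis := h.disjoint_of_separated hj hs
    have hrne : REP y ≠ REP y' := fun g =>
      Finset.disjoint_left.1 hdis (h.rep y hc.y_le) (g ▸ h.rep y' hc'.y_le)
    have hap := h.apart _ (h.mem_lt hc.y_le (h.rep y hc.y_le)) _
      (h.mem_lt hc'.y_le (h.rep y' hc'.y_le)) hrne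
    rw [← h.rho_zero y hc.y_le (hleaf y hy), ← h.rho_zero y' hc'.y_le (hleaf y' hy')] at hap
    have h5 := dist_triangle4 (pt d x (REP y)) (w y) (w y') (pt d x (REP y'))
    rw [dist_comm (pt d x (REP y)) (w y)] at h5
    linarith [(hw y hy).1, (hw y' hy').1]

open Classical in
/-- The set of pairs that are inspected and split. -/
noncomputable def _root_.crossings (d J : ℕ) (S : ℕ → Finset ℕ) (P : ℕ → ℕ) (EL RHO : ℕ → ℝ)
    (XC : ℕ → ℕ → ℝ) (τ : ℝ) : Finset (ℕ × ℕ) :=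
  (Finset.range (2 * J + 1) ×ˢ Finset.range (2 * J + 1)).filter fun p =>
    Crossing d J S P EL RHO XC τ p.1 p.2

theorem _root_.mem_crossings {τ : ℝ} {p : ℕ × ℕ} :
    p ∈ crossings d J S P EL RHO XC τ ↔ Crossing d J S P EL RHO XC τ p.1 p.2 := by
  simp only [crossings, Finset.mem_filter, Finset.mem_product, Finset.mem_range]
  exact ⟨And.right, fun h => ⟨⟨by have := h.a_le; omega, by have := h.y_le; omega⟩, h⟩⟩

/-- There are `2 * J + 1 ≤ 2 * n` choices of the bigger node, and the two packing bounds apply to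
its partners. -/
theorem card_crossings_le (h : FairTree d n x J S P kap mid EL RHO XC REP) {τ : ℝ}
    (hτ : 18 * d ≤ τ) (hd : 0 < d) :
    ((crossings d J S P EL RHO XC τ).card : ℝ) ≤ 2 * n * ((13 * τ) ^ d + 4 ^ d) := by
  classical
  set T := crossings d J S P EL RHO XC τ
  have hmaps : ∀ p ∈ T, p.1 ∈ Finset.range (2 * J + 1) := fun p hp => by
    have := (mem_crossings.1 hp).a_le
    simp
    omega
  have hfib : ∀ a, ((T.filter fun p => p.1 = a).card : ℝ) ≤ (13 * τ) ^ d + 4 ^ d := by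
    intro a
    have hinj : Set.InjOn Prod.snd (↑(T.filter fun p => p.1 = a) : Set (ℕ × ℕ)) := by
      intro p hp q hq hpq
      rw [Finset.mem_coe, Finset.mem_filter] at hp hq
      exact Prod.ext (hp.2.trans hq.2.symm) hpq
    rw [← Finset.card_image_of_injOn hinj]
    set U := (T.filter fun p => p.1 = a).image Prod.snd
    have hU : ∀ y ∈ U, Crossing d J S P EL RHO XC τ a y := by
      intro y hy
      simp only [U, Finset.mem_image, Finset.mem_filter] at hy
      obtain ⟨p, ⟨hp, rfl⟩, rfl⟩ := hy
      exact mem_crossings.1 hp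
    rw [← Finset.card_filter_add_card_filter_not (s := U) fun y => RHO y ≤ τ * EL a]
    push_cast
    refine add_le_add (h.card_crossing_small hτ hd a _ fun y hy => ?_)
      (h.card_crossing_big hτ hd a _ fun y hy => ?_)
    · rw [Finset.mem_filter] at hy
      exact ⟨hU y hy.1, hy.2⟩
    · rw [Finset.mem_filter, not_le] at hy
      exact ⟨hU y hy.1, hy.2⟩
  have h0 : (0 : ℝ) ≤ (13 * τ) ^ d + 4 ^ d := (Nat.cast_nonneg _).trans (hfib 0)
  rw [Finset.card_eq_sum_card_fiberwise (f := Prod.fst) (t := Finset.range (2 * J + 1)) hmaps]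
  push_cast
  refine (Finset.sum_le_sum fun a _ => hfib a).trans ?_
  rw [Finset.sum_const, Finset.card_range, nsmul_eq_mul]
  refine mul_le_mul_of_nonneg_right ?_ h0
  have := h.J_lt
  exact_mod_cast (show 2 * J + 1 ≤ 2 * n by omega)

end FairTree

/-! ### From approximating edges to spanners -/

section Spanner

variable {ι X : Type*} [MetricSpace X]

theorem walkLength_append (G : SimpleGraph ι) (p : ι → X) {i j k : ι} (v : G.Walk i j)
    (w : G.Walk j k) : walkLength G p (v.append w) = walkLength G p v + walkLength G p w := by
  simp [walkLength]

theorem graphDist_self (G : SimpleGraph ι) (p : ι → X) (i : ι) : graphDist G p i i = 0 :=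
  nonpos_iff_eq_zero.1 ((iInf_le _ SimpleGraph.Walk.nil).trans (by simp [walkLength]))

theorem graphDist_adj (G : SimpleGraph ι) (p : ι → X) {i j : ι} (h : G.Adj i j) :
    graphDist G p i j ≤ edist (p i) (p j) :=
  (iInf_le _ h.toWalk).trans (by simp [walkLength, SimpleGraph.Adj.toWalk])

theorem graphDist_triangle (G : SimpleGraph ι) (p : ι → X) (i j k : ι) :
    graphDist G p i k ≤ graphDist G p i j + graphDist G p j k := by
  simp only [graphDist]
  refine ENNReal.le_iInf_add_iInf fun v w => ?_
  rw [← walkLength_append]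
  exact iInf_le _ _

/-- If every pair of points is approximated by an edge, then the graph is a spanner. -/
theorem graphDist_le_of_approx [Finite ι] (G : SimpleGraph ι) (p : ι → X) {t : ℝ} (ht : 1 < t)
    (ht2 : t ≤ 2) (happ : ∀ i j, p i ≠ p j → ∃ i' j', G.Adj i' j' ∧
      dist (p i) (p i') ≤ (t - 1) / 6 * dist (p i) (p j) ∧
      dist (p j') (p j) ≤ (t - 1) / 6 * dist (p i) (p j)) (hp : Function.Injective p) (i j : ι) :
    graphDist G p i j ≤ ENNReal.ofReal (t * dist (p i) (p j)) := by
  -- Induction on the distance of the two points; there are finitely many pairs, so the order by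
  -- distance is well-founded.
  let f : ι × ι → ℝ := fun a => dist (p a.1) (p a.2)
  let r : ι × ι → ι × ι → Prop := fun a b => f a < f b
  have : IsTrans (ι × ι) r := ⟨fun _ _ _ => lt_trans⟩
  have : Std.Irrefl r := ⟨fun a => lt_irrefl (f a)⟩
  have wf : WellFounded r := Finite.wellFounded_of_trans_of_irrefl r
  suffices H : ∀ a : ι × ι, graphDist G p a.1 a.2 ≤ ENNReal.ofReal (t * dist (p a.1) (p a.2)) from
    H (i, j)
  intro a
  induction a using wf.induction with
  | _ a ih =>
    obtain ⟨i, j⟩ := a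
    by_cases hij : p i = p j
    · rw [hp hij, graphDist_self]
      exact zero_le
    · obtain ⟨i', j', hadj, h1, h2⟩ := happ i j hij
      have hpos : 0 < dist (p i) (p j) := dist_pos.2 hij
      set D := dist (p i) (p j) with hD
      have hε : (t - 1) / 6 * D < D := by nlinarith
      have e1 := ih (i, i') (show f (i, i') < f (i, j) from h1.trans_lt hε)
      have e2 := ih (j', j) (show f (j', j) < f (i, j) from h2.trans_lt hε)
      have e3 := graphDist_adj G p hadj
      rw [edist_dist] at e3
      have hmid : dist (p i') (p j') ≤ D + 2 * ((t - 1) / 6 * D) := by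
        have := dist_triangle4 (p i') (p i) (p j) (p j')
        rw [dist_comm (p i') (p i), dist_comm (p j) (p j')] at this
        linarith
      calc graphDist G p i j ≤ graphDist G p i i' + (graphDist G p i' j' + graphDist G p j' j) :=
            (graphDist_triangle G p i i' j).trans
              (add_le_add le_rfl (graphDist_triangle G p i' j' j))
        _ ≤ ENNReal.ofReal (t * dist (p i) (p i')) + (ENNReal.ofReal (dist (p i') (p j')) +
              ENNReal.ofReal (t * dist (p j') (p j))) := add_le_add e1 (add_le_add e3 e2)
        _ = ENNReal.ofReal (t * dist (p i) (p i') + (dist (p i') (p j') +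
              t * dist (p j') (p j))) := by
            rw [← ENNReal.ofReal_add, ← ENNReal.ofReal_add] <;> positivity
        -- With `ε = (t - 1) / 6` and `t ≤ 2` the path has length at most `2 * (2 * ε * D) + (1 + 2
        -- * ε) * D = (1 + 6 * ε) * D = t * D`.
        _ ≤ ENNReal.ofReal (t * D) := by
            refine ENNReal.ofReal_le_ofReal ?_
            have g1 : t * dist (p i) (p i') ≤ t * ((t - 1) / 6 * D) :=
              mul_le_mul_of_nonneg_left h1 (by linarith)
            have g2 : t * dist (p j') (p j) ≤ t * ((t - 1) / 6 * D) :=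
              mul_le_mul_of_nonneg_left h2 (by linarith)
            have g3 : t * ((t - 1) / 6 * D) ≤ 2 * ((t - 1) / 6 * D) :=
              mul_le_mul_of_nonneg_right ht2 (by nlinarith)
            nlinarith

theorem IsSpanner.of_graphDist_le (G : SimpleGraph ι) (p : ι → X) {t t' : ℝ} (ht : t' ≤ t)
    (h : ∀ i j, graphDist G p i j ≤ ENNReal.ofReal (t' * dist (p i) (p j))) (h0 : 0 ≤ t') :
    IsSpanner t G p := by
  intro i j _
  refine ENNReal.div_le_of_le_mul ((h i j).trans ?_)
  rw [edist_dist, ← ENNReal.ofReal_mul (h0.trans ht)]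
  exact ENNReal.ofReal_le_ofReal (mul_le_mul_of_nonneg_right ht dist_nonneg)

end Spanner

namespace FairTree

variable {d n : ℕ} {x : ℕ → ℕ → ℝ} {J : ℕ} {S : ℕ → Finset ℕ} {P kap : ℕ → ℕ}
  {mid EL RHO : ℕ → ℝ} {XC : ℕ → ℕ → ℝ} {REP : ℕ → ℕ}

/-- In an internal node each ball is disjoint from another one of the node, so its radius is at most
the distance of the centres, hence at most `d * EL u`; the centre is within `d * EL u / 2` of the
box centre. This is where disjointness controls arbitrary radii. -/
theorem dist_region_le (h : FairTree d n x J S P kap mid EL RHO XC REP)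
    {p : ℕ → EuclideanSpace ℝ (Fin d)} (hp : ∀ i < n, dist (p i) (pt d x i) ≤ x d i) {u i : ℕ}
    (hu : u ≤ 2 * J) (hi : i ∈ S u) : dist (p i) (pt d XC u) ≤ RHO u := by
  have hin := h.mem_lt hu hi
  have h1 := h.dist_centre_le hu hi
  have h2 := dist_triangle (p i) (pt d x i) (pt d XC u)
  have h3 := hp i hin
  rcases (h.box u hu).nonneg.lt_or_eq with g | g
  · have : ∃ i' ∈ S u, i ≠ i' := by
      obtain ⟨j, hj, rfl⟩ := h.internal u hu g
      obtain ⟨a, ha, b, hb, hab, -⟩ := h.tree.split j hj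
      by_cases hia : i = a
      · refine ⟨b, hb, ?_⟩
        rintro rfl
        rw [hia, sub_self] at hab
        linarith
      · exact ⟨a, ha, hia⟩
    obtain ⟨i', hi', hne⟩ := this
    have h4 := h.apart i hin i' (h.mem_lt hu hi') hne
    have h5 := h.radius i' (h.mem_lt hu hi')
    have h6 : dist (pt d x i) (pt d x i') ≤ d * EL u := by
      refine dist_le_mul_of_abs_le _ _ g.le fun k => ?_
      rw [abs_le]
      have g1 := (h.box u hu).ext k k.2 i hi i' hi'
      have g2 := (h.box u hu).ext k k.2 i' hi' i hi
      simp only [pt]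
      constructor <;> linarith
    rw [h.rho_pos u hu g]
    linarith
  · rw [← g, zero_div, mul_zero] at h1
    rw [h.rho_zero u hu g.symm, h.eq_of_el_eq_zero hu g.symm (h.rep u hu) hi]
    linarith

theorem dist_same_node_le (h : FairTree d n x J S P kap mid EL RHO XC REP)
    {p : ℕ → EuclideanSpace ℝ (Fin d)} (hp : ∀ i < n, dist (p i) (pt d x i) ≤ x d i) {u i j : ℕ}
    (hu : u ≤ 2 * J) (hi : i ∈ S u) (hj : j ∈ S u) : dist (p i) (p j) ≤ 3 * d * EL u := by
  rcases (h.box u hu).nonneg.lt_or_eq with g | g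
  · have h1 := h.dist_region_le hp hu hi
    have h2 := h.dist_region_le hp hu hj
    have h3 := dist_triangle_right (p i) (p j) (pt d XC u)
    rw [h.rho_pos u hu g] at h1 h2
    linarith
  · rw [h.eq_of_el_eq_zero hu g.symm hi hj, dist_self, ← g, mul_zero]

/-- Points of a far pair have distance at least `18 * d / (t - 1)` times the larger side, whereas
points of one node are within `3 * d` times its side; the quotient is `(t - 1) / 6`. A leaf costs
nothing: its only point belongs to the representative. -/
theorem approx (h : FairTree d n x J S P kap mid EL RHO XC REP)
    {p : ℕ → EuclideanSpace ℝ (Fin d)} (hp : ∀ i < n, dist (p i) (pt d x i) ≤ x d i) {t : ℝ}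
    (ht : 1 < t) {u v : ℕ} (hu : u ≤ 2 * J) (hv : v ≤ 2 * J)
    (hfar : Far d EL RHO XC (18 * d / (t - 1)) u v) {i j : ℕ} (hi : i ∈ S u) (hj : j ∈ S v) :
    dist (p i) (p (REP u)) ≤ (t - 1) / 6 * dist (p i) (p j) ∧
      dist (p (REP v)) (p j) ≤ (t - 1) / 6 * dist (p i) (p j) := by
  have h1 := h.dist_region_le hp hu hi
  have h2 := h.dist_region_le hp hv hj
  have h3 := dist_triangle4 (pt d XC u) (p i) (p j) (pt d XC v)
  rw [dist_comm (pt d XC u) (p i)] at h3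
  rw [Far] at hfar
  have h4 : 18 * d / (t - 1) * max (EL u) (EL v) ≤ dist (p i) (p j) := by linarith
  have h5 : 3 * d * max (EL u) (EL v) ≤ (t - 1) / 6 * dist (p i) (p j) := by
    refine le_trans (le_of_eq ?_) (mul_le_mul_of_nonneg_left h4 (show 0 ≤ (t - 1) / 6 by linarith))
    have : t - 1 ≠ 0 := by linarith
    field_simp
    ring
  constructor
  · refine (h.dist_same_node_le hp hu hi (h.rep u hu)).trans (le_trans ?_ h5)
    have := le_max_left (EL u) (EL v)
    gcongr
  · refine (h.dist_same_node_le hp hv (h.rep v hv) hj).trans (le_trans ?_ h5)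
    have := le_max_right (EL u) (EL v)
    gcongr

end FairTree

/-! ### The queue of pairs of nodes -/

theorem Covers.swap {S : ℕ → Finset ℕ} {u v i j : ℕ} (h : Covers S u v i j) :
    Covers S v u i j := Or.symm (h.imp And.symm And.symm)

theorem Covers.symm {S : ℕ → Finset ℕ} {u v i j : ℕ} (h : Covers S u v i j) :
    Covers S u v j i := Or.symm h

theorem Covers.mono {S : ℕ → Finset ℕ} {u v u' v' i j : ℕ} (h : Covers S u v i j)
    (hu : S u ⊆ S u') (hv : S v ⊆ S v') : Covers S u' v' i j :=
  h.imp (fun g => ⟨hu g.1, hv g.2⟩) fun g => ⟨hu g.1, hv g.2⟩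

/-- The pair `a`, `y` of nodes descends from the pair `u`, `v`. -/
def Under (S : ℕ → Finset ℕ) (u v : ℕ) (p : ℕ × ℕ) : Prop :=
  S p.1 ⊆ S u ∧ S p.2 ⊆ S v ∨ S p.2 ⊆ S u ∧ S p.1 ⊆ S v

theorem Under.swap {S : ℕ → Finset ℕ} {u v : ℕ} {p : ℕ × ℕ} (h : Under S u v p) :
    Under S v u p := Or.symm (h.imp And.symm And.symm)

theorem Under.mono {S : ℕ → Finset ℕ} {u v u' v' : ℕ} {p : ℕ × ℕ} (h : Under S u v p)
    (hu : S u ⊆ S u') (hv : S v ⊆ S v') : Under S u' v' p :=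
  h.imp (fun g => ⟨g.1.trans hu, g.2.trans hv⟩) fun g => ⟨g.1.trans hu, g.2.trans hv⟩

/-- The pairs of nodes that occur in the queue. -/
structure GoodPair (J : ℕ) (S : ℕ → Finset ℕ) (P : ℕ → ℕ) (EL : ℕ → ℝ) (u v : ℕ) : Prop where
  u_pos : 1 ≤ u
  u_le : u ≤ 2 * J
  v_pos : 1 ≤ v
  v_le : v ≤ 2 * J
  disj : Disjoint (S u) (S v)
  par_v : Bigger EL (P ((v - 1) / 2)) u
  par_u : Bigger EL (P ((u - 1) / 2)) v

theorem GoodPair.symm {J : ℕ} {S : ℕ → Finset ℕ} {P : ℕ → ℕ} {EL : ℕ → ℝ} {u v : ℕ}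
    (h : GoodPair J S P EL u v) : GoodPair J S P EL v u :=
  ⟨h.v_pos, h.v_le, h.u_pos, h.u_le, h.disj.symm, h.par_u, h.par_v⟩

/-- The entries `head, …, tail - 1` of the queue of pairs `(QU k, QV k)` are pending; the edges
for the earlier ones that are far apart have been output. -/
structure PairQueue (d n J : ℕ) (S : ℕ → Finset ℕ) (P : ℕ → ℕ) (EL RHO : ℕ → ℝ)
    (XC : ℕ → ℕ → ℝ) (REP : ℕ → ℕ) (τ : ℝ) (head tail : ℕ) (QU QV : ℕ → ℕ)
    (out : List (ℕ × ℕ)) : Prop where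
  head_le : head ≤ tail
  good : ∀ k < tail, GoodPair J S P EL (QU k) (QV k)
  cover : ∀ i < n, ∀ j < n, i ≠ j → ∃ k < tail,
    (head ≤ k ∨ Far d EL RHO XC τ (QU k) (QV k)) ∧ Covers S (QU k) (QV k) i j
  unique : ∀ k < tail, ∀ l < tail, (head ≤ k ∨ Far d EL RHO XC τ (QU k) (QV k)) →
    (head ≤ l ∨ Far d EL RHO XC τ (QU l) (QV l)) → ∀ i j, Covers S (QU k) (QV k) i j →
      Covers S (QU l) (QV l) i j → k = l
  out_of_far : ∀ k < head, Far d EL RHO XC τ (QU k) (QV k) →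
    s(REP (QU k), REP (QV k)) ∈ out.map fun e => s(e.1, e.2)
  far_of_out : ∀ m ∈ out.map fun e => s(e.1, e.2), ∃ k < head, Far d EL RHO XC τ (QU k) (QV k) ∧
    m = s(REP (QU k), REP (QV k))
  nodup : (out.map fun e => s(e.1, e.2)).Nodup
  length : out.length ≤ head
  count : ∀ N : Finset (ℕ × ℕ), (∀ p, p ∈ N ↔ p ∈ crossings d J S P EL RHO XC τ ∧
    ∃ k, head ≤ k ∧ k < tail ∧ Under S (QU k) (QV k) p) →
      tail + 2 * N.card ≤ J + 2 * (crossings d J S P EL RHO XC τ).card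

namespace FairTree

variable {d n : ℕ} {x : ℕ → ℕ → ℝ} {J : ℕ} {S : ℕ → Finset ℕ} {P kap : ℕ → ℕ}
  {mid EL RHO : ℕ → ℝ} {XC : ℕ → ℕ → ℝ} {REP : ℕ → ℕ} {τ : ℝ} {head tail : ℕ} {QU QV : ℕ → ℕ}
  {out : List (ℕ × ℕ)}

theorem bigger_child (h : FairTree d n x J S P kap mid EL RHO XC REP) {u v : ℕ}
    (hc : IsChild J P u v) : Bigger EL u v := by
  have hlt := h.child_lt hc
  have hv := hc.eq_par.2.2
  rcases (h.el_mono (by omega) hv (h.child_subset hc)).lt_or_eq with g | g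
  · exact Or.inl g
  · exact Or.inr ⟨g.symm, hlt⟩

theorem queue_init (h : FairTree d n x J S P kap mid EL RHO XC REP)
    (hU : ∀ j < J, QU j = 2 * j + 1) (hV : ∀ j < J, QV j = 2 * j + 2) :
    PairQueue d n J S P EL RHO XC REP τ 0 J QU QV [] where
  head_le := Nat.zero_le _
  good k hk := by
    have e1 : (2 * k + 1 - 1) / 2 = k := by omega
    have e2 : (2 * k + 2 - 1) / 2 = k := by omega
    rw [hU k hk, hV k hk]
    refine ⟨by omega, by omega, by omega, by omega, h.disjoint_children hk, ?_, ?_⟩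
    · rw [e2]
      exact h.bigger_child ⟨k, hk, rfl, Or.inl rfl⟩
    · rw [e1]
      exact h.bigger_child ⟨k, hk, rfl, Or.inr rfl⟩
  cover i hi j hj hne := by
    obtain ⟨a, ha, hc⟩ := h.exists_split_covers hi hj hne
    exact ⟨a, ha, Or.inl (Nat.zero_le _), by rwa [hU a ha, hV a ha]⟩
  unique k hk l hl _ _ i j hc hc' := by
    rw [hU k hk, hV k hk] at hc
    rw [hU l hl, hV l hl] at hc'
    exact h.split_covers_unique hk hl hc hc'
  out_of_far k hk := absurd hk (Nat.not_lt_zero _)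
  far_of_out := by simp
  nodup := by simp
  length := by simp
  count N hN := by
    have : N.card ≤ (crossings d J S P EL RHO XC τ).card :=
      Finset.card_le_card fun p hp => ((hN p).1 hp).1
    omega

/-- The field `count` quantifies over all finite sets with the given members, so that no choice of
decidability enters its statement; here it is applied to the filtered set. -/
theorem _root_.PairQueue.tail_le (hq : PairQueue d n J S P EL RHO XC REP τ head tail QU QV out) :
    tail ≤ J + 2 * (crossings d J S P EL RHO XC τ).card := by
  classical
  have := hq.count ((crossings d J S P EL RHO XC τ).filter fun p =>
    ∃ k, head ≤ k ∧ k < tail ∧ Under S (QU k) (QV k) p) fun p => by rw [Finset.mem_filter]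
  omega

theorem covers_rep (h : FairTree d n x J S P kap mid EL RHO XC REP) {u v : ℕ}
    (hg : GoodPair J S P EL u v) : Covers S u v (REP u) (REP v) :=
  Or.inl ⟨h.rep u hg.u_le, h.rep v hg.v_le⟩

/-- No edge is repeated: two far pairs with the same representatives would both cover these
representatives, against uniqueness. -/
theorem queue_emit (h : FairTree d n x J S P kap mid EL RHO XC REP)
    (hq : PairQueue d n J S P EL RHO XC REP τ head tail QU QV out) (hlt : head < tail)
    (hfar : Far d EL RHO XC τ (QU head) (QV head)) {e : ℕ × ℕ}
    (he : s(e.1, e.2) = s(REP (QU head), REP (QV head))) :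
    PairQueue d n J S P EL RHO XC REP τ (head + 1) tail QU QV (e :: out) where
  head_le := hlt
  good := hq.good
  cover i hi j hj hne := by
    obtain ⟨k, hk, hkept, hc⟩ := hq.cover i hi j hj hne
    refine ⟨k, hk, ?_, hc⟩
    rcases hkept with g | g
    · rcases g.lt_or_eq with g | rfl
      · exact Or.inl g
      · exact Or.inr hfar
    · exact Or.inr g
  unique k hk l hl gk gl := hq.unique k hk l hl (gk.imp_left fun g => by omega)
    (gl.imp_left fun g => by omega)
  out_of_far k hk hf := by
    rw [List.map_cons, List.mem_cons]
    rcases Nat.lt_succ_iff_lt_or_eq.1 hk with g | rfl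
    · exact Or.inr (hq.out_of_far k g hf)
    · exact Or.inl he.symm
  far_of_out m hm := by
    rw [List.map_cons, List.mem_cons] at hm
    rcases hm with rfl | hm
    · exact ⟨head, Nat.lt_succ_self _, hfar, he⟩
    · obtain ⟨k, hk, hf, hm⟩ := hq.far_of_out m hm
      exact ⟨k, Nat.lt_succ_of_lt hk, hf, hm⟩
  nodup := by
    rw [List.map_cons, List.nodup_cons]
    refine ⟨fun hm => ?_, hq.nodup⟩
    obtain ⟨k, hk, hf, hm⟩ := hq.far_of_out _ hm
    have hc := h.covers_rep (hq.good k (hk.trans hlt))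
    have hc' := h.covers_rep (hq.good head hlt)
    rw [he, Sym2.eq_iff] at hm
    have : Covers S (QU k) (QV k) (REP (QU head)) (REP (QV head)) := by
      rcases hm with ⟨g1, g2⟩ | ⟨g1, g2⟩
      · rw [g1, g2]
        exact hc
      · rw [g1, g2]
        exact hc.symm
    have := hq.unique k (hk.trans hlt) head hlt (Or.inr hf) (Or.inl le_rfl) _ _ this hc'
    omega
  length := by
    have := hq.length
    simpa using this
  count N hN := by
    classical
    refine le_trans ?_ (hq.count ((crossings d J S P EL RHO XC τ).filter fun p =>
      ∃ k, head ≤ k ∧ k < tail ∧ Under S (QU k) (QV k) p) fun p => by rw [Finset.mem_filter])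
    have : N ⊆ (crossings d J S P EL RHO XC τ).filter fun p =>
        ∃ k, head ≤ k ∧ k < tail ∧ Under S (QU k) (QV k) p := by
      intro p hp
      obtain ⟨h1, k, h2, h3, h4⟩ := (hN p).1 hp
      exact Finset.mem_filter.2 ⟨h1, k, by omega, h3, h4⟩
    have := Finset.card_le_card this
    omega

/-- The two new pairs take over exactly what the pair at the head covered. The queue grows by two,
and the crossing `(P j, v)` disappears from those still ahead, which balances `count`. -/
theorem queue_split (h : FairTree d n x J S P kap mid EL RHO XC REP)
    (hq : PairQueue d n J S P EL RHO XC REP τ head tail QU QV out) (hlt : head < tail)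
    (hnear : ¬ Far d EL RHO XC τ (QU head) (QV head)) {j v : ℕ} (hj : j < J)
    (huv : P j = QU head ∧ v = QV head ∨ P j = QV head ∧ v = QU head) (hb : Bigger EL (P j) v)
    {QU' QV' : ℕ → ℕ} (hU : ∀ k < tail, QU' k = QU k) (hV : ∀ k < tail, QV' k = QV k)
    (hU0 : QU' tail = 2 * j + 1) (hU1 : QU' (tail + 1) = 2 * j + 2) (hV0 : QV' tail = v)
    (hV1 : QV' (tail + 1) = v) :
    PairQueue d n J S P EL RHO XC REP τ (head + 1) (tail + 2) QU' QV' out := by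
  have hgood : GoodPair J S P EL (P j) v := by
    have := hq.good head hlt
    rcases huv with ⟨h1, h2⟩ | ⟨h1, h2⟩ <;> rw [h1, h2]
    · exact this
    · exact this.symm
  have hcov : ∀ {a b}, Covers S (P j) v a b → Covers S (QU head) (QV head) a b := by
    rcases huv with ⟨h1, h2⟩ | ⟨h1, h2⟩ <;> rw [h1, h2]
    · exact id
    · exact Covers.swap
  have hcov' : ∀ {a b}, Covers S (QU head) (QV head) a b → Covers S (P j) v a b := by
    rcases huv with ⟨h1, h2⟩ | ⟨h1, h2⟩ <;> rw [h1, h2]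
    · exact id
    · exact Covers.swap
  have hund : ∀ {p}, Under S (P j) v p → Under S (QU head) (QV head) p := by
    rcases huv with ⟨h1, h2⟩ | ⟨h1, h2⟩ <;> rw [h1, h2]
    · exact id
    · exact Under.swap
  have hfar : ¬ Far d EL RHO XC τ (P j) v := by
    rcases huv with ⟨h1, h2⟩ | ⟨h1, h2⟩ <;> rw [h1, h2]
    · exact hnear
    · exact fun g => hnear g.symm
  have c1 : IsChild J P (P j) (2 * j + 1) := ⟨j, hj, rfl, Or.inl rfl⟩
  have c2 : IsChild J P (P j) (2 * j + 2) := ⟨j, hj, rfl, Or.inr rfl⟩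
  have s1 := h.child_subset c1
  have s2 := h.child_subset c2
  have hdc := Finset.disjoint_left.1 (h.disjoint_children hj)
  have hdv := Finset.disjoint_left.1 hgood.disj
  have hgc : ∀ c, IsChild J P (P j) c → GoodPair J S P EL c v := fun c hc =>
    ⟨hc.eq_par.2.1, hc.eq_par.2.2, hgood.v_pos, hgood.v_le,
      hgood.disj.mono_left (h.child_subset hc), hgood.par_v.trans (h.bigger_child hc),
      hc.eq_par.1 ▸ hb⟩
  have old : ∀ k, k < tail → (head + 1 ≤ k ∨ Far d EL RHO XC τ (QU' k) (QV' k)) →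
      (head ≤ k ∨ Far d EL RHO XC τ (QU k) (QV k)) ∧ k ≠ head := by
    intro k hk hkept
    rw [hU k hk, hV k hk] at hkept
    refine ⟨hkept.imp_left fun g => by omega, ?_⟩
    rintro rfl
    rcases hkept with g | g
    · omega
    · exact hnear g
  have new : ∀ k, tail ≤ k → k < tail + 2 → k = tail ∨ k = tail + 1 := fun k _ _ => by omega
  have newcov : ∀ k, tail ≤ k → k < tail + 2 → ∀ a b, Covers S (QU' k) (QV' k) a b →
      Covers S (QU head) (QV head) a b := by
    intro k h1 h2 a b hc
    rcases new k h1 h2 with rfl | rfl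
    · rw [hU0, hV0] at hc
      exact hcov (hc.mono s1 subset_rfl)
    · rw [hU1, hV1] at hc
      exact hcov (hc.mono s2 subset_rfl)
  have excl : ∀ a b, Covers S (2 * j + 1) v a b → ¬ Covers S (2 * j + 2) v a b := by
    rintro a b (⟨h1, h2⟩ | ⟨h1, h2⟩) (⟨h3, h4⟩ | ⟨h3, h4⟩)
    · exact hdc h1 h3
    · exact hdv (s2 h3) h2
    · exact hdv (s2 h3) h2
    · exact hdc h1 h3
  constructor
  · have := hq.head_le
    omega
  · intro k hk
    rcases Nat.lt_or_ge k tail with g | g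
    · rw [hU k g, hV k g]
      exact hq.good k g
    · rcases new k g hk with rfl | rfl
      · rw [hU0, hV0]
        exact hgc _ c1
      · rw [hU1, hV1]
        exact hgc _ c2
  · intro a ha b hb hne
    obtain ⟨k, hk, hkept, hc⟩ := hq.cover a ha b hb hne
    by_cases hkh : k = head
    · subst hkh
      have : Covers S (2 * j + 1) v a b ∨ Covers S (2 * j + 2) v a b := by
        have key : ∀ e ∈ S (P j), e ∈ S (2 * j + 1) ∨ e ∈ S (2 * j + 2) := by
          intro e he
          rw [h.mem_low hj, h.mem_high hj]
          rcases lt_or_ge (x (kap j) e) (mid j) with g | g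
          · exact Or.inl ⟨he, g⟩
          · exact Or.inr ⟨he, g⟩
        rcases hcov' hc with ⟨h1, h2⟩ | ⟨h1, h2⟩
        · exact (key _ h1).imp (fun g => Or.inl ⟨g, h2⟩) fun g => Or.inl ⟨g, h2⟩
        · exact (key _ h1).imp (fun g => Or.inr ⟨g, h2⟩) fun g => Or.inr ⟨g, h2⟩
      rcases this with g | g
      · exact ⟨tail, by omega, Or.inl hlt, by rwa [hU0, hV0]⟩
      · exact ⟨tail + 1, by omega, Or.inl (by omega), by rwa [hU1, hV1]⟩
    · refine ⟨k, by omega, ?_, by rwa [hU k hk, hV k hk]⟩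
      rw [hU k hk, hV k hk]
      exact hkept.imp_left fun g => by omega
  -- An older kept pair and a new pair cannot cover the same elements: the old head would cover them
  -- too, against uniqueness before the step.
  · have mixed : ∀ k < tail, ∀ l, tail ≤ l → l < tail + 2 →
        (head + 1 ≤ k ∨ Far d EL RHO XC τ (QU' k) (QV' k)) → ∀ a b,
        Covers S (QU' k) (QV' k) a b → ¬ Covers S (QU' l) (QV' l) a b := by
      intro k hk l h1 h2 hkept a b hc hc'
      obtain ⟨g1, g2⟩ := old k hk hkept
      rw [hU k hk, hV k hk] at hc
      exact g2 (hq.unique k hk head hlt g1 (Or.inl le_rfl) a b hc (newcov l h1 h2 a b hc'))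
    intro k hk l hl gk gl a b hc hc'
    rcases Nat.lt_or_ge k tail with hk' | hk' <;> rcases Nat.lt_or_ge l tail with hl' | hl'
    · rw [hU k hk', hV k hk'] at hc
      rw [hU l hl', hV l hl'] at hc'
      exact hq.unique k hk' l hl' (old k hk' gk).1 (old l hl' gl).1 a b hc hc'
    · exact absurd hc' (mixed k hk' l hl' hl gk a b hc)
    · exact absurd hc (mixed l hl' k hk' hk gl a b hc')
    · rcases new k hk' hk with rfl | rfl <;> rcases new l hl' hl with rfl | rfl
      · rfl
      · rw [hU0, hV0] at hc
        rw [hU1, hV1] at hc'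
        exact absurd hc' (excl a b hc)
      · rw [hU1, hV1] at hc
        rw [hU0, hV0] at hc'
        exact absurd hc (excl a b hc')
      · rfl
  · intro k hk hf
    have hkt : k < tail := by omega
    have hne : k ≠ head := by
      rintro rfl
      rw [hU k hkt, hV k hkt] at hf
      exact hnear hf
    rw [hU k hkt, hV k hkt] at hf ⊢
    exact hq.out_of_far k (by omega) hf
  · intro m hm
    obtain ⟨k, hk, hf, hm⟩ := hq.far_of_out m hm
    refine ⟨k, by omega, ?_⟩
    rw [hU k (by omega), hV k (by omega)]
    exact ⟨hf, hm⟩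
  · exact hq.nodup
  · have := hq.length
    omega
  · classical
    intro N hN
    set L := (crossings d J S P EL RHO XC τ).filter fun p =>
      ∃ k, head ≤ k ∧ k < tail ∧ Under S (QU k) (QV k) p with hL
    have hcount := hq.count L fun p => by rw [hL, Finset.mem_filter]
    have hmem : (P j, v) ∈ L := by
      rw [hL, Finset.mem_filter]
      exact ⟨mem_crossings.2 ⟨hgood.u_le, hgood.v_pos, hgood.v_le, hgood.disj, hgood.par_v, hb,
        hfar⟩, head, le_rfl, hlt, hund (Or.inl ⟨subset_rfl, subset_rfl⟩)⟩
    have hru := h.rep _ hgood.u_le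
    have hrv := h.rep _ hgood.v_le
    -- The crossing `(P j, v)` does not descend from another pending pair, since that pair would
    -- cover the representatives of `P j` and `v` as the head does. Nor does it descend from a new
    -- pair: `S (P j)` is not inside one child, because the sibling is nonempty, nor inside the
    -- disjoint set `S v`.
    have hsub : N ⊆ L.erase (P j, v) := by
      intro p hp
      obtain ⟨hp1, k, hk1, hk2, hk3⟩ := (hN p).1 hp
      rw [Finset.mem_erase, hL, Finset.mem_filter]
      rcases Nat.lt_or_ge k tail with hk | hk
      · rw [hU k hk, hV k hk] at hk3
        refine ⟨?_, hp1, k, by omega, hk, hk3⟩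
        rintro rfl
        have hc : Covers S (QU k) (QV k) (REP (P j)) (REP v) :=
          hk3.imp (fun g => ⟨g.1 hru, g.2 hrv⟩) fun g => ⟨g.1 hrv, g.2 hru⟩
        have := hq.unique k hk head hlt (Or.inl (by omega)) (Or.inl le_rfl) _ _ hc
          (hcov (h.covers_rep hgood))
        omega
      · have hc : ∃ c, IsChild J P (P j) c ∧ Under S c v p ∧ ¬ S (P j) ⊆ S c := by
          rcases new k hk hk2 with rfl | rfl
          · rw [hU0, hV0] at hk3
            refine ⟨_, c1, hk3, fun g => ?_⟩
            have := h.rep _ c2.eq_par.2.2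
            exact hdc (g (s2 this)) this
          · rw [hU1, hV1] at hk3
            refine ⟨_, c2, hk3, fun g => ?_⟩
            have := h.rep _ c1.eq_par.2.2
            exact hdc this (g (s1 this))
        obtain ⟨c, hc, hun, hns⟩ := hc
        refine ⟨?_, hp1, head, le_rfl, hlt, hund (hun.mono (h.child_subset hc) subset_rfl)⟩
        rintro rfl
        rcases hun with ⟨g1, -⟩ | ⟨-, g2⟩
        · exact hns g1
        · exact hdv hru (g2 hru)
    have h1 := Finset.card_le_card hsub
    have h2 := Finset.card_erase_add_one hmem
    omega

end FairTree

/-! ### The program that processes the pairs -/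

namespace RealRAM

/-- Load the pair at the head of the queue, the bigger node first. -/
def loadPair (d : ℕ) : Cmd :=
  .seq (.setN 23 (.read 6 (.reg 21))) <| .seq (.setN 24 (.read 7 (.reg 21))) <|
  .ite (.and (.not (.rlt (.read (d + 1) (.reg 23)) (.read (d + 1) (.reg 24))))
      (.not (.and (.not (.rlt (.read (d + 1) (.reg 24)) (.read (d + 1) (.reg 23))))
        (.nlt (.reg 24) (.reg 23)))))
    .skip
    (.seq (.setN 25 (.reg 23)) (.seq (.setN 23 (.reg 24)) (.setN 24 (.reg 25))))

/-- Ties between equal side lengths are broken by the index, exactly as in `Bigger`. -/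
theorem loadPair_spec {d : ℕ} {s : State} {a b : ℕ} (ha : s.narr 6 (s.nreg 21) = a)
    (hb : s.narr 7 (s.nreg 21) = b) (hne : a ≠ b) :
    Run (loadPair d) s fun s' c => ((s'.nreg 23 = a ∧ s'.nreg 24 = b ∨
      s'.nreg 23 = b ∧ s'.nreg 24 = a) ∧ Bigger (s.rarr (d + 1)) (s'.nreg 23) (s'.nreg 24) ∧
      c ≤ 40) ∧ Frame (loadPair d) s s' := by
  refine Run.frame ?_
  have key : ¬ s.rarr (d + 1) a < s.rarr (d + 1) b ∧
      ¬ (¬ s.rarr (d + 1) b < s.rarr (d + 1) a ∧ b < a) ↔ Bigger (s.rarr (d + 1)) a b := by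
    rw [Bigger]
    constructor
    · rintro ⟨h1, h2⟩
      rcases lt_or_eq_of_le (not_lt.1 h1) with g | g
      · exact Or.inl g
      · refine Or.inr ⟨g.symm, ?_⟩
        have : ¬ b < a := fun hlt => h2 ⟨by rw [g]; exact lt_irrefl _, hlt⟩
        omega
    · rintro (h | ⟨h1, h2⟩)
      · exact ⟨h.le.not_gt, fun g => g.1 h⟩
      · exact ⟨by rw [h1]; exact lt_irrefl _, fun g => by omega⟩
  simp only [loadPair, run_seq, run_setN, run_ite, run_skip, Test.Holds, NExp.eval, RExp.eval,
    NExp.cost, RExp.cost, Test.cost, Function.update_self, ne_eq, OfNat.ofNat_eq_ofNat,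
    Nat.reduceEqDiff, not_false_eq_true, Function.update_of_ne, ha, hb, key]
  refine ⟨fun h => ⟨Or.inl ⟨trivial, trivial⟩, h, by norm_num⟩,
    fun h => ⟨Or.inr ⟨trivial, trivial⟩, ?_, by norm_num⟩⟩
  exact (Bigger.or hne).resolve_left h

/-- The square of the distance of the box centres of the two nodes. -/
def centreDist (d : ℕ) : Cmd :=
  .seq (.setR 6 (.const 0)) (forK d fun k => .setR 6 (.add (.reg 6)
    (.mul (.sub (.read (d + 3 + k) (.reg 23)) (.read (d + 3 + k) (.reg 24)))
      (.sub (.read (d + 3 + k) (.reg 23)) (.read (d + 3 + k) (.reg 24))))))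

theorem centreDist_spec {d : ℕ} {s : State} {u v : ℕ} (hu : s.nreg 23 = u) (hv : s.nreg 24 = v) :
    Run (centreDist d) s fun s' c => (s'.rreg 6 = dist (pt d (fun k => s.rarr (d + 3 + k)) u)
      (pt d (fun k => s.rarr (d + 3 + k)) v) ^ 2 ∧ c ≤ 20 * d + 10) ∧
      Frame (centreDist d) s s' := by
  refine Run.frame ?_
  rw [centreDist, run_seq, run_setR]
  refine (Run.forK (fun j s' => s'.rreg 6 = ∑ k ∈ Finset.range j,
    (s.rarr (d + 3 + k) u - s.rarr (d + 3 + k) v) * (s.rarr (d + 3 + k) u - s.rarr (d + 3 + k) v))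
    (fun _ => 0) 20 ?_ ?_).mono ?_
  · simp
  · rintro k s' hk hF hI
    have e1 : s'.nreg = s.nreg := funext fun y => hF.n y (by simp)
    have e2 : s'.rarr = s.rarr := funext fun y => hF.ra y (by simp)
    simp [hI, e1, e2, hu, hv, Finset.sum_range_succ]
  · rintro s' c ⟨⟨h1, h2⟩, hF⟩
    refine ⟨?_, ?_⟩
    · rw [h1, dist_pt_sq]
    · simp
      omega

/-- Inspect the pair at the head of the queue. -/
def pairStep (d : ℕ) : Cmd :=
  .seq (loadPair d) <| .seq (centreDist d) <|
  .seq (.setR 7 (.add (.add (.read (d + 2) (.reg 23)) (.read (d + 2) (.reg 24)))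
    (.mul (.reg 1) (.read (d + 1) (.reg 23))))) <|
  .seq (.ite (.rlt (.reg 6) (.mul (.reg 7) (.reg 7)))
    (.seq (.writeN 6 (.reg 22) (.read 4 (.reg 23))) <|
     .seq (.writeN 7 (.reg 22) (.reg 24)) <|
     .seq (.writeN 6 (.add (.reg 22) (.const 1)) (.add (.read 4 (.reg 23)) (.const 1))) <|
     .seq (.writeN 7 (.add (.reg 22) (.const 1)) (.reg 24))
      (.setN 22 (.add (.reg 22) (.const 2))))
    (.emit (.read 5 (.reg 23)) (.read 5 (.reg 24))))
  (.setN 21 (.add (.reg 21) (.const 1)))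

/-- The queue of pairs in memory. -/
def QueueInv (d n J : ℕ) (S : ℕ → Finset ℕ) (P : ℕ → ℕ) (s₀ s : State) : Prop :=
  PairQueue d n J S P (s₀.rarr (d + 1)) (s₀.rarr (d + 2)) (fun k => s₀.rarr (d + 3 + k))
    (s₀.narr 5) (s₀.rreg 1) (s.nreg 21) (s.nreg 22) (s.narr 6) (s.narr 7) s.out

theorem pairStep_spec {d n J : ℕ} {x : ℕ → ℕ → ℝ} {S : ℕ → Finset ℕ} {P kap : ℕ → ℕ}
    {mid : ℕ → ℝ} {s₀ s : State}
    (h : FairTree d n x J S P kap mid (s₀.rarr (d + 1)) (s₀.rarr (d + 2))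
      (fun k => s₀.rarr (d + 3 + k)) (s₀.narr 5))
    (hch : ∀ j < J, s₀.narr 4 (P j) = 2 * j + 1) (hτ : 0 ≤ s₀.rreg 1)
    (e1 : s.rreg 1 = s₀.rreg 1) (e2 : s.rarr = s₀.rarr) (e4 : s.narr 4 = s₀.narr 4)
    (e5 : s.narr 5 = s₀.narr 5) (hq : QueueInv d n J S P s₀ s) (hlt : s.nreg 21 < s.nreg 22) :
    Run (pairStep d) s fun s' c => QueueInv d n J S P s₀ s' ∧ s'.nreg 21 = s.nreg 21 + 1 ∧
      c ≤ 20 * d + 110 := by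
  set EL := s₀.rarr (d + 1) with hEL
  set RHO := s₀.rarr (d + 2) with hRHO
  set XC : ℕ → ℕ → ℝ := fun k => s₀.rarr (d + 3 + k) with hXC
  set REP := s₀.narr 5 with hREP
  set τ := s₀.rreg 1 with hτ'
  set a := s.narr 6 (s.nreg 21) with ha
  set b := s.narr 7 (s.nreg 21) with hb
  have hg : GoodPair J S P EL a b := hq.good _ hlt
  have hne : a ≠ b := by
    intro g
    have := h.rep a hg.u_le
    exact Finset.disjoint_left.1 hg.disj this (g ▸ this)
  refine Run.of_forall fun R hR => ?_
  rw [pairStep, run_seq]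
  refine (loadPair_spec ha.symm hb.symm hne).mono ?_
  rintro s₁ c₁ ⟨⟨hab, hbig, hc₁⟩, hF₁⟩
  set u := s₁.nreg 23 with hu
  set v := s₁.nreg 24 with hv
  rw [e2] at hbig
  rw [run_seq]
  refine (centreDist_spec hu.symm hv.symm).mono ?_
  rintro s₂ c₂ ⟨⟨hD, hc₂⟩, hF₂⟩
  have r₁ : s₁.rarr = s.rarr := funext fun y => hF₁.ra y (by simp [loadPair])
  have r₂ : s₂.rarr = s.rarr := (funext fun y => hF₂.ra y (by simp [centreDist])).trans r₁
  have na₁ : s₂.narr = s.narr := (funext fun y => hF₂.na y (by simp [centreDist])).trans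
    (funext fun y => hF₁.na y (by simp [loadPair]))
  have n2 : s₂.nreg = s₁.nreg := funext fun y => hF₂.n y (by simp [centreDist])
  have n21 : s₂.nreg 21 = s.nreg 21 := by rw [n2]; exact hF₁.n 21 (by simp [loadPair])
  have n22 : s₂.nreg 22 = s.nreg 22 := by rw [n2]; exact hF₁.n 22 (by simp [loadPair])
  have n23 : s₂.nreg 23 = u := by rw [n2]
  have n24 : s₂.nreg 24 = v := by rw [n2]
  have t1 : s₂.rreg 1 = τ := by
    rw [hF₂.r 1 (by simp [centreDist]), hF₁.r 1 (by simp [loadPair]), e1]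
  have o2 : s₂.out = s.out := by
    rw [hF₂.out (by simp [centreDist]), hF₁.out (by simp [loadPair])]
  rw [r₁, e2] at hD
  have hgood : GoodPair J S P EL u v := by
    rcases hab with ⟨h1, h2⟩ | ⟨h1, h2⟩ <;> rw [h1, h2]
    · exact hg
    · exact hg.symm
  -- The machine has no square roots, so squares are compared; this is legitimate as both sides are
  -- nonnegative. The larger side is that of `u`.
  have hfar : s₂.rreg 6 < (RHO u + RHO v + τ * EL u) * (RHO u + RHO v + τ * EL u) ↔
      ¬ Far d EL RHO XC τ u v := by
    have h0 : 0 ≤ RHO u + RHO v + τ * EL u := by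
      have h1 := h.rho_nonneg hgood.u_le
      have h2 := h.rho_nonneg hgood.v_le
      have h3 := mul_nonneg hτ (h.box u hgood.u_le).nonneg
      linarith
    rw [Far, not_le, max_eq_left hbig.le, hD, ← sq]
    exact pow_lt_pow_iff_left₀ dist_nonneg h0 two_ne_zero
  have hfar' : Far d EL RHO XC τ u v ↔ Far d EL RHO XC τ a b := by
    rcases hab with ⟨h1, h2⟩ | ⟨h1, h2⟩ <;> rw [h1, h2]
    exact ⟨Far.symm, Far.symm⟩
  simp only [run_seq, run_setR, run_ite, run_writeN, run_setN, run_emit, Test.Holds, NExp.eval,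
    RExp.eval, NExp.cost, RExp.cost, Test.cost, Function.update_self, ne_eq, Nat.reduceEqDiff,
    not_false_eq_true, Function.update_of_ne, n21, n22, n23, n24, t1, na₁, r₂, o2, e2, e4, e5,
    OfNat.ofNat_eq_ofNat, ← hEL, ← hRHO, ← hREP, hfar]
  constructor
  · intro hnear
    refine hR _ _ ⟨?_, ?_, ?_⟩
    · have hpos : 0 < EL u := by
        by_contra hn
        have h1 := (h.box u hgood.u_le).nonneg
        have h2 := (h.box v hgood.v_le).nonneg
        have := hbig.le
        exact hnear (h.far_of_el_eq_zero hgood.u_le hgood.v_le hgood.disj (by linarith)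
          (by linarith))
      obtain ⟨j, hj, hPj⟩ := h.internal u hgood.u_le hpos
      have hchu : s₀.narr 4 u = 2 * j + 1 := hPj ▸ hch j hj
      have := h.queue_split (QU' := Function.update (Function.update (s.narr 6) (s.nreg 22)
          (2 * j + 1)) (s.nreg 22 + 1) (2 * j + 2))
        (QV' := Function.update (Function.update (s.narr 7) (s.nreg 22) v) (s.nreg 22 + 1) v)
        hq hlt (fun g => hnear (hfar'.2 g)) hj (v := v)
        (by rw [hPj]; tauto) (by rw [hPj]; exact hbig) ?_ ?_ ?_ ?_ ?_ ?_
      · simpa [QueueInv, hchu] using this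
      · intro k hk
        rw [Function.update_of_ne (by omega), Function.update_of_ne (by omega)]
      · intro k hk
        rw [Function.update_of_ne (by omega), Function.update_of_ne (by omega)]
      · rw [Function.update_of_ne (by omega), Function.update_self]
      · rw [Function.update_self]
      · rw [Function.update_of_ne (by omega), Function.update_self]
      · rw [Function.update_self]
    · simp [n21]
    · omega
  · intro hf
    rw [not_not] at hf
    refine hR _ _ ⟨?_, by simp [n21], by omega⟩
    have := h.queue_emit (e := (REP u, REP v)) hq hlt (hfar'.1 hf) (by
      rcases hab with ⟨h1, h2⟩ | ⟨h1, h2⟩ <;> rw [h1, h2]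
      exact Sym2.eq_swap)
    simpa [QueueInv, n22] using this

/-- Inspect all pairs. -/
def pairLoop (d : ℕ) : Cmd := .loop (.nlt (.reg 21) (.reg 22)) (pairStep d)

/-- Every step advances the head by one, and the tail never passes the bound in `PairQueue.tail_le`.
-/
theorem pairLoop_spec {d n J : ℕ} {x : ℕ → ℕ → ℝ} {S : ℕ → Finset ℕ} {P kap : ℕ → ℕ}
    {mid : ℕ → ℝ} {s : State}
    (h : FairTree d n x J S P kap mid (s.rarr (d + 1)) (s.rarr (d + 2))
      (fun k => s.rarr (d + 3 + k)) (s.narr 5))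
    (hch : ∀ j < J, s.narr 4 (P j) = 2 * j + 1) (hτ : 0 ≤ s.rreg 1)
    (hq : QueueInv d n J S P s s) :
    Run (pairLoop d) s fun s' c => QueueInv d n J S P s s' ∧ s'.nreg 21 = s'.nreg 22 ∧
      c ≤ (20 * d + 114) * (J + 2 * (crossings d J S P (s.rarr (d + 1)) (s.rarr (d + 2))
        (fun k => s.rarr (d + 3 + k)) (s.rreg 1)).card) + 4 := by
  set M := J + 2 * (crossings d J S P (s.rarr (d + 1)) (s.rarr (d + 2))
        (fun k => s.rarr (d + 3 + k)) (s.rreg 1)).card with hM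
  refine (Run.loop (fun s' => QueueInv d n J S P s s')
    (fun s' => (20 * d + 114) * (M - s'.nreg 21)) hq ?_).mono ?_
  · intro s' hF hI hb
    simp only [Test.Holds, NExp.eval] at hb
    refine (pairStep_spec h hch hτ (hF.r 1 (by simp [pairStep, loadPair, centreDist]))
      (funext fun y => hF.ra y (by simp [pairStep, loadPair, centreDist]))
      (hF.na 4 (by simp [pairStep, loadPair, centreDist]))
      (hF.na 5 (by simp [pairStep, loadPair, centreDist])) hI hb).mono ?_
    rintro s'' c ⟨h1, h2, h3⟩
    refine ⟨h1, ?_⟩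
    have ht := hI.tail_le
    rw [h2, show M - s'.nreg 21 = (M - (s'.nreg 21 + 1)) + 1 by omega, Nat.mul_add]
    simp
    omega
  · rintro s' c ⟨⟨h1, h2, h3⟩, -⟩
    simp only [Test.Holds, NExp.eval] at h2
    have h4 := h1.head_le
    refine ⟨h1, by omega, ?_⟩
    have h5 : (20 * d + 114) * (M - s.nreg 21) ≤ (20 * d + 114) * M := by
      gcongr
      omega
    simp at h3
    omega

end RealRAM

/-! ### Assembling the algorithm -/

namespace RealRAM

theorem Core.fairTree {d n : ℕ} {x : ℕ → ℕ → ℝ} {J : ℕ} {s : State} {S : ℕ → Finset ℕ}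
    {P kap : ℕ → ℕ} {mid : ℕ → ℝ} (h : Core d n x (J + 1) J s S P kap mid)
    (hap : ∀ i < n, ∀ j < n, i ≠ j → x d i + x d j < dist (pt d x i) (pt d x j))
    (hr : ∀ i < n, 0 ≤ x d i) :
    FairTree d n x J S P kap mid (s.rarr (d + 1)) (s.rarr (d + 2))
      (fun k => s.rarr (d + 3 + k)) (s.narr 5) := by
  have hdata : ∀ u ≤ 2 * J, NodeData d x s u (S u) := by
    intro u hu
    rcases h.nodes u hu with ⟨j, hj, rfl⟩ | ⟨l, hl, rfl⟩
    · exact h.dataP j hj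
    · exact (h.dataL l (by omega) hl).1
  refine ⟨h.tree, ?_, h.root, fun u hu => (hdata u hu).rep, fun u hu => (hdata u hu).box,
    fun u hu => (hdata u hu).rho_pos, fun u hu => (hdata u hu).rho_zero, ?_, hap, hr⟩
  -- The `J + 1` leaves have pairwise different representatives among the `n` balls.
  · have : (Finset.range (J + 1)).card ≤ (Finset.range n).card := by
      refine Finset.card_le_card_of_injOn (fun l => s.narr 5 (s.narr 3 l)) ?_ ?_
      · intro l hl
        have hl' : l ≤ J := by simpa [Nat.lt_succ_iff] using hl
        have := (hdata _ (h.front_le l hl')).rep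
        rw [h.front l hl', mem_labelled] at this
        simpa using this.1
      · intro l hl l' hl' he
        have hl2 : l ≤ J := by simpa [Nat.lt_succ_iff] using hl
        have hl2' : l' ≤ J := by simpa [Nat.lt_succ_iff] using hl'
        have g := (hdata _ (h.front_le l hl2)).rep
        have g' := (hdata _ (h.front_le l' hl2')).rep
        rw [h.front l hl2, mem_labelled] at g
        rw [h.front l' hl2', mem_labelled] at g'
        simp only at he
        rw [← he] at g'
        exact g.2.symm.trans g'.2
    simpa using this
  · intro u hu hpos
    rcases h.nodes u hu with g | ⟨l, hl, rfl⟩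
    · exact g
    · have := (h.dataL l (by omega) hl).2
      rw [this] at hpos
      exact absurd hpos (lt_irrefl _)

/-- Sort the centres along all coordinate axes. -/
def sortAll (d : ℕ) : Cmd := forK d fun k => sortDim (2 * k + 20) k

theorem sortAll_frame {d : ℕ} {s s' : State} (h : Frame (sortAll d) s s') :
    (∀ a < 14, s'.nreg a = s.nreg a) ∧ (∀ a < 10, s'.narr a = s.narr a) ∧ s'.rarr = s.rarr ∧
      s'.rreg = s.rreg ∧ s'.out = s.out := by
  refine ⟨fun a ha => h.n a ?_, fun a ha => h.na a ?_, funext fun a => h.ra a ?_,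
    funext fun a => h.r a ?_, h.out ?_⟩ <;>
    simp [sortAll, sortDim, mergeRound, mergeLoop, copyLoop] <;> omega

theorem sortAll_spec {d n : ℕ} {s : State} (r0 : s.nreg 0 = n) :
    Run (sortAll d) s fun s' c =>
      ((∀ k < d, Seg (s.rarr k) (s'.narr (2 * k + 20)) 0 n {e | e < n}) ∧
        c ≤ d * (120 * ((n + 1) * (Nat.clog 2 n + 1))) + 1) ∧ Frame (sortAll d) s s' := by
  refine (Run.forK (fun j s' => ∀ k < j, Seg (s.rarr k) (s'.narr (2 * k + 20)) 0 n {e | e < n})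
    (fun _ => 0) (120 * ((n + 1) * (Nat.clog 2 n + 1))) (by simp) ?_).mono ?_
  · intro k s₁ hk hF hI
    obtain ⟨fn, -, fr, -, -⟩ := sortAll_frame hF
    refine (sortDim_spec (a := 2 * k + 20) (k := k) (n := n) (by omega)
      ((fn 0 (by norm_num)).trans r0)).mono ?_
    rintro s₂ c ⟨⟨h1, h2⟩, hF₂⟩
    refine ⟨fun k' hk' => ?_, by omega⟩
    rcases Nat.lt_succ_iff_lt_or_eq.1 hk' with g | rfl
    · rw [hF₂.na _ (by simp [sortDim, mergeRound, mergeLoop, copyLoop]; omega)]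
      exact hI k' g
    · rwa [fr] at h1
  · rintro s' c ⟨⟨h1, h2⟩, hF⟩
    exact ⟨⟨h1, by omega⟩, hF⟩

/-- List the edges of a spanner of at least two balls. -/
def listSpanner (d : ℕ) : Cmd :=
  .seq (.ite (.rlt (.const 2) (.reg 0)) (.setR 1 (.const (18 * d)))
    (.setR 1 (.div (.const (18 * d)) (.sub (.reg 0) (.const 1))))) <|
  .seq (sortAll d) <| .seq (.writeN 2 (.const 0) (.reg 0)) <| .seq (treeLoop d) <|
  .seq (.setN 21 (.const 0)) <| .seq (.setN 22 (.reg 1)) (pairLoop d)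

theorem treeLoop_frame {d : ℕ} {s s' : State} (h : Frame (treeLoop d) s s') :
    s'.rreg 1 = s.rreg 1 ∧ s'.out = s.out := by
  refine ⟨h.r 1 ?_, h.out ?_⟩ <;>
  simp [treeLoop, processList, openList, heavyLoop, heavyStep, computeBox, boxDim, splitNode,
    finishLeaf, splitDim, scanLoop, labelLoop, trim, skipLoops, distribute]

/-- All labels, the root index and the start of the first segment are `0`, the initial content of
the memory; only the size of the first list had to be written. -/
theorem outer_init {d n : ℕ} {s : State} {x : ℕ → ℕ → ℝ} (hn : 0 < n) (r0 : s.nreg 0 = n)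
    (r1 : s.nreg 1 = 0) (r2 : s.nreg 2 = 0) (hx : s.rarr = x)
    (h0 : ∀ e, s.narr 0 e = 0) (h1 : s.narr 1 0 = 0) (h2 : s.narr 2 0 = n) (h3 : s.narr 3 0 = 0)
    (hseg : ∀ k < d, Seg (x k) (s.narr (2 * k + 20)) 0 n {e | e < n}) : Outer d n x 0 s := by
  have hl : labelled n (s.narr 0) 0 = Finset.range n := by
    ext e
    simp [mem_labelled, h0]
  have z : ∀ {l}, l ≤ 0 → l = 0 := fun h => Nat.le_zero.1 h
  refine ⟨⟨fun _ => Finset.range n, id, id, fun _ => 0, ?_⟩, Nat.zero_le _, ?_, ?_⟩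
  · rw [r1]
    refine ⟨r0, r1, r2, fun k _ => congrFun hx k, ⟨?_, ?_, ?_, ?_, ?_, ?_⟩, rfl,
      fun e _ => (h0 e).le, ?_, fun _ _ => ⟨0, by simpa using hn⟩, ?_, ?_, ?_, ?_, ?_, ?_, ?_⟩
    any_goals exact fun j hj => absurd hj (Nat.not_lt_zero _)
    · intro l h
      obtain rfl := z h
      exact hl.symm
    · intro l h
      obtain rfl := z h
      exact h3.le
    · intro u h
      obtain rfl := z h
      exact Or.inr ⟨0, le_rfl, h3⟩
  · intro l _ h
    rw [r1] at h
    obtain rfl := z h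
    rw [h2, hl, Finset.card_range]
  · intro l _ h k hk
    rw [r1] at h
    obtain rfl := z h
    rw [h1, h2, Nat.zero_add]
    simpa [h0] using hseg k hk

theorem listSpanner_spec {d n : ℕ} (hd : 0 < d) (hn : 0 < n) {s : State} (r0 : s.nreg 0 = n)
    (r1 : s.nreg 1 = 0) (r2 : s.nreg 2 = 0) (hna : ∀ a i, s.narr a i = 0) (ho : s.out = [])
    (ht : 1 < s.rreg 0)
    (hap : ∀ i < n, ∀ j < n, i ≠ j →
      s.rarr d i + s.rarr d j < dist (pt d s.rarr i) (pt d s.rarr j))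
    (hr : ∀ i < n, 0 ≤ s.rarr d i) :
    Run (listSpanner d) s fun s' c => ∃ J S P kap mid EL RHO XC REP QU QV head,
      FairTree d n s.rarr J S P kap mid EL RHO XC REP ∧
      PairQueue d n J S P EL RHO XC REP (18 * d / (min (s.rreg 0) 2 - 1)) head head QU QV s'.out ∧
      c ≤ (100 * (d * d) + 800 * d + 900) * ((n + 1) * (Nat.clog 2 n + 1)) +
        (20 * d + 114) * (2 * (crossings d J S P EL RHO XC
          (18 * d / (min (s.rreg 0) 2 - 1))).card) := by
  set τ := 18 * d / (min (s.rreg 0) 2 - 1) with hτ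
  have hτ0 : 0 ≤ τ := by
    have : 1 < min (s.rreg 0) 2 := lt_min ht (by norm_num)
    have : 0 < min (s.rreg 0) 2 - 1 := by linarith
    positivity
  set W := (n + 1) * (Nat.clog 2 n + 1) with hW
  refine Run.of_forall fun R hR => ?_
  rw [listSpanner, run_seq]
  have hfirst : Run (.ite (.rlt (.const 2) (.reg 0)) (.setR 1 (.const (18 * d)))
      (.setR 1 (.div (.const (18 * d)) (.sub (.reg 0) (.const 1))))) s
      fun s' c => s' = { s with rreg := Function.update s.rreg 1 τ } ∧ c ≤ 20 := by
    simp only [run_ite, run_setR, Test.Holds, RExp.eval, RExp.cost, Test.cost]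
    push_cast
    constructor <;> intro h
    · refine ⟨?_, by norm_num⟩
      rw [hτ, min_eq_right h.le]
      norm_num
    · refine ⟨?_, by norm_num⟩
      rw [hτ, min_eq_left (not_lt.1 h)]
  refine hfirst.mono ?_
  rintro s₁ c₁ ⟨rfl, hc₁⟩
  rw [run_seq]
  refine (sortAll_spec (by exact r0)).mono ?_
  rintro s₂ c₂ ⟨⟨hseg, hc₂⟩, hF₂⟩
  obtain ⟨fn, fna, fr, frr, fo⟩ := sortAll_frame hF₂
  simp only at fn fna fr frr fo hseg
  rw [run_seq, run_writeN, run_seq]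
  set s₃ : State := { s₂ with narr := Function.update s₂.narr 2 (Function.update (s₂.narr 2)
    (NExp.eval s₂ (NExp.const 0)) (NExp.eval s₂ (NExp.reg 0))) }
  have e1 : s₃.nreg 1 = 0 := (fn 1 (by norm_num)).trans r1
  have e22 : s₃.narr 2 0 = n := by
    simp [s₃, fn, r0]
  have hout : Outer d n s.rarr 0 s₃ := by
    refine outer_init hn ((fn 0 (by norm_num)).trans r0) e1 ((fn 2 (by norm_num)).trans r2) fr
      (fun e => ?_) ?_ e22 ?_ fun k hk => ?_
    · simp [s₃, fna, hna]
    · simp [s₃, fna, hna]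
    · simp [s₃, fna, hna]
    · have : 2 * k + 20 ≠ 2 := by omega
      simpa [s₃, this] using hseg k hk
  refine (treeLoop_spec hd hout).frame.mono ?_
  rintro s₄ c₄ ⟨⟨⟨J, S, P, kap, mid, hcore⟩, hc₄⟩, hF₄⟩
  obtain ⟨g1, g2⟩ := treeLoop_frame hF₄
  have hcr : credits 0 s₃ = credit n := by
    rw [credits, e1]
    simp [e22]
  rw [hcr] at hc₄
  simp only [run_seq, run_setN]
  set s₅ : State := ⟨Function.update (Function.update s₄.nreg 21 0) 22
    (Function.update s₄.nreg 21 0 1), s₄.rreg, s₄.narr, s₄.rarr, s₄.out⟩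
  have hs1 : s₅.nreg 1 = J := by simpa [s₅] using hcore.r1
  have hτ5 : s₅.rreg 1 = τ := by
    change s₄.rreg 1 = τ
    rw [g1]
    change s₂.rreg 1 = τ
    rw [frr]
    simp
  have ho5 : s₅.out = [] := by
    change s₄.out = []
    rw [g2]
    change s₂.out = []
    rw [fo, ho]
  have hT := hcore.fairTree hap hr
  -- The queue is already filled: each split has entered its pair of children, so the tail starts at
  -- `J`.
  have hq : QueueInv d n J S P s₅ s₅ := by
    have : s₅.nreg 22 = J := by simpa [s₅] using hcore.r1
    rw [QueueInv, this, ho5]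
    have h21 : s₅.nreg 21 = 0 := by simp [s₅]
    rw [h21]
    exact hT.queue_init (fun j hj => (hcore.child j hj).2.1) fun j hj => (hcore.child j hj).2.2
  refine (pairLoop_spec (s := s₅) (J := J) (n := n) (S := S) (P := P) (kap := kap) (mid := mid)
    (x := s.rarr) hT (fun j hj => (hcore.child j hj).1) (by rw [hτ5]; exact hτ0) hq).mono ?_
  rintro s₆ c₆ ⟨h1, h2, h3⟩
  rw [QueueInv, h2, hτ5] at h1
  rw [hτ5] at h3
  refine hR _ _ ⟨J, S, P, kap, mid, _, _, _, _, _, _, _, hT, h1, ?_⟩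
  change c₆ ≤ (20 * d + 114) * (J + 2 * (crossings d J S P (s₄.rarr (d + 1)) (s₄.rarr (d + 2))
    (fun k => s₄.rarr (d + 3 + k)) τ).card) + 4 at h3
  set N := (crossings d J S P (s₄.rarr (d + 1)) (s₄.rarr (d + 2))
    (fun k => s₄.rarr (d + 3 + k)) τ).card
  have hJ := hT.J_lt
  have hnW : n + 1 ≤ W := Nat.le_mul_of_pos_right _ (by omega)
  have hcW : credit n ≤ W := by
    rw [credit, hW]
    have := Nat.log_le_clog 2 n
    gcongr
    omega
  have k1 : (20 * d + 114) * (J + 2 * N) ≤ (20 * d + 114) * W + (20 * d + 114) * (2 * N) := by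
    rw [← Nat.mul_add]
    gcongr
    omega
  have k2 : (100 * (d * d) + 600 * d + 600) * credit n ≤ (100 * (d * d) + 600 * d + 600) * W := by
    gcongr
  have k3 : d * (120 * W) = 120 * d * W := by ring
  have k4 : (100 * (d * d) + 800 * d + 900) * W = 60 * (d * W) + 120 * d * W +
    (100 * (d * d) + 600 * d + 600) * W + (20 * d + 114) * W + 186 * W := by ring
  rw [k4]
  rw [k3] at hc₂
  simp only [NExp.cost]
  omega

/-- List the edges of a spanner. -/
def spanner (d : ℕ) : Cmd := .ite (.nlt (.const 1) (.reg 0)) (listSpanner d) .skip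

end RealRAM

/-! ### Numerical estimates and the main theorem -/

/-- For `n ≥ 2`, `n + 1 ≤ 2 * n`, and `clog n + 1 ≤ 3/2 * log n + 2 ≤ 9/2 * log n` because `log n ≥
log 2 > 2/3`. -/
theorem sort_cost_le {n : ℕ} (hn : 2 ≤ n) :
    (((n + 1) * (Nat.clog 2 n + 1) : ℕ) : ℝ) ≤ 9 * (n * Real.log n) := by
  have hn2 : (2 : ℝ) ≤ n := by exact_mod_cast hn
  have hl2 := Real.log_two_gt_d9
  have hln : Real.log 2 ≤ Real.log n := Real.log_le_log (by norm_num) hn2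
  have h1 : (Nat.clog 2 n : ℝ) ≤ Real.log n / Real.log 2 + 1 := by
    rw [← Real.natCeil_logb_natCast 2 n]
    have h0 : 0 ≤ Real.logb 2 n := Real.logb_nonneg (by norm_num) (by linarith)
    exact_mod_cast (Nat.ceil_lt_add_one h0).le
  have h2 : Real.log n / Real.log 2 ≤ 3 / 2 * Real.log n := by
    rw [div_le_iff₀ (by linarith)]
    nlinarith
  have h3 : (Nat.clog 2 n : ℝ) + 1 ≤ 9 / 2 * Real.log n := by linarith
  push_cast
  calc ((n : ℝ) + 1) * (Nat.clog 2 n + 1) ≤ (2 * n) * (9 / 2 * Real.log n) := by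
        gcongr
        linarith
    _ = 9 * (n * Real.log n) := by ring

theorem le_two_mul_log {n : ℕ} (hn : 2 ≤ n) : (n : ℝ) ≤ 2 * (n * Real.log n) := by
  have hn2 : (2 : ℝ) ≤ n := by exact_mod_cast hn
  have hl2 := Real.log_two_gt_d9
  have hln : Real.log 2 ≤ Real.log n := Real.log_le_log (by norm_num) hn2
  nlinarith

/-- Replacing `t` by `min t 2` costs at most the additive `1`, which becomes the summand `n` of the
bounds. -/
theorem one_div_min_pow_le (d : ℕ) {t : ℝ} (ht : 1 < t) :
    1 / (min t 2 - 1) ^ d ≤ 1 + 1 / (t - 1) ^ d := by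
  have h0 : 0 < 1 / (t - 1) ^ d := by
    have : 0 < t - 1 := by linarith
    positivity
  rcases le_total t 2 with h | h
  · rw [min_eq_left h]
    linarith
  · rw [min_eq_right h]
    norm_num
    simpa using h0.le

/-- The constant is `234 = 13 * 18`. -/
theorem crossing_bound_le (d n : ℕ) {t N : ℝ} (ht : 1 < t)
    (hN : N ≤ 2 * n * ((13 * (18 * d / (min t 2 - 1))) ^ d + 4 ^ d)) :
    N ≤ 2 * ((234 * d) ^ d + 4 ^ d) * (n + n / (t - 1) ^ d) := by
  have h1 := one_div_min_pow_le d ht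
  have h0 : 0 < 1 / (t - 1) ^ d := by
    have : 0 < t - 1 := by linarith
    positivity
  have e1 : (13 * (18 * d / (min t 2 - 1))) ^ d = (234 * (d : ℝ)) ^ d * (1 / (min t 2 - 1) ^ d) := by
    rw [← one_div_pow, ← mul_pow]
    congr 1
    ring
  rw [e1] at hN
  calc N ≤ _ := hN
    _ ≤ 2 * n * ((234 * d) ^ d * (1 + 1 / (t - 1) ^ d) + 4 ^ d * (1 + 1 / (t - 1) ^ d)) := by
        gcongr
        exact le_mul_of_one_le_right (by positivity) (by linarith)
    _ = _ := by ring

namespace FairTree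

variable {d n : ℕ} {x : ℕ → ℕ → ℝ} {J : ℕ} {S : ℕ → Finset ℕ} {P kap : ℕ → ℕ}
  {mid EL RHO : ℕ → ℝ} {XC : ℕ → ℕ → ℝ} {REP : ℕ → ℕ} {τ : ℝ} {head : ℕ} {QU QV : ℕ → ℕ}
  {out : List (ℕ × ℕ)}

/-- The graph whose edges are in the list. -/
def _root_.listGraph (n : ℕ) (out : List (ℕ × ℕ)) : SimpleGraph (Fin n) where
  Adj i j := i ≠ j ∧ s((i : ℕ), (j : ℕ)) ∈ out.map fun e => s(e.1, e.2)
  symm := ⟨fun i j h => ⟨h.1.symm, by rw [Sym2.eq_swap]; exact h.2⟩⟩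
  loopless := ⟨fun _ h => h.1 rfl⟩

theorem _root_.ncard_listGraph_le (n : ℕ) (out : List (ℕ × ℕ)) :
    (listGraph n out).edgeSet.ncard ≤ out.length := by
  classical
  rw [← Set.ncard_image_of_injective _ (Sym2.map.injective Fin.val_injective)]
  have hsub : Sym2.map Fin.val '' (listGraph n out).edgeSet ⊆
      ((out.map fun e => s(e.1, e.2)).toFinset : Set (Sym2 ℕ)) := by
    rintro _ ⟨m, hm, rfl⟩
    induction m using Sym2.ind with
    | _ i j =>
      rw [Finset.mem_coe, List.mem_toFinset]
      exact hm.2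
  calc _ ≤ ((out.map fun e => s(e.1, e.2)).toFinset : Set (Sym2 ℕ)).ncard :=
        Set.ncard_le_ncard hsub (Finset.finite_toSet _)
    _ ≤ out.length := by
        rw [Set.ncard_coe_finset]
        exact (List.toFinset_card_le _).trans (by simp)

theorem listsEdges (h : FairTree d n x J S P kap mid EL RHO XC REP)
    (hq : PairQueue d n J S P EL RHO XC REP τ head head QU QV out) :
    RealRAM.ListsEdges out (listGraph n out) := by
  refine ⟨hq.nodup, fun e he => ?_, fun i j hij => ?_⟩
  · have hm : s(e.1, e.2) ∈ out.map fun e => s(e.1, e.2) := List.mem_map_of_mem he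
    obtain ⟨k, hk, -, hk'⟩ := hq.far_of_out _ hm
    have hg := hq.good k hk
    have hu := h.rep _ hg.u_le
    have hv := h.rep _ hg.v_le
    have hne : REP (QU k) ≠ REP (QV k) := fun g =>
      Finset.disjoint_left.1 hg.disj hu (g ▸ hv)
    have hun := h.mem_lt hg.u_le hu
    have hvn := h.mem_lt hg.v_le hv
    have key : e.1 < n ∧ e.2 < n ∧ e.1 ≠ e.2 := by
      rcases Sym2.eq_iff.1 hk' with ⟨g1, g2⟩ | ⟨g1, g2⟩ <;> rw [g1, g2]
      · exact ⟨hun, hvn, hne⟩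
      · exact ⟨hvn, hun, hne.symm⟩
    exact ⟨⟨e.1, key.1⟩, ⟨e.2, key.2.1⟩, ⟨fun g => key.2.2 (congrArg Fin.val g), hm⟩, rfl⟩
  · obtain ⟨e, he, hem⟩ := List.mem_map.1 hij.2
    rcases Sym2.eq_iff.1 hem with ⟨g1, g2⟩ | ⟨g1, g2⟩
    · exact Or.inl (by rwa [← g1, ← g2])
    · exact Or.inr (by rwa [← g1, ← g2])

/-- The queue is empty, so the pair that covers `i` and `j` is far and has an edge in the list.
Disjointness of the balls makes the chosen points distinct. -/
theorem isSpanner (h : FairTree d n x J S P kap mid EL RHO XC REP) {t : ℝ} (ht : 1 < t)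
    (hq : PairQueue d n J S P EL RHO XC REP (18 * d / (min t 2 - 1)) head head QU QV out)
    {p : Fin n → EuclideanSpace ℝ (Fin d)} (hp : ∀ i, dist (p i) (pt d x i) ≤ x d i) :
    IsSpanner t (listGraph n out) p := by
  have ht' : 1 < min t 2 := lt_min ht (by norm_num)
  have hinj : Function.Injective p := by
    intro i j hij
    by_contra hne
    have h1 := h.apart i i.2 j j.2 fun g => hne (Fin.ext g)
    have h2 := dist_triangle_left (pt d x i) (pt d x j) (p i)
    have h3 := hp i
    have h4 := hp j
    rw [← hij] at h4
    linarith
  let q : ℕ → EuclideanSpace ℝ (Fin d) := fun i => if hi : i < n then p ⟨i, hi⟩ else 0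
  have hqp : ∀ i : Fin n, q i = p i := fun i => by simp [q]
  have hqd : ∀ i < n, dist (q i) (pt d x i) ≤ x d i := fun i hi => by
    rw [show q i = p ⟨i, hi⟩ from hqp ⟨i, hi⟩]
    exact hp ⟨i, hi⟩
  refine IsSpanner.of_graphDist_le _ p (min_le_left t 2)
    (graphDist_le_of_approx _ p ht' (min_le_right t 2) ?_ hinj) (by linarith)
  intro i j hij
  have hne : (i : ℕ) ≠ j := fun g => hij (congrArg p (Fin.ext g))
  obtain ⟨k, hk, hkept, hc⟩ := hq.cover i i.2 j j.2 hne
  have hfar := hkept.resolve_left (by omega)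
  have hg := hq.good k hk
  have hm := hq.out_of_far k hk hfar
  have hu := h.rep _ hg.u_le
  have hv := h.rep _ hg.v_le
  have hrne : REP (QU k) ≠ REP (QV k) := fun g =>
    Finset.disjoint_left.1 hg.disj hu (g ▸ hv)
  let a : Fin n := ⟨_, h.mem_lt hg.u_le hu⟩
  let b : Fin n := ⟨_, h.mem_lt hg.v_le hv⟩
  have hadj : (listGraph n out).Adj a b := ⟨fun g => hrne (congrArg Fin.val g), hm⟩
  have ha : q (REP (QU k)) = p a := hqp a
  have hb : q (REP (QV k)) = p b := hqp b
  rcases hc with ⟨h1, h2⟩ | ⟨h1, h2⟩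
  · obtain ⟨g1, g2⟩ := h.approx hqd ht' hg.u_le hg.v_le hfar h1 h2
    rw [ha, hqp, hqp] at g1
    rw [hb, hqp, hqp] at g2
    exact ⟨a, b, hadj, g1, g2⟩
  · obtain ⟨g1, g2⟩ := h.approx hqd ht' hg.u_le hg.v_le hfar h1 h2
    rw [ha, hqp, hqp, dist_comm, dist_comm (p j)] at g1
    rw [hb, hqp, hqp, dist_comm, dist_comm (p j)] at g2
    exact ⟨b, a, hadj.symm, g2, g1⟩

end FairTree

theorem edge_count_le {e n N F B X Y : ℝ} (he : e ≤ n + 2 * N) (hN : N ≤ B * F) (hn : n ≤ F)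
    (hF : 0 ≤ F) (hX : 0 ≤ X) (hY : 0 ≤ Y) : e ≤ (10 + 2 * B + 9 * X + 4 * Y) * F := by
  have h1 := mul_nonneg hX hF
  have h2 := mul_nonneg hY hF
  linarith

theorem time_le {k W N n L D B X Y : ℝ} (hk : k ≤ X * W + Y * (2 * N)) (hW : W ≤ 9 * L)
    (hN : N ≤ B * (n + D)) (hn : n ≤ 2 * L) (hL : 0 ≤ L) (hD : 0 ≤ D) (hB : 0 ≤ B) (hX : 0 ≤ X)
    (hY : 0 ≤ Y) : k + 5 ≤ (10 + 2 * B + 9 * X + 4 * (Y * B)) * (1 + L + D) := by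
  have h1 : X * W ≤ X * (9 * L) := mul_le_mul_of_nonneg_left hW hX
  have h2 : Y * (2 * N) ≤ Y * (2 * (B * (2 * L + D))) := by
    have : B * (n + D) ≤ B * (2 * L + D) := mul_le_mul_of_nonneg_left (by linarith) hB
    exact mul_le_mul_of_nonneg_left (by linarith) hY
  have p1 := mul_nonneg hX hD
  have p2 := mul_nonneg (mul_nonneg hY hB) hD
  have p3 := mul_nonneg hB hL
  have p4 := mul_nonneg hB hD
  have p5 := mul_nonneg hY hB
  linarith

theorem mainTheorem2 (d : ℕ) :
    ∃ (C : ℝ) (P : RealRAM.Cmd),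
      ∀ (n : ℕ) (c : Fin n → EuclideanSpace ℝ (Fin d)) (r : Fin n → ℝ) (t : ℝ),
        (∀ i, 0 ≤ r i) →
        (Pairwise fun i j => Disjoint (Metric.closedBall (c i) (r i))
          (Metric.closedBall (c j) (r j))) →
        1 < t →
        ∃ G : SimpleGraph (Fin n),
          IsImpreciseSpanner t (fun i => Metric.closedBall (c i) (r i)) G ∧
          (G.edgeSet.ncard : ℝ) ≤ C * ((n : ℝ) + n / (t - 1) ^ d) ∧
          ∃ (s : RealRAM.State) (k : ℕ),
            RealRAM.Exec P (RealRAM.inputState c r t) s k ∧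
            RealRAM.ListsEdges s.out G ∧
            (k : ℝ) ≤ C * (1 + (n : ℝ) * Real.log n + n / (t - 1) ^ d) := by
  set B : ℝ := 2 * ((234 * d) ^ d + 4 ^ d) with hB
  have hB0 : 0 ≤ B := by positivity
  set K₁ : ℕ := 100 * (d * d) + 800 * d + 900 with hK₁
  set K₂ : ℕ := 20 * d + 114 with hK₂
  refine ⟨10 + 2 * B + 9 * K₁ + 4 * (K₂ * B), RealRAM.spanner d, ?_⟩
  intro n c r t hr hdis ht
  have ht1 : 0 < t - 1 := by linarith
  have hlog : 0 ≤ (n : ℝ) * Real.log n := by positivity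
  have hdiv : 0 ≤ (n : ℝ) / (t - 1) ^ d := by positivity
  have hK1 : (0 : ℝ) ≤ K₁ := Nat.cast_nonneg _
  have hK2 : (0 : ℝ) ≤ K₂ * B := mul_nonneg (Nat.cast_nonneg _) hB0
  by_cases hn : 1 < n
  -- In dimension `0` all centres coincide, so two balls cannot be disjoint.
  · have hd : 0 < d := by
      rcases Nat.eq_zero_or_pos d with rfl | h
      · exfalso
        have h1 := hdis (i := ⟨0, by omega⟩) (j := ⟨1, hn⟩) (by simp)
        refine Set.disjoint_left.1 h1 (Metric.mem_closedBall_self (hr _)) ?_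
        rw [Subsingleton.elim (c ⟨0, _⟩) (c ⟨1, hn⟩)]
        exact Metric.mem_closedBall_self (hr _)
      · exact h
    set s₀ := RealRAM.inputState c r t with hs₀
    have hpt : ∀ i : Fin n, pt d s₀.rarr i = c i := by
      intro i
      ext k
      simp [pt, hs₀, RealRAM.inputState]
    have hrad : ∀ i : Fin n, s₀.rarr d i = r i := by
      intro i
      simp [hs₀, RealRAM.inputState]
    have hap : ∀ i < n, ∀ j < n, i ≠ j →
        s₀.rarr d i + s₀.rarr d j < dist (pt d s₀.rarr i) (pt d s₀.rarr j) := by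
      intro i hi j hj hij
      have h1 := hdis (i := ⟨i, hi⟩) (j := ⟨j, hj⟩) fun g => hij (congrArg Fin.val g)
      replace h1 := (disjoint_closedBall_closedBall_iff (hr _) (hr _)).1 h1
      rw [hrad ⟨i, hi⟩, hrad ⟨j, hj⟩, hpt ⟨i, hi⟩, hpt ⟨j, hj⟩]
      exact h1
    obtain ⟨s, k, hexec, J, S, Q, kap, mid, EL, RHO, XC, REP, QU, QV, head, hT, hq, hk⟩ :=
      RealRAM.listSpanner_spec (s := s₀) hd (show 0 < n by omega) (by simp [hs₀, RealRAM.inputState])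
        (by simp [hs₀, RealRAM.inputState]) (by simp [hs₀, RealRAM.inputState])
        (by simp [hs₀, RealRAM.inputState]) (by simp [hs₀, RealRAM.inputState])
        (by simpa [hs₀, RealRAM.inputState] using ht) hap fun i hi => by
          rw [hrad ⟨i, hi⟩]
          exact hr _
    have hrr : s₀.rreg 0 = t := by simp [hs₀, RealRAM.inputState]
    rw [hrr] at hq hk
    set N := (crossings d J S Q EL RHO XC (18 * d / (min t 2 - 1))).card with hN
    have hτ : 18 * (d : ℝ) ≤ 18 * d / (min t 2 - 1) := by
      have h1 : 1 < min t 2 := lt_min ht (by norm_num)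
      have h2 : min t 2 ≤ 2 := min_le_right _ _
      rw [le_div_iff₀ (by linarith)]
      exact mul_le_of_le_one_right (by positivity) (by linarith)
    have hNle : (N : ℝ) ≤ B * (n + n / (t - 1) ^ d) :=
      crossing_bound_le d n ht (hT.card_crossings_le hτ hd)
    refine ⟨listGraph n s.out, fun p hp => hT.isSpanner ht hq fun i => ?_, ?_, s,
      k + 4, ?_, hT.listsEdges hq, ?_⟩
    · rw [hpt, hrad]
      exact hp i
    · have h1 := ncard_listGraph_le n s.out
      have h2 := hq.length
      have h3 := hq.tail_le
      have h4 := hT.J_lt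
      have h5 : ((listGraph n s.out).edgeSet.ncard : ℝ) ≤ n + 2 * N := by
        exact_mod_cast (show (listGraph n s.out).edgeSet.ncard ≤ n + 2 * N by omega)
      exact edge_count_le h5 hNle (by linarith) (by linarith [Nat.cast_nonneg (α := ℝ) n]) hK1 hK2
    · have hb : (RealRAM.Test.nlt (.const 1) (.reg 0)).Holds s₀ := by
        simpa [hs₀, RealRAM.inputState] using hn
      have := RealRAM.Exec.iteTrue (Q := .skip) hb hexec
      rwa [show (RealRAM.Test.nlt (.const 1) (.reg 0)).cost + k + 1 = k + 4 by
        simp only [RealRAM.Test.cost, RealRAM.NExp.cost]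
        omega] at this
    · have h1 := sort_cost_le hn
      have h2 : (k : ℝ) ≤ K₁ * (((n + 1) * (Nat.clog 2 n + 1) : ℕ) : ℝ) + K₂ * (2 * N) := by
        exact_mod_cast hk
      have hln : (n : ℝ) ≤ 2 * (n * Real.log n) := le_two_mul_log hn
      push_cast
      have h3 := time_le h2 h1 hNle hln hlog hdiv hB0 hK1 (Nat.cast_nonneg _)
      linarith
  -- With at most one ball the empty graph does, and the program stops after `5` time units; this is
  -- what the summand `1` in the time bound is for.
  · have hsub : Subsingleton (Fin n) := Fin.subsingleton_iff_le_one.2 (by omega)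
    refine ⟨⊥, fun p _ i j hij => absurd (congrArg p (Subsingleton.elim i j)) hij, ?_,
      RealRAM.inputState c r t, 5, ?_, ⟨?_, ?_, ?_⟩, ?_⟩
    · simp only [SimpleGraph.edgeSet_bot, Set.ncard_empty, Nat.cast_zero]
      positivity
    · have hb : ¬ (RealRAM.Test.nlt (.const 1) (.reg 0)).Holds (RealRAM.inputState c r t) := by
        simpa [RealRAM.inputState] using hn
      exact RealRAM.Exec.iteFalse (P := RealRAM.listSpanner d) hb (.skip _)
    · simp [RealRAM.inputState]
    · simp [RealRAM.inputState]
    · simp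
    · have h := time_le (k := 0) (W := 0) (N := 0) (n := 0) (X := K₁) (Y := K₂) (by simp)
        (by linarith) (mul_nonneg hB0 (by linarith)) (by linarith) hlog hdiv hB0 hK1
        (Nat.cast_nonneg _)
      push_cast at h ⊢
      rwa [zero_add] at h
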